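/- Let \(W(x,y)\) be a real polynomial of degree \(N\ge 4\) such that \(W(x,y)>0\) for all \((x,y)\in\mathbb R^2\) and its homogeneous part \(W_N\) of degree \(N\) is positive definite. For \(c\in\mathbb R\) put \[A=x(2x^2+2y^2+1),\qquad B=y(2x^2+2y^2-1),\qquad C=(x^2+y^2)^2+x^2-y^2-c,\] and consider the system \[\frac{dx}{dt}=AC-BW,\qquad \frac{dy}{dt}=BC+AW .\] Then for every \(c\in\mathbb R\) the phase portrait is the one Poincaré described for his fifth example (P5): 1. The equilibria in the plane are exactly \((0,0)\) and \((0,\pm1/\sqrt2)\). The origin is a saddle (the linearization has one negative and one positive eigenvalue). The points \((0,\pm1/\sqrt2)\) are unstable spirals if \(c\le-1/4\) and stable spirals if \(c>-1/4\). Here a stable spiral is a Lyapunov stable equilibrium such that along all nearby trajectories, in polar coordinates \((r,\theta)\) centred at it, \(r\to0\) and \(|\theta|\to\infty\) as \(t\to\infty\); an unstable spiral is a stable spiral of the time-reversed system. 2. The curve \(\{C=0\}\) is invariant. If \(c\le -1/4\), there are no cycles (nonconstant periodic orbits) in the plane. If \(-1/4<c<0\), the cycles in the plane are exactly \(\{C=0,\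 y>0\}\) and \(\{C=0,\ y<0\}\), whose union is \(\{C=0\}\); they are repelling limit cycles, the first surrounding \((0,1/\sqrt2)\) and neither of the other equilibria, the second surrounding \((0,-1/\sqrt2)\) and neither of the other equilibria. If \(c=0\), there are no cycles in the plane, and the homoclinic orbits are exactly \(\{C=0,\ y>0\}\) and \(\{C=0,\ y<0\}\); both are homoclinic to the origin, together with the origin they form \(\{C=0\}\), and the closed loop formed by the first (second) orbit and the origin surrounds \((0,1/\sqrt2)\) but not \((0,-1/\sqrt2)\) (respectively \((0,-1/\sqrt2)\) but not \((0,1/\sqrt2)\)). If \(c>0\), the only cycle in the plane is \(\{C=0\}\); it is a repelling limit cycle, symmetric about the origin, and surrounds all three equilibria. If \(c\ne0\), there are no homoclinic orbits. 3. There is an attracting limit cycle at infinity: for the vector field that the system induces on the closed upper hemisphere of the Poincaré sphere (after the usual change of time scale that leaves the equator invariant), the equator is a periodic orbit, and it is the \(\omega\)-limit set of every trajectory starting in some neighbourhood of the equator in the closed hemisphere. A limit cycle in the plane is called repelling if, for the time-reversed system, it is the \(\omega\)-limit set of every trajectory starting in some neighbourhood of it. In particular all of this holds for the system R5, in which \(W=x^4+y^4+1\).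 -/

import Mathlib

open Set Filter Topology

noncomputable section

/-! ### Autonomous vector fields and their orbits

All vector fields below are polynomial, so that solutions of initial value problems are unique.
Hence a condition on the solution `γ` through a point `q` is stated as the existence of such a
solution with the required properties. -/

section General

variable {E : Type*} [NormedAddCommGroup E] [NormedSpace ℝ E]

/-- `γ` is a solution of `γ' = F γ` on the time set `s`. -/
def SolvesOn (F : E → E) (γ : ℝ → E) (s : Set ℝ) : Prop :=
  IsIntegralCurveOn γ (fun _ => F) s

/-- The ω-limit set of a curve. -/
def omegaSet (γ : ℝ → E) : Set E := {z | MapClusterPt z atTop γ}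

/-- `Γ` is a cycle of `F`: the orbit of a nonconstant periodic solution. -/
def IsCycle (F : E → E) (Γ : Set E) : Prop :=
  ∃ (γ : ℝ → E) (T : ℝ), SolvesOn F γ univ ∧ 0 < T ∧ Function.Periodic γ T ∧
    (∃ t, γ t ≠ γ 0) ∧ Γ = range γ

/-- `Γ` is an attracting limit cycle of `F` in the phase space `S`: a cycle which is the
ω-limit set of every trajectory starting in some neighbourhood of `Γ` in `S`. -/
def IsAttractingLimitCycle (F : E → E) (S Γ : Set E) : Prop :=
  Γ ⊆ S ∧ IsCycle F Γ ∧
    ∃ U, IsOpen U ∧ Γ ⊆ U ∧ ∀ q ∈ U ∩ S, ∃ γ : ℝ → E,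
      γ 0 = q ∧ SolvesOn F γ (Ici 0) ∧ (∀ t, 0 ≤ t → γ t ∈ S) ∧ omegaSet γ = Γ

/-- A repelling limit cycle is an attracting one for the time-reversed field. -/
def IsRepellingLimitCycle (F : E → E) (S Γ : Set E) : Prop :=
  IsAttractingLimitCycle (fun v => -F v) S Γ

/-- `Γ` is a homoclinic orbit of `F` at `p`: the orbit of a solution other than the constant `p`
which tends to `p` in both time directions. -/
def IsHomoclinicOrbit (F : E → E) (p : E) (Γ : Set E) : Prop :=
  F p = 0 ∧ ∃ γ : ℝ → E, SolvesOn F γ univ ∧ (∃ t, γ t ≠ p) ∧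
    Tendsto γ atTop (𝓝 p) ∧ Tendsto γ atBot (𝓝 p) ∧ Γ = range γ

end General

/-! ### Planar notions -/

/-- `p` is a saddle: an equilibrium at which the linearization has one negative and one positive
eigenvalue. -/
def IsSaddle (F : (Fin 2 → ℝ) → (Fin 2 → ℝ)) (p : Fin 2 → ℝ) : Prop :=
  F p = 0 ∧ DifferentiableAt ℝ F p ∧ ∃ a b : ℝ, a < 0 ∧ 0 < b ∧
    Module.End.HasEigenvalue (fderiv ℝ F p : (Fin 2 → ℝ) →ₗ[ℝ] (Fin 2 → ℝ)) a ∧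
    Module.End.HasEigenvalue (fderiv ℝ F p : (Fin 2 → ℝ) →ₗ[ℝ] (Fin 2 → ℝ)) b

/-- `p` is a stable spiral (stable focus): a Lyapunov stable equilibrium such that all nearby
trajectories, written in polar coordinates `(r, θ)` centred at `p` with `θ` continuous in time,
satisfy `r → 0` and `|θ| → ∞` as `t → ∞`. -/
def IsStableSpiral (F : (Fin 2 → ℝ) → (Fin 2 → ℝ)) (p : Fin 2 → ℝ) : Prop :=
  F p = 0 ∧ ∀ U ∈ 𝓝 p, ∃ V ∈ 𝓝 p, ∀ q ∈ V, q ≠ p →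
    ∃ (γ : ℝ → Fin 2 → ℝ) (r θ : ℝ → ℝ),
      γ 0 = q ∧ SolvesOn F γ (Ici 0) ∧ (∀ t, 0 ≤ t → γ t ∈ U) ∧
      ContinuousOn θ (Ici 0) ∧
      (∀ t, 0 ≤ t → 0 < r t ∧ γ t = p + r t • ![Real.cos (θ t), Real.sin (θ t)]) ∧
      Tendsto r atTop (𝓝 0) ∧ Tendsto (fun t => |θ t|) atTop atTop

/-- An unstable spiral is a stable one for the time-reversed field. -/
def IsUnstableSpiral (F : (Fin 2 → ℝ) → (Fin 2 → ℝ)) (p : Fin 2 → ℝ) : Prop :=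
  IsStableSpiral (fun v => -F v) p

/-- The closed curve `Γ` surrounds `p`: `p` lies in a bounded component of the complement. -/
def Surrounds (Γ : Set (Fin 2 → ℝ)) (p : Fin 2 → ℝ) : Prop :=
  p ∉ Γ ∧ Bornology.IsBounded (connectedComponentIn Γᶜ p)

/-! ### Polynomial systems and their compactification on the Poincaré sphere -/

open MvPolynomial in
/-- The vector field `x' = P(x, y)`, `y' = Q(x, y)`. -/
def planarField (P Q : MvPolynomial (Fin 2) ℝ) (v : Fin 2 → ℝ) : Fin 2 → ℝ :=
  ![eval v P, eval v Q]

open MvPolynomial in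
/-- The homogenization `Z ^ m * P (X / Z, Y / Z)` in degree `m` of a polynomial of degree at most
`m`, as a function of `(X, Y, Z)`. -/
def homogenized (m : ℕ) (P : MvPolynomial (Fin 2) ℝ) (u : Fin 3 → ℝ) : ℝ :=
  ∑ i ∈ Finset.range (m + 1), u 2 ^ (m - i) * eval ![u 0, u 1] (homogeneousComponent i P)

/-- The vector field on the Poincaré sphere of the system `x' = P`, `y' = Q` of degree
`m = max (deg P) (deg Q)`: with `P*, Q*` the homogenizations in degree `m`, the tangential part
`(P*, Q*, 0) - (X P* + Y Q*) (X, Y, Z)` of `(P*, Q*, 0)`. On the open upper hemisphere it is the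
image of the planar field under central projection `(x, y) ↦ (x, y, 1) / √(1 + x² + y²)`,
multiplied by the positive factor `Z ^ (m - 1)` (a change of time scale). On the equator `Z = 0`
it is `(X Q_m - Y P_m) (-Y, X, 0)`, with `P_m, Q_m` the parts of degree `m`. -/
def poincareField (P Q : MvPolynomial (Fin 2) ℝ) (u : Fin 3 → ℝ) : Fin 3 → ℝ :=
  let m := max P.totalDegree Q.totalDegree
  let p := homogenized m P u
  let q := homogenized m Q u
  ![p, q, 0] - (u 0 * p + u 1 * q) • u

/-- The closed upper hemisphere: the plane together with its points at infinity. -/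
def hemisphere : Set (Fin 3 → ℝ) := {u | u 0 ^ 2 + u 1 ^ 2 + u 2 ^ 2 = 1 ∧ 0 ≤ u 2}

/-- The equator: the points at infinity. -/
def equator : Set (Fin 3 → ℝ) := {u | u 0 ^ 2 + u 1 ^ 2 = 1 ∧ u 2 = 0}

/-- The equator is an attracting limit cycle of the compactified system. -/
def HasAttractingLimitCycleAtInfinity (P Q : MvPolynomial (Fin 2) ℝ) : Prop :=
  IsAttractingLimitCycle (poincareField P Q) hemisphere equator

/-! ### The modified fifth example of Poincaré -/

open MvPolynomial in
/-- `A = x (2x² + 2y² + 1)`. -/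
def polyA : MvPolynomial (Fin 2) ℝ := X 0 * (2 * X 0 ^ 2 + 2 * X 1 ^ 2 + 1)

open MvPolynomial in
/-- `B = y (2x² + 2y² - 1)`. -/
def polyB : MvPolynomial (Fin 2) ℝ := X 1 * (2 * X 0 ^ 2 + 2 * X 1 ^ 2 - 1)

open MvPolynomial in
/-- `(x² + y²)² + x² - y² - c`. -/
def polyC (c : ℝ) : MvPolynomial (Fin 2) ℝ :=
  (X 0 ^ 2 + X 1 ^ 2) ^ 2 + X 0 ^ 2 - X 1 ^ 2 - C c

/-- The right-hand side `A C - B W` of the equation for `x'`. -/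
def p5X (W : MvPolynomial (Fin 2) ℝ) (c : ℝ) : MvPolynomial (Fin 2) ℝ :=
  polyA * polyC c - polyB * W

/-- The right-hand side `B C + A W` of the equation for `y'`. -/
def p5Y (W : MvPolynomial (Fin 2) ℝ) (c : ℝ) : MvPolynomial (Fin 2) ℝ :=
  polyB * polyC c + polyA * W

open MvPolynomial in
/-- The factor `x⁴ + y⁴ + 1` of the system R5. -/
def weightR5 : MvPolynomial (Fin 2) ℝ := X 0 ^ 4 + X 1 ^ 4 + 1

/-- The curve `(x² + y²)² + x² - y² - c = 0`. -/
def curveC (c : ℝ) : Set (Fin 2 → ℝ) := {v | MvPolynomial.eval v (polyC c) = 0}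

/-- The point `(0, 1/√2)`. -/
def upperPoint : Fin 2 → ℝ := ![0, 1 / √2]

/-- The point `(0, -1/√2)`. -/
def lowerPoint : Fin 2 → ℝ := ![0, -(1 / √2)]

/-- The system `x' = P`, `y' = Q` has the phase portrait which Poincaré describes for his fifth
example with parameter `c`; the lists of equilibria, cycles and homoclinic orbits in the plane
are complete. -/
structure HasPortraitP5 (P Q : MvPolynomial (Fin 2) ℝ) (c : ℝ) : Prop where
  equilibria : ∀ v, planarField P Q v = 0 ↔ v = 0 ∨ v = upperPoint ∨ v = lowerPoint
  saddle : IsSaddle (planarField P Q) 0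
  unstable_spirals : c ≤ -1 / 4 →
    IsUnstableSpiral (planarField P Q) upperPoint ∧
    IsUnstableSpiral (planarField P Q) lowerPoint
  stable_spirals : -1 / 4 < c →
    IsStableSpiral (planarField P Q) upperPoint ∧
    IsStableSpiral (planarField P Q) lowerPoint
  /-- The curve `C = 0` is invariant. -/
  invariant : ∀ (γ : ℝ → Fin 2 → ℝ) (s : Set ℝ), s.OrdConnected →
    SolvesOn (planarField P Q) γ s → ∀ t₀ ∈ s, γ t₀ ∈ curveC c → ∀ t ∈ s, γ t ∈ curveC c
  /-- For `c ≤ -1/4` there are no cycles in the plane. -/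
  no_cycle : c ≤ -1 / 4 → ∀ Γ, ¬ IsCycle (planarField P Q) Γ
  /-- For `-1/4 < c < 0` the upper and the lower half of the curve `C = 0` are repelling limit
  cycles, each surrounding exactly one of the equilibria, a spiral. There are no other cycles. -/
  two_cycles : -1 / 4 < c → c < 0 →
    (∃ Γ₁ Γ₂ : Set (Fin 2 → ℝ),
      Γ₁ = curveC c ∩ {v | 0 < v 1} ∧ Γ₂ = curveC c ∩ {v | v 1 < 0} ∧ Γ₁ ∪ Γ₂ = curveC c ∧
      IsRepellingLimitCycle (planarField P Q) univ Γ₁ ∧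
      IsRepellingLimitCycle (planarField P Q) univ Γ₂ ∧
      Surrounds Γ₁ upperPoint ∧ ¬ Surrounds Γ₁ lowerPoint ∧ ¬ Surrounds Γ₁ 0 ∧
      Surrounds Γ₂ lowerPoint ∧ ¬ Surrounds Γ₂ upperPoint ∧ ¬ Surrounds Γ₂ 0 ∧
      ∀ Γ, IsCycle (planarField P Q) Γ → Γ = Γ₁ ∨ Γ = Γ₂)
  /-- For `c = 0` there are exactly two homoclinic orbits. They branch from the saddle at the
  origin, together with it they form the lemniscate `C = 0`, and the loops they form with it
  surround one spiral each. There are no cycles. -/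
  two_homoclinic : c = 0 →
    (∃ Γ₁ Γ₂ : Set (Fin 2 → ℝ),
      Γ₁ = curveC c ∩ {v | 0 < v 1} ∧ Γ₂ = curveC c ∩ {v | v 1 < 0} ∧
      insert 0 (Γ₁ ∪ Γ₂) = curveC c ∧
      IsHomoclinicOrbit (planarField P Q) 0 Γ₁ ∧
      IsHomoclinicOrbit (planarField P Q) 0 Γ₂ ∧
      Surrounds (insert 0 Γ₁) upperPoint ∧ ¬ Surrounds (insert 0 Γ₁) lowerPoint ∧
      Surrounds (insert 0 Γ₂) lowerPoint ∧ ¬ Surrounds (insert 0 Γ₂) upperPoint ∧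
      (∀ p Γ, IsHomoclinicOrbit (planarField P Q) p Γ → p = 0 ∧ (Γ = Γ₁ ∨ Γ = Γ₂)) ∧
      ∀ Γ, ¬ IsCycle (planarField P Q) Γ)
  /-- For `c > 0` the curve `C = 0` is a repelling limit cycle, symmetric about the origin,
  which surrounds all three equilibria. There are no other cycles. -/
  one_cycle : 0 < c →
    IsRepellingLimitCycle (planarField P Q) univ (curveC c) ∧
    (∀ v ∈ curveC c, -v ∈ curveC c) ∧
    Surrounds (curveC c) 0 ∧ Surrounds (curveC c) upperPoint ∧
    Surrounds (curveC c) lowerPoint ∧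
    ∀ Γ, IsCycle (planarField P Q) Γ → Γ = curveC c
  no_homoclinic : c ≠ 0 → ∀ p Γ, ¬ IsHomoclinicOrbit (planarField P Q) p Γ
  infinity : HasAttractingLimitCycleAtInfinity P Q

end

/-! Put H = (x² + y²)² + x² - y², so that (A, B) = ½∇H and C = H - c. The field is C·(A, B) + W·(-B,
A): a gradient part crossing the level curves of H and a Hamiltonian part running along them. In the
derivative of C the factor W drops out, leaving C' = 2(A² + B²)C. Thus C = 0 is invariant, C keeps
its sign, and C² is nondecreasing. Since W > 0, the equilibria are the common zeros of A and B: the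
saddle 0, at level 0, and two minima of H, at level -1/4.

Periodicity, or equal limits at both ends of time, forces the monotone C² to be constant. Hence
cycles and homoclinic orbits lie on C = 0 and avoid the equilibria, and the classification reduces
to the level curve H = c (`level_of_isCycle`, `level_of_homoclinic`).

That these curves are cycles is shown without Poincaré–Bendixson. For c > 0 the curve is star-shaped
about the origin; for -1/4 < c < 0 each half is star-shaped about its spiral point
(`star_spiralPoint`). On C = 0 the angular velocity is W times a positive function, bounded below by
compactness, so a solution makes full turns and closes up (`isCycle_of_rotation`). With time
reversed, C² is a Lyapunov function in a narrow band around the cycle, which makes the cycle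
repelling. For c = 0 the slope u = x/y on half of the lemniscate obeys a scalar equation u' = -W(1 -
u²), so it runs from 1 to -1 and both ends tend to the origin.

At a spiral point H + 1/4 is a Lyapunov function, after time reversal if c ≤ -1/4. Near the point
the Hamiltonian part dominates the rotation, so the angle grows at least linearly
(`isStableSpiral_spiralPoint`).

At infinity, 1/C becomes Z⁴/C* in homogeneous coordinates. This function vanishes on the equator and
decreases nearby, while positive definiteness of the top part of W makes the equator rotate
(`isAttractingLimitCycle_equator`, `isCycle_equator`).

Polynomial fields need not have complete flows. Solutions are therefore constructed for the field
times a cutoff, and shown to stay where the cutoff equals 1. -/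

noncomputable section

/-! ### Global solutions, uniqueness and orbits -/

section GlobalSolutions

open scoped NNReal

variable {E : Type*} [NormedAddCommGroup E] [NormedSpace ℝ E]

/-- On [-(n+1), n+1] a field bounded by L moves a point by at most L(n+1), so Picard–Lindelöf
applies on a ball of that radius. By uniqueness the local solutions glue. -/
theorem exists_global_solution_of_bounded_of_lipschitz [CompleteSpace E] {F : E → E} {L K : ℝ≥0}
    (hb : ∀ x, ‖F x‖ ≤ L) (hl : LipschitzWith K F) (q : E) :
    ∃ γ : ℝ → E, γ 0 = q ∧ ∀ t, HasDerivAt γ (F (γ t)) t := by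
  have hex : ∀ n : ℕ, ∃ α : ℝ → E, α 0 = q ∧
      ∀ t ∈ Icc (-((n : ℝ) + 1)) (n + 1),
        HasDerivWithinAt α (F (α t)) (Icc (-((n : ℝ) + 1)) (n + 1)) t := by
    intro n
    have hn : (0 : ℝ) ≤ n := n.cast_nonneg
    have h0 : (0 : ℝ) ∈ Icc (-((n : ℝ) + 1)) (n + 1) := ⟨by linarith, by linarith⟩
    have hpl : IsPicardLindelof (fun _ => F) (⟨0, h0⟩ : Icc (-((n : ℝ) + 1)) (n + 1)) q
        (L * (n + 1)) 0 L K :=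
      IsPicardLindelof.of_time_independent (fun x _ => hb x) hl.lipschitzOnWith (by simp)
    exact hpl.exists_eq_forall_mem_Icc_hasDerivWithinAt₀
  choose α hα0 hα using hex
  have hder : ∀ (n : ℕ) (t : ℝ), |t| < n + 1 → HasDerivAt (α n) (F (α n t)) t := by
    intro n t ht
    rw [abs_lt] at ht
    exact (hα n t ⟨ht.1.le, ht.2.le⟩).hasDerivAt (Icc_mem_nhds ht.1 ht.2)
  have hagree : ∀ (n m : ℕ) (t : ℝ), |t| < n + 1 → |t| < m + 1 → α n t = α m t := by
    intro n m t hn hm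
    have hlt : |t| < min ((n : ℝ) + 1) (m + 1) := lt_min hn hm
    have hpos : 0 < min ((n : ℝ) + 1) (m + 1) := lt_of_le_of_lt (abs_nonneg t) hlt
    refine ODE_solution_unique_of_mem_Ioo (v := fun _ => F) (s := fun _ => univ) (K := K)
      (a := -min ((n : ℝ) + 1) (m + 1)) (b := min ((n : ℝ) + 1) (m + 1)) (t₀ := 0)
      (fun _ _ => hl.lipschitzOnWith) ⟨by linarith, hpos⟩ ?_ ?_ (by rw [hα0, hα0])
      (abs_lt.mp hlt)
    · exact fun s hs => ⟨hder n s (lt_of_lt_of_le (abs_lt.mpr hs) (min_le_left _ _)), trivial⟩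
    · exact fun s hs => ⟨hder m s (lt_of_lt_of_le (abs_lt.mpr hs) (min_le_right _ _)), trivial⟩
  -- The index ⌈|t|⌉₊ puts t strictly inside the interval, as a two-sided derivative requires.
  refine ⟨fun t => α ⌈|t|⌉₊ t, by simp [hα0], fun t => ?_⟩
  have hceil : ∀ s : ℝ, |s| < (⌈|s|⌉₊ : ℝ) + 1 := fun s => by
    have := Nat.le_ceil |s|
    linarith
  have heq : (fun t => α ⌈|t|⌉₊ t) =ᶠ[𝓝 t] α ⌈|t|⌉₊ := by
    have : ∀ᶠ s in 𝓝 t, |s| < (⌈|t|⌉₊ : ℝ) + 1 :=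
      (continuous_abs.tendsto t).eventually (gt_mem_nhds (hceil t))
    filter_upwards [this] with s hs
    exact hagree _ _ s (hceil s) hs
  exact (hder _ t (hceil t)).congr_of_eventuallyEq heq

/-- A `C¹` field, multiplied by a cutoff function, has complete flow. -/
theorem exists_cutoff_solution [FiniteDimensional ℝ E] {F : E → E} (hF : ContDiff ℝ 1 F) (q : E)
    (R : ℝ) :
    ∃ χ : E → ℝ, ContDiff ℝ 1 χ ∧ (∀ x, 0 ≤ χ x) ∧ (∀ x, ‖x‖ ≤ R → χ x = 1) ∧
      ∃ γ : ℝ → E, γ 0 = q ∧ ∀ t, HasDerivAt γ (χ (γ t) • F (γ t)) t := by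
  let f : ContDiffBump (0 : E) := ⟨|R| + 1, |R| + 2, by positivity, by linarith⟩
  have hcd : ContDiff ℝ 1 (fun x => f x • F x) := f.contDiff.smul hF
  have hcs : HasCompactSupport (fun x => f x • F x) := f.hasCompactSupport.smul_right
  obtain ⟨K, hK⟩ := hcd.lipschitzWith_of_hasCompactSupport hcs one_ne_zero
  obtain ⟨L, hL⟩ := hcs.exists_bound_of_continuous hcd.continuous
  have hL' : ∀ x, ‖f x • F x‖ ≤ (Real.toNNReal L : ℝ) := fun x =>
    (hL x).trans (Real.le_coe_toNNReal L)
  refine ⟨f, f.contDiff, f.nonneg', fun x hx => f.one_of_mem_closedBall ?_,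
    exists_global_solution_of_bounded_of_lipschitz hL' hK q⟩
  rw [mem_closedBall_zero_iff]
  have := le_abs_self R
  change ‖x‖ ≤ |R| + 1
  linarith

theorem exists_lipschitzOnWith_closedBall [FiniteDimensional ℝ E] {F : E → E}
    (hF : ContDiff ℝ 1 F) (R : ℝ) : ∃ K, LipschitzOnWith K F (Metric.closedBall 0 R) :=
  hF.contDiffOn.exists_lipschitzOnWith one_ne_zero (convex_closedBall 0 R)
    (isCompact_closedBall 0 R)

theorem solution_unique [FiniteDimensional ℝ E] {F : E → E} (hF : ContDiff ℝ 1 F) {γ η : ℝ → E}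
    (hγ : ∀ t, HasDerivAt γ (F (γ t)) t) (hη : ∀ t, HasDerivAt η (F (η t)) t) {t₀ : ℝ}
    (h : γ t₀ = η t₀) : γ = η := by
  funext t
  set T := |t| + |t₀| + 1 with hT
  have cγ : Continuous γ := continuous_iff_continuousAt.mpr fun t => (hγ t).continuousAt
  have cη : Continuous η := continuous_iff_continuousAt.mpr fun t => (hη t).continuousAt
  obtain ⟨R₁, hR₁⟩ := (isCompact_Icc.image cγ).isBounded.subset_closedBall (0 : E) (s := γ '' Icc (-T) T)
  obtain ⟨R₂, hR₂⟩ := (isCompact_Icc.image cη).isBounded.subset_closedBall (0 : E) (s := η '' Icc (-T) T)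
  obtain ⟨K, hK⟩ := exists_lipschitzOnWith_closedBall hF (max R₁ R₂)
  have hm : ∀ s : ℝ, |s| ≤ |t| + |t₀| → s ∈ Ioo (-T) T := fun s hs =>
    abs_lt.mp (by linarith)
  refine ODE_solution_unique_of_mem_Ioo (v := fun _ => F) (K := K)
    (s := fun _ => Metric.closedBall 0 (max R₁ R₂)) (fun _ _ => hK)
    (hm t₀ (by linarith [abs_nonneg t])) ?_ ?_ h (hm t (by linarith [abs_nonneg t₀]))
  · exact fun s hs => ⟨hγ s, Metric.closedBall_subset_closedBall (le_max_left _ _)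
      (hR₁ (mem_image_of_mem _ (Ioo_subset_Icc_self hs)))⟩
  · exact fun s hs => ⟨hη s, Metric.closedBall_subset_closedBall (le_max_right _ _)
      (hR₂ (mem_image_of_mem _ (Ioo_subset_Icc_self hs)))⟩

theorem solution_eq_const [FiniteDimensional ℝ E] {F : E → E} (hF : ContDiff ℝ 1 F) {γ : ℝ → E}
    (hγ : ∀ t, HasDerivAt γ (F (γ t)) t) {t₀ : ℝ} (h : F (γ t₀) = 0) (t : ℝ) : γ t = γ t₀ :=
  congrFun (solution_unique hF (η := fun _ => γ t₀) hγ
    (fun t => by simpa only [h] using hasDerivAt_const t (γ t₀)) rfl) t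

theorem solution_shift {F : E → E} {γ : ℝ → E} (hγ : ∀ t, HasDerivAt γ (F (γ t)) t) (a t : ℝ) :
    HasDerivAt (fun s => γ (s + a)) (F (γ (t + a))) t :=
  (hγ (t + a)).comp_add_const t a

theorem solution_reverse {F : E → E} {γ : ℝ → E} (hγ : ∀ t, HasDerivAt γ (F (γ t)) t) (t : ℝ) :
    HasDerivAt (fun s => γ (-s)) (-F (γ (-t))) t := by
  simpa [Function.comp_def] using (hγ (-t)).scomp t (hasDerivAt_neg t)

/-- Two orbits with a common point coincide. -/
theorem range_eq_of_mem_range [FiniteDimensional ℝ E] {F : E → E} (hF : ContDiff ℝ 1 F)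
    {γ η : ℝ → E} (hγ : ∀ t, HasDerivAt γ (F (γ t)) t) (hη : ∀ t, HasDerivAt η (F (η t)) t)
    {t₀ : ℝ} (h : γ t₀ ∈ range η) : ∃ a, γ = (fun t => η (t + a)) ∧ range γ = range η := by
  obtain ⟨s, hs⟩ := h
  have : γ = fun t => η (t + (s - t₀)) :=
    solution_unique hF hγ (solution_shift hη (s - t₀)) (t₀ := t₀) (by simp [hs])
  refine ⟨s - t₀, this, ?_⟩
  rw [this]
  exact (Equiv.addRight (s - t₀)).surjective.range_comp η

theorem solvesOn_univ_iff {F : E → E} {γ : ℝ → E} :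
    SolvesOn F γ univ ↔ ∀ t, HasDerivAt γ (F (γ t)) t :=
  isIntegralCurveOn_univ

theorem solvesOn_of_hasDerivAt {F : E → E} {γ : ℝ → E} {s : Set ℝ}
    (h : ∀ t ∈ s, HasDerivAt γ (F (γ t)) t) : SolvesOn F γ s :=
  fun t ht => (h t ht).hasDerivWithinAt

end GlobalSolutions

/-! ### Scalar linear equations and inequalities -/

section Comparison

/-- A primitive of a continuous function. -/
theorem hasDerivAt_primitive {a : ℝ → ℝ} (ha : Continuous a) (t : ℝ) :
    HasDerivAt (fun t => ∫ s in (0 : ℝ)..t, a s) (a t) t :=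
  intervalIntegral.integral_hasDerivAt_right (ha.intervalIntegrable _ _)
    (ha.stronglyMeasurableAtFilter _ _) ha.continuousAt

/-- The integrating factor exp(-∫a) turns g into an antitone function on t ≥ 0; the sign of a plays
no role. -/
theorem nonpos_of_deriv_le_mul {g g' a : ℝ → ℝ} (ha : Continuous a)
    (hg : ∀ t, HasDerivAt g (g' t) t) (h : ∀ t, 0 ≤ t → g' t ≤ a t * g t) (h0 : g 0 ≤ 0)
    {t : ℝ} (ht : 0 ≤ t) : g t ≤ 0 := by
  set I : ℝ → ℝ := fun t => ∫ s in (0 : ℝ)..t, a s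
  have hI : ∀ t, HasDerivAt I (a t) t := hasDerivAt_primitive ha
  have hd : ∀ t, HasDerivAt (fun t => g t * Real.exp (-I t))
      (g' t * Real.exp (-I t) + g t * (Real.exp (-I t) * (-a t))) t := fun t =>
    (hg t).mul (hI t).neg.exp
  have hanti : AntitoneOn (fun t => g t * Real.exp (-I t)) (Ici 0) := by
    refine antitoneOn_of_hasDerivWithinAt_nonpos (convex_Ici 0)
      (fun t _ => (hd t).continuousAt.continuousWithinAt) (fun t _ => (hd t).hasDerivWithinAt) ?_
    intro t ht
    rw [interior_Ici] at ht
    have h1 := h t (le_of_lt ht)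
    have h2 := Real.exp_pos (-I t)
    nlinarith
  have h1 := hanti (mem_Ici.mpr le_rfl) ht ht
  have h2 : I 0 = 0 := by simp [I]
  simp only [h2, neg_zero, Real.exp_zero, mul_one] at h1
  have h3 := Real.exp_pos (-I t)
  by_contra! hcon
  nlinarith [mul_pos hcon h3]

/-- The solution formula for the scalar linear equation `g' = a g`. -/
theorem linear_solution {g a : ℝ → ℝ} (ha : Continuous a)
    (hg : ∀ t, HasDerivAt g (a t * g t) t) :
    ∃ e : ℝ → ℝ, (∀ t, 0 < e t) ∧ ∀ t, g t = g 0 * e t := by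
  set I : ℝ → ℝ := fun t => ∫ s in (0 : ℝ)..t, a s
  have hI : ∀ t, HasDerivAt I (a t) t := hasDerivAt_primitive ha
  have hd : ∀ t, HasDerivAt (fun t => g t * Real.exp (-I t)) 0 t := fun t => by
    have := (hg t).mul (hI t).neg.exp
    convert! this using 1
    ring
  refine ⟨fun t => Real.exp (I t), fun t => Real.exp_pos _, fun t => ?_⟩
  have h1 := is_const_of_deriv_eq_zero (fun t => (hd t).differentiableAt)
    (fun t => (hd t).deriv) t 0
  have h2 : I 0 = 0 := by simp [I]
  simp only [h2, neg_zero, Real.exp_zero, mul_one] at h1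
  rw [← h1, mul_assoc, ← Real.exp_add]
  simp

theorem pos_of_ne_zero_of_pos {g : ℝ → ℝ} (hg : Continuous g) (h0 : 0 < g 0) {t : ℝ} (ht : 0 ≤ t)
    (hne : ∀ s, 0 ≤ s → g s ≠ 0) : 0 < g t := by
  by_contra! hle
  obtain ⟨s, hs, hs0⟩ := intermediate_value_Icc' ht hg.continuousOn ⟨hle, h0.le⟩
  exact hne s hs.1 hs0

theorem pos_of_ne_zero_of_pos' {g : ℝ → ℝ} (hg : Continuous g) (h0 : 0 < g 0)
    (hne : ∀ s, g s ≠ 0) (t : ℝ) : 0 < g t := by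
  rcases le_total 0 t with ht | ht
  · exact pos_of_ne_zero_of_pos hg h0 ht fun s _ => hne s
  · simpa using pos_of_ne_zero_of_pos (g := fun s => g (-s)) (by fun_prop) (by simpa using h0)
      (neg_nonneg.mpr ht) fun s _ => hne (-s)

end Comparison

/-! ### Lyapunov functions and ω-limit sets -/

section Lyapunov

/-- A Lyapunov function tends to zero along a trajectory in a compact set on which its orbital
derivative is negative away from its zeros. -/
theorem tendsto_zero_of_lyapunov {E : Type*} [TopologicalSpace E] [T2Space E] {K : Set E}
    (hK : IsCompact K) {V D : E → ℝ}
    (hV : ContinuousOn V K) (hD : ContinuousOn D K) (hV0 : ∀ v ∈ K, 0 ≤ V v)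
    (hD0 : ∀ v ∈ K, D v ≤ 0) (hDV : ∀ v ∈ K, D v = 0 → V v = 0) {γ : ℝ → E}
    (hγ : ∀ t, 0 ≤ t → γ t ∈ K) (hd : ∀ t, 0 ≤ t → HasDerivAt (fun s => V (γ s)) (D (γ t)) t) :
    Tendsto (fun t => V (γ t)) atTop (𝓝 0) := by
  have hanti : AntitoneOn (fun t => V (γ t)) (Ici 0) := by
    refine antitoneOn_of_hasDerivWithinAt_nonpos (convex_Ici 0)
      (fun t ht => (hd t ht).continuousAt.continuousWithinAt)
      (fun t ht => (hd t (interior_subset ht)).hasDerivWithinAt) ?_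
    exact fun t ht => hD0 _ (hγ t (interior_subset ht))
  rw [Metric.tendsto_atTop]
  intro ε hε
  suffices h : ∃ T, 0 ≤ T ∧ V (γ T) < ε by
    obtain ⟨T, hT, hTε⟩ := h
    refine ⟨T, fun t ht => ?_⟩
    have h1 : V (γ t) ≤ V (γ T) := hanti hT (hT.trans ht) ht
    rw [Real.dist_0_eq_abs, abs_of_nonneg (hV0 _ (hγ t (hT.trans ht)))]
    linarith
  by_contra! hcon
  -- If V stayed above ε, the trajectory would remain in a compact set where D has a negative
  -- maximum, so V would decrease at least linearly and reach 0 in finite time.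
  have hKε : IsCompact (K ∩ V ⁻¹' Ici ε) :=
    hK.of_isClosed_subset (hV.preimage_isClosed_of_isClosed hK.isClosed isClosed_Ici)
      inter_subset_left
  have hmem : ∀ t, 0 ≤ t → γ t ∈ K ∩ V ⁻¹' Ici ε := fun t ht => ⟨hγ t ht, hcon t ht⟩
  obtain ⟨m, hm, hmax⟩ := hKε.exists_isMaxOn ⟨_, hmem 0 le_rfl⟩ (hD.mono inter_subset_left)
  have hmneg : D m < 0 := lt_of_le_of_ne (hD0 m hm.1) fun h => by
    have h1 := hDV m hm.1 h
    have h2 : ε ≤ V m := hm.2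
    linarith
  have hlin : ∀ t, 0 ≤ t → V (γ t) ≤ V (γ 0) + D m * t := by
    intro t ht
    have hanti2 : AntitoneOn (fun t => V (γ t) - D m * t) (Ici 0) := by
      have hdd : ∀ t, 0 ≤ t → HasDerivAt (fun t => V (γ t) - D m * t) (D (γ t) - D m * 1) t :=
        fun t ht => (hd t ht).sub ((hasDerivAt_id t).const_mul (D m))
      refine antitoneOn_of_hasDerivWithinAt_nonpos (convex_Ici 0)
        (fun t ht => (hdd t ht).continuousAt.continuousWithinAt)
        (fun t ht => (hdd t (interior_subset ht)).hasDerivWithinAt) ?_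
      intro t ht
      have h1 : D (γ t) ≤ D m := hmax (hmem t (interior_subset ht))
      linarith
    have := hanti2 (mem_Ici.mpr le_rfl) ht ht
    simp only [mul_zero, sub_zero] at this
    linarith
  have h0 := hcon 0 le_rfl
  have ht : 0 ≤ V (γ 0) / -(D m) := div_nonneg (by linarith) (by linarith)
  have h1 := hlin _ ht
  have h2 := hcon _ ht
  have h3 : D m * (V (γ 0) / -(D m)) = -V (γ 0) := by
    rw [div_neg, mul_neg, mul_div_cancel₀ _ hmneg.ne]
  linarith

variable {E : Type*} [NormedAddCommGroup E] [NormedSpace ℝ E]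

/-- Forward orbits of ω-limit points consist of ω-limit points. -/
theorem mem_omegaSet_of_solution [FiniteDimensional ℝ E] {F : E → E} (hF : ContDiff ℝ 1 F)
    {K : Set E} (hK : IsCompact K) {γ η : ℝ → E}
    (hγ : ∀ t, 0 ≤ t → HasDerivAt γ (F (γ t)) t) (hγK : ∀ t, 0 ≤ t → γ t ∈ K)
    (hη : ∀ t, HasDerivAt η (F (η t)) t) (hηK : ∀ t, η t ∈ K) (h : η 0 ∈ omegaSet γ)
    {t : ℝ} (ht : 0 ≤ t) : η t ∈ omegaSet γ := by
  obtain ⟨R, hR⟩ := hK.isBounded.subset_closedBall (0 : E)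
  obtain ⟨L, hL⟩ := exists_lipschitzOnWith_closedBall hF R
  change MapClusterPt (η t) atTop γ
  rw [Metric.nhds_basis_ball.mapClusterPt_iff_frequently]
  intro ε hε
  have h' : MapClusterPt (η 0) atTop γ := h
  rw [Metric.nhds_basis_ball.mapClusterPt_iff_frequently] at h'
  -- Grönwall's inequality magnifies an initial error by at most exp(L t) over time t.
  set δ := ε / 2 * Real.exp (-(L * t)) with hδ
  have hδ0 : 0 < δ := by positivity
  have hfr := h' δ hδ0
  rw [frequently_atTop] at hfr ⊢
  intro a
  obtain ⟨s, hs, hsb⟩ := hfr (max a 0)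
  have hs0 : 0 ≤ s := (le_max_right a 0).trans hs
  refine ⟨t + s, by linarith [le_max_left a 0], ?_⟩
  have hγs : ∀ τ, 0 ≤ τ → HasDerivAt (fun τ => γ (τ + s)) (F (γ (τ + s))) τ := fun τ hτ =>
    (hγ (τ + s) (by linarith)).comp_add_const τ s
  have key := dist_le_of_trajectories_ODE_of_mem (v := fun _ => F) (K := L)
    (s := fun _ => Metric.closedBall 0 R) (f := fun τ => γ (τ + s)) (g := η) (a := 0) (b := t)
    (δ := δ) (fun _ _ => hL) (fun τ hτ => (hγs τ hτ.1).continuousAt.continuousWithinAt)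
    (fun τ hτ => (hγs τ hτ.1).hasDerivWithinAt) (fun τ hτ => hR (hγK _ (by linarith [hτ.1])))
    (fun τ _ => (hη τ).continuousAt.continuousWithinAt) (fun τ _ => (hη τ).hasDerivWithinAt)
    (fun τ _ => hR (hηK τ)) (by simpa using (Metric.mem_ball.mp hsb).le) t ⟨ht, le_rfl⟩
  rw [Metric.mem_ball]
  calc dist (γ (t + s)) (η t) ≤ δ * Real.exp (L * (t - 0)) := key
    _ = ε / 2 := by
      rw [hδ, mul_assoc, ← Real.exp_add]
      simp
    _ < ε := by linarith

/-- The decay of V puts the ω-limit set inside Γ, and compactness of K makes it nonempty. It is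
forward invariant and Γ is a single periodic orbit, so it is all of Γ. The trapping hypothesis
`htrap` concerns cut-off fields because existence for all time is known only for them; it then shows
that the cutoff was inactive. -/
theorem isAttractingLimitCycle_of_lyapunov [FiniteDimensional ℝ E] {F : E → E}
    (hF : ContDiff ℝ 1 F) {S Γ K U : Set E} (hcyc : IsCycle F Γ) (hK : IsCompact K) (hKS : K ⊆ S)
    (hΓK : Γ ⊆ K) (hU : IsOpen U) (hΓU : Γ ⊆ U) (hUK : U ∩ S ⊆ K)
    (htrap : ∀ (χ : E → ℝ) (γ : ℝ → E), ContDiff ℝ 1 χ → (∀ x, 0 ≤ χ x) →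
      (∀ t, HasDerivAt γ (χ (γ t) • F (γ t)) t) → γ 0 ∈ K → ∀ t, 0 ≤ t → γ t ∈ K)
    {V D : E → ℝ} (hV : ContinuousOn V K) (hD : ContinuousOn D K) (hV0 : ∀ v ∈ K, 0 ≤ V v)
    (hD0 : ∀ v ∈ K, D v ≤ 0) (hDV : ∀ v ∈ K, D v = 0 → V v = 0) (hVΓ : ∀ v ∈ K, V v = 0 → v ∈ Γ)
    (hd : ∀ (γ : ℝ → E) (t : ℝ), γ t ∈ K → HasDerivAt γ (F (γ t)) t →
      HasDerivAt (fun s => V (γ s)) (D (γ t)) t) :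
    IsAttractingLimitCycle F S Γ := by
  refine ⟨hΓK.trans hKS, hcyc, U, hU, hΓU, fun q hq => ?_⟩
  obtain ⟨R, hR⟩ := hK.isBounded.subset_closedBall (0 : E)
  obtain ⟨χ, hχ, hχ0, hχ1, γ, hγ0, hγ⟩ := exists_cutoff_solution hF q R
  have hγK := htrap χ γ hχ hχ0 hγ (hγ0 ▸ hUK hq)
  have hγF : ∀ t, 0 ≤ t → HasDerivAt γ (F (γ t)) t := fun t ht => by
    simpa [hχ1 _ (mem_closedBall_zero_iff.mp (hR (hγK t ht)))] using hγ t
  refine ⟨γ, hγ0, solvesOn_of_hasDerivAt hγF, fun t ht => hKS (hγK t ht), ?_⟩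
  have hev : ∀ᶠ t in atTop, γ t ∈ K := (eventually_ge_atTop 0).mono hγK
  have hlim := tendsto_zero_of_lyapunov hK hV hD hV0 hD0 hDV hγK
    fun t ht => hd γ t (hγK t ht) (hγF t ht)
  have hsub : omegaSet γ ⊆ Γ := by
    intro z hz
    have hz' : MapClusterPt z atTop γ := hz
    have hzK : z ∈ K := hK.isClosed.mem_of_mapClusterPt hz' hev
    refine hVΓ z hzK ?_
    have hcl : MapClusterPt (V z) atTop (fun t => V (γ t)) := by
      refine hz'.tendsto_comp' ?_
      refine (hV z hzK).mono_left (inf_le_inf_left _ ?_)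
      exact le_principal_iff.mpr hev
    have hne : (𝓝 (V z) ⊓ 𝓝 0).NeBot := NeBot.mono hcl (inf_le_inf_left _ hlim)
    exact eq_of_nhds_neBot hne
  obtain ⟨z, hzK, hz⟩ := hK.exists_mapClusterPt (f := atTop) (u := γ) (le_principal_iff.mpr hev)
  refine hsub.antisymm ?_
  obtain ⟨η, T, hη, hT, hper, -, rfl⟩ := hcyc
  rw [solvesOn_univ_iff] at hη
  obtain ⟨a, ha⟩ := hsub hz
  rintro _ ⟨b, rfl⟩
  -- Adding n periods makes the target time b later than a, so forward invariance suffices.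
  obtain ⟨n, hn⟩ := exists_nat_ge ((a - b) / T)
  have hb : 0 ≤ b + n * T - a := by
    have := (div_le_iff₀ hT).mp hn
    linarith
  have key := mem_omegaSet_of_solution hF hK hγF hγK (solution_shift hη a)
    (fun t => hΓK ⟨_, rfl⟩) (by simpa [ha, omegaSet] using hz) hb
  have : η (b + n * T - a + a) = η b := by
    rw [sub_add_cancel]
    exact hper.nat_mul n b
  rwa [this] at key

end Lyapunov

/-! ### Polar angle and closed orbits by rotation -/

section Rotation

open Complex in
-- The integral l of z'/z is a logarithm along the curve: z = z(0)·exp(l). Its imaginary part is a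
-- continuous angle, with no choice of branches.
theorem exists_polar_lift {z z' : ℝ → ℂ} (hz : ∀ t, HasDerivAt z (z' t) t) (hc : Continuous z')
    (h0 : ∀ t, z t ≠ 0) :
    ∃ θ : ℝ → ℝ, (∀ t, HasDerivAt θ (z' t / z t).im t) ∧
      ∀ t, z t = ‖z t‖ * exp (θ t * I) := by
  have hzc : Continuous z := continuous_iff_continuousAt.mpr fun t => (hz t).continuousAt
  have hq : Continuous fun t => z' t / z t := hc.div₀ hzc h0
  set l : ℝ → ℂ := fun t => ∫ s in (0 : ℝ)..t, z' s / z s with hl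
  have hL : ∀ t, HasDerivAt l (z' t / z t) t := fun t =>
    intervalIntegral.integral_hasDerivAt_right (hq.intervalIntegrable _ _)
      (hq.stronglyMeasurableAtFilter _ _) hq.continuousAt
  have hd : ∀ t, HasDerivAt (fun t => z t * exp (-l t)) 0 t := fun t => by
    have := (hz t).mul (hL t).neg.cexp
    convert! this using 1
    have := h0 t
    field_simp
    ring
  have hconst : ∀ t, z t = z 0 * exp (l t) := fun t => by
    have h1 := is_const_of_deriv_eq_zero (fun t => (hd t).differentiableAt)
      (fun t => (hd t).deriv) t 0
    have h2 : l 0 = 0 := by simp [hl]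
    simp only [h2, neg_zero, exp_zero, mul_one] at h1
    rw [← h1, mul_assoc, ← exp_add]
    simp
  have him : ∀ t, HasDerivAt (fun t => (l t).im) (z' t / z t).im t := fun t =>
    (imCLM.hasFDerivAt.comp_hasDerivAt t (hL t))
  refine ⟨fun t => arg (z 0) + (l t).im, fun t => (him t).const_add _, fun t => ?_⟩
  have hn : (‖z t‖ : ℂ) = ‖z 0‖ * exp ((l t).re : ℂ) := by
    rw [hconst t, norm_mul, norm_exp]
    push_cast
    rfl
  rw [hn]
  calc z t = z 0 * exp (l t) := hconst t
    _ = (‖z 0‖ * exp (arg (z 0) * I)) * exp ((l t).re + (l t).im * I) := by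
        rw [norm_mul_exp_arg_mul_I, re_add_im]
    _ = _ := by
        rw [exp_add]
        push_cast
        rw [add_mul, exp_add]
        ring

theorem add_mul_le_of_le_deriv {θ θ' : ℝ → ℝ} {m a b : ℝ} (hab : a ≤ b)
    (h : ∀ t, a ≤ t → HasDerivAt θ (θ' t) t) (hm : ∀ t, a ≤ t → m ≤ θ' t) :
    θ a + m * (b - a) ≤ θ b := by
  have hd : ∀ t, a ≤ t → HasDerivAt (fun t => θ t - m * t) (θ' t - m * 1) t := fun t ht =>
    (h t ht).sub ((hasDerivAt_id t).const_mul m)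
  have hmono : MonotoneOn (fun t => θ t - m * t) (Ici a) := by
    refine monotoneOn_of_hasDerivWithinAt_nonneg (convex_Ici a)
      (fun t ht => (hd t ht).continuousAt.continuousWithinAt)
      (fun t ht => (hd t (interior_subset ht)).hasDerivWithinAt) fun t ht => ?_
    have := hm t (interior_subset ht)
    linarith
  have h1 := hmono (mem_Ici.mpr le_rfl) (mem_Ici.mpr hab) hab
  simp only at h1
  linarith

theorem surjective_of_le_deriv {θ θ' : ℝ → ℝ} {m : ℝ} (hm0 : 0 < m)
    (h : ∀ t, HasDerivAt θ (θ' t) t) (hm : ∀ t, m ≤ θ' t) : Function.Surjective θ := by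
  have key : ∀ a b, a ≤ b → θ a + m * (b - a) ≤ θ b := fun a b hab =>
    add_mul_le_of_le_deriv hab (fun t _ => h t) fun t _ => hm t
  have hc : Continuous θ := continuous_iff_continuousAt.mpr fun t => (h t).continuousAt
  intro y
  set d := (|y - θ 0|) / m
  have hd : 0 ≤ d := by positivity
  have hmd : m * d = |y - θ 0| := mul_div_cancel₀ _ hm0.ne'
  have h1 := key 0 d hd
  have h2 := key (-d) 0 (by linarith)
  have h3 := le_abs_self (y - θ 0)
  have h4 := neg_abs_le (y - θ 0)
  obtain ⟨t, -, ht⟩ := intermediate_value_Icc (show -d ≤ d by linarith) hc.continuousOn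
    (show y ∈ Icc (θ (-d)) (θ d) from ⟨by nlinarith, by nlinarith⟩)
  exact ⟨t, ht⟩

variable {E : Type*} [NormedAddCommGroup E] [NormedSpace ℝ E]

open Complex in
/-- A curve which is star-shaped in a suitable chart and along which a solution rotates with
angular velocity bounded below is a cycle. -/
theorem isCycle_of_rotation [FiniteDimensional ℝ E] {F : E → E} (hF : ContDiff ℝ 1 F)
    {γ : ℝ → E} (hγ : ∀ t, HasDerivAt γ (F (γ t)) t) {Γ : Set E} (hΓ : ∀ t, γ t ∈ Γ)
    {π : E → ℂ} {z' : ℝ → ℂ} (hz : ∀ t, HasDerivAt (fun t => π (γ t)) (z' t) t)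
    (hc : Continuous z') (h0 : ∀ v ∈ Γ, π v ≠ 0) {m : ℝ} (hm0 : 0 < m)
    (hm : ∀ t, m ≤ (z' t / π (γ t)).im)
    (hstar : ∀ u ∈ Γ, ∀ v ∈ Γ, ∀ k : ℝ, 0 < k → π u = k * π v → u = v) : IsCycle F Γ := by
  obtain ⟨θ, hθ, hpol⟩ := exists_polar_lift hz hc fun t => h0 _ (hΓ t)
  have hsurj := surjective_of_le_deriv hm0 hθ hm
  have hsame : ∀ t, ∀ v ∈ Γ, exp (θ t * I) = exp (arg (π v) * I) → γ t = v := by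
    intro t v hv he
    have hv0 : 0 < ‖π v‖ := norm_pos_iff.mpr (h0 v hv)
    have ht0 : 0 < ‖π (γ t)‖ := norm_pos_iff.mpr (h0 _ (hΓ t))
    refine hstar _ (hΓ t) v hv (‖π (γ t)‖ / ‖π v‖) (by positivity) ?_
    have hne : (‖π v‖ : ℂ) ≠ 0 := by exact_mod_cast hv0.ne'
    calc π (γ t) = ‖π (γ t)‖ * exp (θ t * I) := hpol t
      _ = (‖π (γ t)‖ / ‖π v‖ : ℝ) * (‖π v‖ * exp (arg (π v) * I)) := by
        rw [he]
        push_cast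
        field_simp
      _ = _ := by rw [norm_mul_exp_arg_mul_I]
  have hcover : Γ = range γ := by
    refine Subset.antisymm (fun v hv => ?_) (range_subset_iff.mpr hΓ)
    obtain ⟨t, ht⟩ := hsurj (arg (π v))
    exact ⟨t, hsame t v hv (by rw [ht])⟩
  -- T is the time of one full turn. Star-shapedness identifies points of Γ with equal argument, so
  -- the solution returns to its start.
  obtain ⟨T, hT⟩ := hsurj (θ 0 + 2 * Real.pi)
  have hTpos : 0 < T := by
    by_contra! hle
    have := add_mul_le_of_le_deriv hle (fun t _ => hθ t) fun t _ => hm t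
    nlinarith [Real.pi_pos]
  have hexp0 : exp (θ 0 * I) = exp (arg (π (γ 0)) * I) := by
    have hne : (‖π (γ 0)‖ : ℂ) ≠ 0 := by
      exact_mod_cast (norm_pos_iff.mpr (h0 _ (hΓ 0))).ne'
    exact mul_left_cancel₀ hne ((hpol 0).symm.trans (norm_mul_exp_arg_mul_I _).symm)
  have hper0 : γ T = γ 0 := by
    refine hsame T _ (hΓ 0) ?_
    rw [hT, ← hexp0]
    push_cast
    rw [add_mul, exp_add, exp_two_pi_mul_I, mul_one]
  have hper : (fun t => γ (t + T)) = γ :=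
    solution_unique hF (solution_shift hγ T) hγ (t₀ := 0) (by simpa using hper0)
  refine ⟨γ, T, solvesOn_univ_iff.mpr hγ, hTpos, fun t => congrFun hper t, ?_, hcover⟩
  -- A constant solution would have angular velocity 0 < m.
  by_contra! hcon
  have h1 : (fun t => π (γ t)) = fun _ => π (γ 0) := funext fun t => by rw [hcon t]
  have h2 := hz 0
  rw [h1] at h2
  have h3 := h2.unique (hasDerivAt_const 0 (π (γ 0)))
  have h4 := hm 0
  rw [h3] at h4
  simp at h4
  linarith

end Rotation

/-! ### The function C along the flow and the equilibria -/

section PlanarSystem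

/-- `A` as a function on the plane. -/
def coeffA (v : Fin 2 → ℝ) : ℝ := v 0 * (2 * v 0 ^ 2 + 2 * v 1 ^ 2 + 1)

/-- `B` as a function on the plane. -/
def coeffB (v : Fin 2 → ℝ) : ℝ := v 1 * (2 * v 0 ^ 2 + 2 * v 1 ^ 2 - 1)

/-- The function `(x² + y²)² + x² - y²`, whose gradient is `2 (A, B)`. -/
def levelH (v : Fin 2 → ℝ) : ℝ := (v 0 ^ 2 + v 1 ^ 2) ^ 2 + v 0 ^ 2 - v 1 ^ 2

/-- `A² + B²`. -/
def coeffS (v : Fin 2 → ℝ) : ℝ := coeffA v ^ 2 + coeffB v ^ 2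

/-- The vector field `(A C - B w, B C + A w)` for a general weight function `w`. -/
def fieldP5 (w : (Fin 2 → ℝ) → ℝ) (c : ℝ) (v : Fin 2 → ℝ) : Fin 2 → ℝ :=
  ![coeffA v * (levelH v - c) - coeffB v * w v, coeffB v * (levelH v - c) + coeffA v * w v]

theorem eval_polyA (v : Fin 2 → ℝ) : MvPolynomial.eval v polyA = coeffA v := by
  simp [polyA, coeffA, map_ofNat]

theorem eval_polyB (v : Fin 2 → ℝ) : MvPolynomial.eval v polyB = coeffB v := by
  simp [polyB, coeffB, map_ofNat]

theorem eval_polyC (c : ℝ) (v : Fin 2 → ℝ) :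
    MvPolynomial.eval v (polyC c) = levelH v - c := by
  simp [polyC, levelH]

theorem planarField_p5 (W : MvPolynomial (Fin 2) ℝ) (c : ℝ) :
    planarField (p5X W c) (p5Y W c) = fieldP5 (fun v => MvPolynomial.eval v W) c := by
  funext v
  simp [planarField, p5X, p5Y, fieldP5, eval_polyA, eval_polyB, eval_polyC]

theorem curveC_eq (c : ℝ) : curveC c = {v | levelH v = c} := by
  ext v
  simp [curveC, eval_polyC, sub_eq_zero]

theorem contDiff_coeffA : ContDiff ℝ 1 coeffA := by
  unfold coeffA
  fun_prop

theorem contDiff_coeffB : ContDiff ℝ 1 coeffB := by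
  unfold coeffB
  fun_prop

theorem contDiff_levelH : ContDiff ℝ 1 levelH := by
  unfold levelH
  fun_prop

theorem continuous_coeffS : Continuous coeffS :=
  (contDiff_coeffA.continuous.pow 2).add (contDiff_coeffB.continuous.pow 2)

theorem contDiff_fieldP5 {w : (Fin 2 → ℝ) → ℝ} (hw : ContDiff ℝ 1 w) (c : ℝ) :
    ContDiff ℝ 1 (fieldP5 w c) := by
  have hA := contDiff_coeffA
  have hB := contDiff_coeffB
  have hH := contDiff_levelH
  rw [contDiff_pi]
  intro i
  fin_cases i
  · exact (hA.mul (hH.sub contDiff_const)).sub (hB.mul hw)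
  · exact (hB.mul (hH.sub contDiff_const)).add (hA.mul hw)

theorem contDiff_neg_fieldP5 {w : (Fin 2 → ℝ) → ℝ} (hw : ContDiff ℝ 1 w) (c : ℝ) :
    ContDiff ℝ 1 (fun v => -fieldP5 w c v) :=
  (contDiff_fieldP5 hw c).neg

/-- The sum of squares exhibits -1/4 as the minimum of H, attained only at the spiral points, and
also controls the size of sublevel sets. -/
theorem levelH_add_quarter (v : Fin 2 → ℝ) :
    levelH v + 1 / 4 = (v 0 ^ 2 + v 1 ^ 2 - 1 / 2) ^ 2 + 2 * v 0 ^ 2 := by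
  unfold levelH
  ring

theorem levelH_ge (v : Fin 2 → ℝ) : -(1 / 4) ≤ levelH v := by
  have := levelH_add_quarter v
  nlinarith [sq_nonneg (v 0 ^ 2 + v 1 ^ 2 - 1 / 2), sq_nonneg (v 0)]

theorem levelH_of_apply_one_eq_zero {v : Fin 2 → ℝ} (h : v 1 = 0) :
    levelH v = (v 0 ^ 2) ^ 2 + v 0 ^ 2 := by
  simp [levelH, h]

theorem isCompact_levelH_le (M : ℝ) : IsCompact {v | levelH v ≤ M} := by
  refine Metric.isCompact_of_isClosed_isBounded
    (isClosed_le contDiff_levelH.continuous continuous_const) ?_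
  refine Metric.isBounded_closedBall.subset (t := Metric.closedBall 0 (|M| + 3)) fun v hv => ?_
  rw [mem_closedBall_zero_iff, pi_norm_le_iff_of_nonneg (by positivity)]
  have h1 := levelH_add_quarter v
  have h2 : levelH v ≤ M := hv
  have h3 : v 0 ^ 2 + v 1 ^ 2 ≤ |M| + 2 := by
    nlinarith [sq_nonneg (v 0 ^ 2 + v 1 ^ 2 - 1), sq_nonneg (v 0), le_abs_self M]
  intro i
  rw [Real.norm_eq_abs]
  have h4 : |v i| ^ 2 ≤ |M| + 2 := by
    rw [sq_abs]
    fin_cases i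
    · change v 0 ^ 2 ≤ _
      nlinarith [sq_nonneg (v 1)]
    · change v 1 ^ 2 ≤ _
      nlinarith [sq_nonneg (v 0)]
  nlinarith [sq_nonneg (|v i| - 1), abs_nonneg (v i), abs_nonneg M]

theorem sq_one_div_sqrt_two : (1 / √2) ^ 2 = (1 / 2 : ℝ) := by
  rw [div_pow, one_pow, Real.sq_sqrt (by norm_num)]

theorem one_div_sqrt_two_pos : (0 : ℝ) < 1 / √2 := by positivity

theorem coeffS_eq_zero_iff (v : Fin 2 → ℝ) :
    coeffS v = 0 ↔ v = 0 ∨ v = upperPoint ∨ v = lowerPoint := by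
  have hs := sq_one_div_sqrt_two
  have hext : ∀ a : ℝ, v = ![0, a] ↔ v 0 = 0 ∧ v 1 = a := fun a => by
    constructor
    · rintro rfl
      simp
    · rintro ⟨h0, h1⟩
      ext i
      fin_cases i
      · simpa using h0
      · simpa using h1
  have hz : v = 0 ↔ v 0 = 0 ∧ v 1 = 0 := by
    rw [← hext]
    have h0 : (![0, 0] : Fin 2 → ℝ) = 0 := by
      ext i
      fin_cases i <;> rfl
    rw [h0]
  rw [hz, upperPoint, lowerPoint, hext, hext]
  set s := 1 / √2
  constructor
  · intro h
    have hA : coeffA v = 0 := by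
      unfold coeffS at h
      nlinarith [sq_nonneg (coeffA v), sq_nonneg (coeffB v)]
    have hB : coeffB v = 0 := by
      unfold coeffS at h
      nlinarith [sq_nonneg (coeffA v), sq_nonneg (coeffB v)]
    have h0 : v 0 = 0 := by
      rcases mul_eq_zero.mp hA with h | h
      · exact h
      · nlinarith [sq_nonneg (v 0), sq_nonneg (v 1)]
    rcases mul_eq_zero.mp hB with h1 | h1
    · exact Or.inl ⟨h0, h1⟩
    · rw [h0] at h1
      have h2 : (v 1 - s) * (v 1 + s) = 0 := by nlinarith
      rcases mul_eq_zero.mp h2 with h3 | h3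
      · exact Or.inr (Or.inl ⟨h0, by linarith⟩)
      · exact Or.inr (Or.inr ⟨h0, by linarith⟩)
  · unfold coeffS coeffA coeffB
    rintro (⟨h0, h1⟩ | ⟨h0, h1⟩ | ⟨h0, h1⟩) <;> rw [h0, h1]
    · ring
    · linear_combination (s ^ 2 * (4 * s ^ 2 - 2)) * hs
    · linear_combination (s ^ 2 * (4 * s ^ 2 - 2)) * hs

/-- The combination A·y' - B·x' equals (A² + B²)w, and w is positive. -/
theorem fieldP5_eq_zero_iff {w : (Fin 2 → ℝ) → ℝ} (hpos : ∀ v, 0 < w v) (c : ℝ)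
    (v : Fin 2 → ℝ) : fieldP5 w c v = 0 ↔ coeffS v = 0 := by
  have hw := hpos v
  have hcomp : fieldP5 w c v = 0 ↔ coeffA v * (levelH v - c) - coeffB v * w v = 0 ∧
      coeffB v * (levelH v - c) + coeffA v * w v = 0 := by
    rw [funext_iff, Fin.forall_fin_two]
    simp [fieldP5]
  rw [hcomp]
  constructor
  · rintro ⟨h0, h1⟩
    have h2 : coeffS v * w v = 0 := by
      unfold coeffS
      linear_combination coeffA v * h1 - coeffB v * h0
    exact (mul_eq_zero.mp h2).resolve_right hw.ne'
  · intro h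
    have hA : coeffA v = 0 := by
      unfold coeffS at h
      nlinarith [sq_nonneg (coeffA v), sq_nonneg (coeffB v)]
    have hB : coeffB v = 0 := by
      unfold coeffS at h
      nlinarith [sq_nonneg (coeffA v), sq_nonneg (coeffB v)]
    simp [hA, hB]

theorem levelH_zero : levelH 0 = 0 := by simp [levelH]

theorem levelH_upperPoint : levelH upperPoint = -(1 / 4) := by
  have hs := sq_one_div_sqrt_two
  simp only [levelH, upperPoint, Matrix.cons_val_zero, Matrix.cons_val_one]
  rw [hs]
  norm_num

theorem levelH_lowerPoint : levelH lowerPoint = -(1 / 4) := by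
  have hs := sq_one_div_sqrt_two
  simp only [levelH, lowerPoint, Matrix.cons_val_zero, Matrix.cons_val_one, neg_sq]
  rw [hs]
  norm_num

theorem coeffS_nonneg (v : Fin 2 → ℝ) : 0 ≤ coeffS v := by
  unfold coeffS
  positivity

theorem coeffS_pos_of_levelH_ne {v : Fin 2 → ℝ} (h0 : levelH v ≠ 0) (h1 : levelH v ≠ -(1 / 4)) :
    0 < coeffS v := by
  refine lt_of_le_of_ne (coeffS_nonneg v) fun h => ?_
  rcases (coeffS_eq_zero_iff v).mp h.symm with rfl | rfl | rfl
  · exact h0 levelH_zero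
  · exact h1 levelH_upperPoint
  · exact h1 levelH_lowerPoint

/-- The derivative of `C` along the flow is `2 (A² + B²) C`. -/
theorem hasDerivWithinAt_levelH {w : (Fin 2 → ℝ) → ℝ} {c k t : ℝ} {γ : ℝ → Fin 2 → ℝ}
    {s : Set ℝ} (h : HasDerivWithinAt γ (k • fieldP5 w c (γ t)) s t) :
    HasDerivWithinAt (fun t => levelH (γ t)) (2 * k * coeffS (γ t) * (levelH (γ t) - c)) s t := by
  rw [hasDerivWithinAt_pi] at h
  have h0 := h 0
  have h1 := h 1
  have h2 := ((((h0.pow 2).add (h1.pow 2)).pow 2).add (h0.pow 2)).sub (h1.pow 2)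
  refine (h2.congr_deriv ?_).congr (fun _ _ => by simp [levelH]) (by simp [levelH])
  simp only [fieldP5, coeffS, coeffA, coeffB, levelH, Pi.smul_apply, smul_eq_mul, Pi.add_apply,
    Pi.pow_apply, Matrix.cons_val_zero, Matrix.cons_val_one]
  push_cast
  ring

theorem hasDerivAt_levelH {w : (Fin 2 → ℝ) → ℝ} {c k t : ℝ} {γ : ℝ → Fin 2 → ℝ}
    (h : HasDerivAt γ (k • fieldP5 w c (γ t)) t) :
    HasDerivAt (fun t => levelH (γ t)) (2 * k * coeffS (γ t) * (levelH (γ t) - c)) t := by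
  rw [← hasDerivWithinAt_univ] at h ⊢
  exact hasDerivWithinAt_levelH h

/-- The factor k accommodates both the cutoff and time reversal. Since the equation for C is linear,
C keeps its sign and vanishes either always or never. -/
theorem exists_levelH_eq {w : (Fin 2 → ℝ) → ℝ} {c : ℝ} {γ : ℝ → Fin 2 → ℝ} {k : ℝ → ℝ}
    (hk : Continuous k) (h : ∀ t, HasDerivAt γ (k t • fieldP5 w c (γ t)) t) :
    ∃ e : ℝ → ℝ, (∀ t, 0 < e t) ∧ ∀ t, levelH (γ t) - c = (levelH (γ 0) - c) * e t := by
  have hγ : Continuous γ := continuous_iff_continuousAt.mpr fun t => (h t).continuousAt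
  exact linear_solution (g := fun t => levelH (γ t) - c)
    (a := fun t => 2 * k t * coeffS (γ t))
    ((continuous_const.mul hk).mul (continuous_coeffS.comp hγ))
    fun t => (hasDerivAt_levelH (h t)).sub_const c

theorem levelH_eq_of_solution {w : (Fin 2 → ℝ) → ℝ} {c : ℝ} {γ : ℝ → Fin 2 → ℝ} {k : ℝ → ℝ}
    (hk : Continuous k) (h : ∀ t, HasDerivAt γ (k t • fieldP5 w c (γ t)) t)
    (h0 : levelH (γ 0) = c) (t : ℝ) : levelH (γ t) = c := by
  obtain ⟨e, -, he⟩ := exists_levelH_eq hk h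
  have := he t
  rw [h0, sub_self, zero_mul] at this
  linarith

/-- On an arbitrary interval only one-sided derivatives may exist at the ends. The coefficient of
the linear equation for C is bounded on the compact segment from t₀ to t, so C agrees there with the
zero solution by uniqueness, forwards or backwards. -/
theorem mem_curveC_of_solvesOn {w : (Fin 2 → ℝ) → ℝ} {c : ℝ} {γ : ℝ → Fin 2 → ℝ} {s : Set ℝ}
    (hs : s.OrdConnected) (h : SolvesOn (fieldP5 w c) γ s) {t₀ t : ℝ} (ht₀ : t₀ ∈ s) (ht : t ∈ s)
    (h0 : levelH (γ t₀) = c) : levelH (γ t) = c := by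
  have hd : ∀ τ ∈ s, HasDerivWithinAt (fun t => levelH (γ t) - c)
      (2 * coeffS (γ τ) * (levelH (γ τ) - c)) s τ := fun τ hτ => by
    have h1 : HasDerivWithinAt γ ((1 : ℝ) • fieldP5 w c (γ τ)) s τ := by
      rw [one_smul]
      exact h τ hτ
    simpa using (hasDerivWithinAt_levelH h1).sub_const c
  have hSc : ContinuousOn (fun τ => 2 * coeffS (γ τ)) s :=
    continuousOn_const.mul (continuous_coeffS.comp_continuousOn
      fun τ hτ => (h τ hτ).continuousWithinAt)
  have hsub : uIcc t₀ t ⊆ s := hs.uIcc_subset ht₀ ht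
  obtain ⟨L, hL⟩ := isCompact_uIcc.exists_bound_of_continuousOn (hSc.mono hsub)
  have hlip : ∀ τ ∈ uIcc t₀ t, LipschitzOnWith (Real.toNNReal L)
      (fun x : ℝ => 2 * coeffS (γ τ) * x) univ := by
    intro τ hτ
    refine LipschitzOnWith.of_dist_le_mul fun x _ y _ => ?_
    rw [Real.dist_eq, Real.dist_eq, ← mul_sub, abs_mul]
    exact mul_le_mul_of_nonneg_right ((hL τ hτ).trans (Real.le_coe_toNNReal L)) (abs_nonneg _)
  have hcont : ContinuousOn (fun t => levelH (γ t) - c) (uIcc t₀ t) := fun τ hτ =>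
    ((hd τ (hsub hτ)).continuousWithinAt).mono hsub
  suffices h : levelH (γ t) - c = 0 by linarith
  rcases le_total t₀ t with hle | hle
  · rw [uIcc_of_le hle] at *
    refine ODE_solution_unique_of_mem_Icc_right (g := fun _ => (0 : ℝ))
      (v := fun τ x => 2 * coeffS (γ τ) * x) (s := fun _ => univ)
      (fun τ hτ => hlip τ (Ico_subset_Icc_self hτ)) hcont (fun τ hτ => ?_) (fun _ _ => trivial)
      continuousOn_const (fun τ _ => by simpa using hasDerivWithinAt_const τ (Ici τ) (0 : ℝ))
      (fun _ _ => trivial) (by simp [h0]) (right_mem_Icc.mpr hle)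
    refine (hd τ (hsub (Ico_subset_Icc_self hτ))).mono_of_mem_nhdsWithin ?_
    exact mem_of_superset (Icc_mem_nhdsGE_of_mem hτ) hsub
  · rw [uIcc_of_ge hle] at *
    refine ODE_solution_unique_of_mem_Icc_left (g := fun _ => (0 : ℝ))
      (v := fun τ x => 2 * coeffS (γ τ) * x) (s := fun _ => univ)
      (fun τ hτ => hlip τ (Ioc_subset_Icc_self hτ)) hcont (fun τ hτ => ?_) (fun _ _ => trivial)
      continuousOn_const (fun τ _ => by simpa using hasDerivWithinAt_const τ (Iic τ) (0 : ℝ))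
      (fun _ _ => trivial) (by simp [h0]) (left_mem_Icc.mpr hle)
    refine (hd τ (hsub (Ioc_subset_Icc_self hτ))).mono_of_mem_nhdsWithin ?_
    exact mem_of_superset (Icc_mem_nhdsLE_of_mem hτ) hsub

/-- `C²` is monotone along trajectories. -/
theorem monotone_sq_levelH {w : (Fin 2 → ℝ) → ℝ} {c : ℝ} {γ : ℝ → Fin 2 → ℝ}
    (h : ∀ t, HasDerivAt γ (fieldP5 w c (γ t)) t) :
    Monotone (fun t => (levelH (γ t) - c) ^ 2) ∧
      ∀ t, HasDerivAt (fun t => (levelH (γ t) - c) ^ 2)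
        (4 * coeffS (γ t) * (levelH (γ t) - c) ^ 2) t := by
  have hd : ∀ t, HasDerivAt (fun t => (levelH (γ t) - c) ^ 2)
      (4 * coeffS (γ t) * (levelH (γ t) - c) ^ 2) t := fun t => by
    have h1 : HasDerivAt γ ((1 : ℝ) • fieldP5 w c (γ t)) t := by
      rw [one_smul]
      exact h t
    refine (((hasDerivAt_levelH h1).sub_const c).pow 2).congr_deriv ?_
    push_cast
    ring
  refine ⟨monotone_of_hasDerivAt_nonneg hd fun t => ?_, hd⟩
  have := coeffS_nonneg (γ t)
  positivity

/-- A nonconstant solution along which `C²` is constant lies on the curve `C = 0` and does not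
meet the equilibria. -/
theorem level_of_sq_const {w : (Fin 2 → ℝ) → ℝ} (hw : ContDiff ℝ 1 w) (hpos : ∀ v, 0 < w v)
    {c : ℝ} {γ : ℝ → Fin 2 → ℝ} (h : ∀ t, HasDerivAt γ (fieldP5 w c (γ t)) t)
    (hne : ∃ t s, γ t ≠ γ s) {l : ℝ} (hl : ∀ t, (levelH (γ t) - c) ^ 2 = l) (t : ℝ) :
    levelH (γ t) = c ∧ coeffS (γ t) ≠ 0 := by
  -- A zero of A² + B² is an equilibrium, and a solution meeting an equilibrium is constant.
  have hS : coeffS (γ t) ≠ 0 := fun h0 => by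
    have hconst := solution_eq_const (contDiff_fieldP5 hw c) h
      ((fieldP5_eq_zero_iff hpos c (γ t)).mpr h0)
    obtain ⟨a, b, hab⟩ := hne
    exact hab ((hconst a).trans (hconst b).symm)
  refine ⟨?_, hS⟩
  have hd := (monotone_sq_levelH h).2 t
  have h1 : (fun t => (levelH (γ t) - c) ^ 2) = fun _ => l := funext hl
  rw [h1] at hd
  have h2 := hd.unique (hasDerivAt_const t l)
  have h3 : (levelH (γ t) - c) ^ 2 = 0 :=
    (mul_eq_zero.mp h2).resolve_left (mul_ne_zero four_ne_zero hS)
  have h4 := pow_eq_zero_iff two_ne_zero |>.mp h3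
  linarith

/-- A monotone function that is also periodic is constant; this is applied to C² along γ. -/
theorem level_of_isCycle {w : (Fin 2 → ℝ) → ℝ} (hw : ContDiff ℝ 1 w) (hpos : ∀ v, 0 < w v)
    {c : ℝ} {γ : ℝ → Fin 2 → ℝ} (h : ∀ t, HasDerivAt γ (fieldP5 w c (γ t)) t)
    {T : ℝ} (hT : 0 < T) (hper : Function.Periodic γ T) (hne : ∃ t, γ t ≠ γ 0) (t : ℝ) :
    levelH (γ t) = c ∧ coeffS (γ t) ≠ 0 := by
  obtain ⟨a, ha⟩ := hne
  have hle : ∀ s t, (levelH (γ s) - c) ^ 2 ≤ (levelH (γ t) - c) ^ 2 := by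
    intro s t
    obtain ⟨n, hn⟩ := exists_nat_ge ((s - t) / T)
    have h1 : s ≤ t + n * T := by
      have := (div_le_iff₀ hT).mp hn
      linarith
    have h2 := (monotone_sq_levelH h).1 h1
    simp only [hper.nat_mul n t] at h2
    exact h2
  exact level_of_sq_const hw hpos h ⟨a, 0, ha⟩ (fun t => (hle t 0).antisymm (hle 0 t)) t

/-- C² is monotone and has the same limit at both ends of time, so it is constant. -/
theorem level_of_homoclinic {w : (Fin 2 → ℝ) → ℝ} (hw : ContDiff ℝ 1 w) (hpos : ∀ v, 0 < w v)
    {c : ℝ} {γ : ℝ → Fin 2 → ℝ} (h : ∀ t, HasDerivAt γ (fieldP5 w c (γ t)) t)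
    {p : Fin 2 → ℝ} (hne : ∃ t, γ t ≠ p) (htop : Tendsto γ atTop (𝓝 p))
    (hbot : Tendsto γ atBot (𝓝 p)) (t : ℝ) : levelH (γ t) = c ∧ coeffS (γ t) ≠ 0 := by
  have hcont : Continuous fun v => (levelH v - c) ^ 2 :=
    (contDiff_levelH.continuous.sub continuous_const).pow 2
  have htop' := (hcont.tendsto p).comp htop
  have hbot' := (hcont.tendsto p).comp hbot
  refine level_of_sq_const hw hpos h ?_ (l := (levelH p - c) ^ 2) (fun t => ?_) t
  · by_contra! hcon
    obtain ⟨a, ha⟩ := hne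
    have h1 : γ = fun _ => γ a := funext fun t => hcon t a
    rw [h1] at htop
    exact ha (tendsto_nhds_unique tendsto_const_nhds htop)
  · have hm := (monotone_sq_levelH h).1
    exact (hm.ge_of_tendsto htop' t).antisymm (hm.le_of_tendsto hbot' t)

theorem level_eq_of_homoclinic {w : (Fin 2 → ℝ) → ℝ} (hw : ContDiff ℝ 1 w)
    (hpos : ∀ v, 0 < w v) {c : ℝ} {γ : ℝ → Fin 2 → ℝ}
    (h : ∀ t, HasDerivAt γ (fieldP5 w c (γ t)) t) {p : Fin 2 → ℝ} (hne : ∃ t, γ t ≠ p)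
    (htop : Tendsto γ atTop (𝓝 p)) (hbot : Tendsto γ atBot (𝓝 p)) : levelH p = c := by
  have h1 := (contDiff_levelH.continuous.tendsto p).comp htop
  refine tendsto_nhds_unique h1 (tendsto_const_nhds.congr fun t => ?_)
  exact (level_of_homoclinic hw hpos h hne htop hbot t).1.symm

/-- Below the level `-1/4` of the spirals the curve `C = 0` contains no regular points. -/
theorem coeffS_eq_zero_of_level_le {v : Fin 2 → ℝ} (h : levelH v ≤ -(1 / 4)) : coeffS v = 0 := by
  have h1 := levelH_add_quarter v
  have h2 : v 0 = 0 := by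
    nlinarith [sq_nonneg (v 0 ^ 2 + v 1 ^ 2 - 1 / 2), sq_nonneg (v 0)]
  have h3 : v 0 ^ 2 + v 1 ^ 2 - 1 / 2 = 0 := by
    nlinarith [sq_nonneg (v 0 ^ 2 + v 1 ^ 2 - 1 / 2), sq_nonneg (v 0)]
  rw [h2] at h3
  simp only [coeffS, coeffA, coeffB, h2]
  have h4 : v 1 ^ 2 = 1 / 2 := by linarith
  rw [mul_pow, h4]
  norm_num

end PlanarSystem

/-! ### Criteria for surrounding a point -/

section Surrounding

/-- By the intermediate value theorem, the component of p in the complement of the zero set of f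
cannot leave the bounded set where f < 0. -/
theorem surrounds_of_neg {f : (Fin 2 → ℝ) → ℝ} (hf : Continuous f) {Γ : Set (Fin 2 → ℝ)}
    (hΓ : ∀ v, f v = 0 ↔ v ∈ Γ) (hb : Bornology.IsBounded {v | f v < 0}) {p : Fin 2 → ℝ}
    (hp : f p < 0) : Surrounds Γ p := by
  have hpΓ : p ∉ Γ := fun h => hp.ne ((hΓ p).mpr h)
  refine ⟨hpΓ, hb.subset fun v hv => ?_⟩
  by_contra! hcon
  have hcon : 0 ≤ f v := not_lt.mp hcon
  obtain ⟨u, hu, hu0⟩ := isPreconnected_connectedComponentIn.intermediate_value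
    (mem_connectedComponentIn (show p ∈ Γᶜ from hpΓ)) hv hf.continuousOn ⟨hp.le, hcon⟩
  exact connectedComponentIn_subset _ _ hu ((hΓ u).mp hu0)

theorem not_surrounds_of_ray {Γ : Set (Fin 2 → ℝ)} {p d : Fin 2 → ℝ} (hd : d ≠ 0)
    (h : ∀ t : ℝ, 0 ≤ t → p + t • d ∉ Γ) : ¬ Surrounds Γ p := by
  rintro ⟨-, hb⟩
  have hsub : (fun t : ℝ => p + t • d) '' Ici 0 ⊆ connectedComponentIn Γᶜ p := by
    refine IsPreconnected.subset_connectedComponentIn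
      (isPreconnected_Ici.image _ (by fun_prop)) ⟨0, by simp⟩ ?_
    rintro _ ⟨t, ht, rfl⟩
    exact h t ht
  obtain ⟨R, hR⟩ := (hb.subset hsub).subset_closedBall p
  have hd0 : 0 < ‖d‖ := norm_pos_iff.mpr hd
  have h1 : (0 : ℝ) ≤ (|R| + 1) / ‖d‖ := by positivity
  have h2 := hR ⟨_, h1, rfl⟩
  rw [mem_closedBall_iff_norm] at h2
  simp only [add_sub_cancel_left, norm_smul, Real.norm_eq_abs, abs_of_nonneg h1,
    div_mul_cancel₀ _ hd0.ne'] at h2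
  linarith [le_abs_self R]

end Surrounding

/-! ### Linearization at the origin -/

section Saddle

/-- With a = w(0), the linearization is the symmetric matrix with rows (-c, a) and (a, c), whose
eigenvalues are ±√(c² + a²). -/
theorem isSaddle_fieldP5 {w : (Fin 2 → ℝ) → ℝ} (hw : ContDiff ℝ 1 w) (hpos : ∀ v, 0 < w v)
    (c : ℝ) : IsSaddle (fieldP5 w c) 0 := by
  have hz : fieldP5 w c 0 = 0 :=
    (fieldP5_eq_zero_iff hpos c 0).mpr ((coeffS_eq_zero_iff 0).mpr (Or.inl rfl))
  have hdiff : DifferentiableAt ℝ (fieldP5 w c) 0 :=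
    (contDiff_fieldP5 hw c).differentiable one_ne_zero 0
  set a := w 0 with ha
  have ha0 : 0 < a := hpos 0
  have hx : HasFDerivAt (fun v : Fin 2 → ℝ => v 0) (ContinuousLinearMap.proj (R := ℝ) 0) 0 :=
    hasFDerivAt_apply 0 0
  have hy : HasFDerivAt (fun v : Fin 2 → ℝ => v 1) (ContinuousLinearMap.proj (R := ℝ) 1) 0 :=
    hasFDerivAt_apply 1 0
  -- The derivative is computed along the lines t·u. As A and B vanish at 0, the derivatives of w
  -- and H do not contribute and only need to exist.
  have hlin : ∀ u : Fin 2 → ℝ,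
      fderiv ℝ (fieldP5 w c) 0 u = ![-c * u 0 + a * u 1, a * u 0 + c * u 1] := by
    intro u
    have hdir : HasDerivAt (fun t : ℝ => fieldP5 w c (t • u)) (fderiv ℝ (fieldP5 w c) 0 u) 0 := by
      have h1 : HasDerivAt (fun t : ℝ => t • u) u 0 := by
        simpa using (hasDerivAt_id (0 : ℝ)).smul_const u
      have h2 : HasFDerivAt (fieldP5 w c) (fderiv ℝ (fieldP5 w c) 0) ((0 : ℝ) • u) := by
        rw [zero_smul]
        exact hdiff.hasFDerivAt
      exact h2.comp_hasDerivAt 0 h1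
    have hw1 : ∃ b, HasDerivAt (fun t : ℝ => w (t • u)) b 0 := by
      have h1 : DifferentiableAt ℝ (fun t : ℝ => w (t • u)) 0 :=
        ((hw.differentiable one_ne_zero).comp (by fun_prop : Differentiable ℝ fun t : ℝ => t • u)) 0
      exact ⟨_, h1.hasDerivAt⟩
    obtain ⟨b, hb⟩ := hw1
    have hid := hasDerivAt_id (0 : ℝ)
    have hA : HasDerivAt (fun t : ℝ => coeffA (t • u)) (u 0) 0 := by
      have h1 : HasDerivAt (fun t : ℝ => t * u 0) (u 0) 0 := by
        simpa using hid.mul_const (u 0)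
      have h2 : HasDerivAt (fun t : ℝ => t * u 1) (u 1) 0 := by
        simpa using hid.mul_const (u 1)
      have h3 := h1.mul (((((h1.pow 2).const_mul 2).add ((h2.pow 2).const_mul 2)).add_const 1))
      refine (h3.congr_deriv ?_)
      simp
    have hB : HasDerivAt (fun t : ℝ => coeffB (t • u)) (-u 1) 0 := by
      have h1 : HasDerivAt (fun t : ℝ => t * u 0) (u 0) 0 := by
        simpa using hid.mul_const (u 0)
      have h2 : HasDerivAt (fun t : ℝ => t * u 1) (u 1) 0 := by
        simpa using hid.mul_const (u 1)
      have h3 := h2.mul (((((h1.pow 2).const_mul 2).add ((h2.pow 2).const_mul 2)).sub_const 1))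
      refine (h3.congr_deriv ?_)
      simp
    have hH : ∃ b, HasDerivAt (fun t : ℝ => levelH (t • u) - c) b 0 := by
      have h1 : DifferentiableAt ℝ (fun t : ℝ => levelH (t • u)) 0 :=
        ((contDiff_levelH.differentiable one_ne_zero).comp
          (by fun_prop : Differentiable ℝ fun t : ℝ => t • u)) 0
      exact ⟨_, h1.hasDerivAt.sub_const c⟩
    obtain ⟨h, hh⟩ := hH
    have hA0 : coeffA 0 = 0 := by simp [coeffA]
    have hB0 : coeffB 0 = 0 := by simp [coeffB]
    have hcomb : HasDerivAt (fun t : ℝ => fieldP5 w c (t • u))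
        ![-c * u 0 + a * u 1, a * u 0 + c * u 1] 0 := by
      rw [hasDerivAt_pi]
      intro i
      fin_cases i
      · refine ((hA.mul hh).sub (hB.mul hb)).congr_deriv ?_
        simp [hA0, hB0, levelH_zero, ← ha]
        ring
      · refine ((hB.mul hh).add (hA.mul hb)).congr_deriv ?_
        simp [hA0, hB0, levelH_zero, ← ha]
        ring
    exact hdir.unique hcomb
  have heig : ∀ μ : ℝ, μ ^ 2 = c ^ 2 + a ^ 2 → Module.End.HasEigenvalue
      (fderiv ℝ (fieldP5 w c) 0 : (Fin 2 → ℝ) →ₗ[ℝ] (Fin 2 → ℝ)) μ := by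
    intro μ hμ
    refine Module.End.hasEigenvalue_of_hasEigenvector (x := ![a, μ + c])
      (Module.End.hasEigenvector_iff.mpr ⟨?_, fun h => ?_⟩)
    · rw [Module.End.mem_eigenspace_iff]
      change fderiv ℝ (fieldP5 w c) 0 ![a, μ + c] = _
      rw [hlin]
      ext i
      fin_cases i
      · simp
        ring
      · simp
        linear_combination -hμ
    · have := congrFun h 0
      simp at this
      exact ha0.ne' this
  have hsq : 0 < √(c ^ 2 + a ^ 2) := Real.sqrt_pos.mpr (by positivity)
  have hsq2 : √(c ^ 2 + a ^ 2) ^ 2 = c ^ 2 + a ^ 2 := Real.sq_sqrt (by positivity)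
  exact ⟨hz, hdiff, -√(c ^ 2 + a ^ 2), √(c ^ 2 + a ^ 2), by linarith, hsq,
    heig _ (by rw [neg_sq, hsq2]), heig _ hsq2⟩

end Saddle

/-! ### Level curves as repelling limit cycles -/

section LimitCycles

theorem isCycle_neg {E : Type*} [NormedAddCommGroup E] [NormedSpace ℝ E] {F : E → E} {Γ : Set E}
    (h : IsCycle F Γ) : IsCycle (fun v => -F v) Γ := by
  obtain ⟨γ, T, hγ, hT, hper, ⟨t, ht⟩, rfl⟩ := h
  rw [solvesOn_univ_iff] at hγ
  refine ⟨fun s => γ (-s), T, solvesOn_univ_iff.mpr (solution_reverse hγ), hT, fun s => ?_,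
    ⟨-t, by simpa using ht⟩, ((Equiv.neg ℝ).surjective.range_comp γ).symm⟩
  have := hper (-s - T)
  simp only [sub_add_cancel] at this
  change γ (-(s + T)) = γ (-s)
  rw [this]
  congr 1
  ring

/-- The complex coordinate centred at `p`. -/
def complexCoord (p v : Fin 2 → ℝ) : ℂ := ⟨v 0 - p 0, v 1 - p 1⟩

theorem complexCoord_eq_zero_iff {p v : Fin 2 → ℝ} : complexCoord p v = 0 ↔ v = p := by
  rw [Complex.ext_iff, funext_iff, Fin.forall_fin_two]
  simp [complexCoord, sub_eq_zero]

theorem hasDerivAt_complexMk {f g : ℝ → ℝ} {f' g' t : ℝ} (hf : HasDerivAt f f' t)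
    (hg : HasDerivAt g g' t) : HasDerivAt (fun t => (⟨f t, g t⟩ : ℂ)) ⟨f', g'⟩ t := by
  have h := hf.ofReal_comp.add (hg.ofReal_comp.mul_const Complex.I)
  have e : ∀ a b : ℝ, (⟨a, b⟩ : ℂ) = (a : ℂ) + (b : ℂ) * Complex.I := fun a b => by
    simpa using (Complex.re_add_im (⟨a, b⟩ : ℂ)).symm
  simp only [e]
  exact h

theorem hasDerivAt_complexCoord {γ : ℝ → Fin 2 → ℝ} {γ' p : Fin 2 → ℝ} {t : ℝ}
    (h : HasDerivAt γ γ' t) : HasDerivAt (fun t => complexCoord p (γ t)) ⟨γ' 0, γ' 1⟩ t :=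
  hasDerivAt_complexMk ((hasDerivAt_pi.mp h 0).sub_const _) ((hasDerivAt_pi.mp h 1).sub_const _)

theorem im_div_eq (a b x y : ℝ) :
    ((⟨a, b⟩ : ℂ) / ⟨x, y⟩).im = (x * b - y * a) / (x ^ 2 + y ^ 2) := by
  rw [Complex.div_im]
  simp only [Complex.normSq_mk]
  rw [← sub_div]
  congr 1 <;> ring

theorem continuous_complexMk {f g : ℝ → ℝ} (hf : Continuous f) (hg : Continuous g) :
    Continuous (fun t => (⟨f t, g t⟩ : ℂ)) :=
  Complex.equivRealProdCLM.symm.continuous.comp (hf.prodMk hg)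

/-- A part of the curve `C = 0` which is star-shaped about `p` and along which the field rotates
about `p` is a cycle. -/
theorem isCycle_level {w : (Fin 2 → ℝ) → ℝ} (hw : ContDiff ℝ 1 w) (hpos : ∀ v, 0 < w v) {c : ℝ}
    {j : (Fin 2 → ℝ) → ℝ} (hj : Continuous j) (hjne : ∀ v, levelH v = c → j v ≠ 0)
    {p : Fin 2 → ℝ} (hp : levelH p ≠ c)
    (hrot : ∀ v, levelH v = c → 0 < j v →
      0 < (v 0 - p 0) * coeffA v + (v 1 - p 1) * coeffB v)
    (hstar : ∀ u v, levelH u = c → 0 < j u → levelH v = c → 0 < j v → ∀ k : ℝ, 0 < k →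
      u 0 - p 0 = k * (v 0 - p 0) → u 1 - p 1 = k * (v 1 - p 1) → u = v)
    (hne : ∃ v, levelH v = c ∧ 0 < j v) :
    IsCycle (fieldP5 w c) {v | levelH v = c ∧ 0 < j v} := by
  set Γ : Set (Fin 2 → ℝ) := {v | levelH v = c ∧ 0 < j v} with hΓdef
  have hH := contDiff_levelH.continuous
  have hΓc : IsCompact Γ := by
    -- The sign of j selects a part of the curve. Since j has no zeros on the curve, the strict
    -- inequality may be relaxed, which makes Γ closed.
    have heq : Γ = {v | levelH v ≤ c} ∩ ({v | levelH v = c} ∩ {v | 0 ≤ j v}) := by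
      ext v
      constructor
      · rintro ⟨h1, h2⟩
        exact ⟨h1.le, h1, h2.le⟩
      · rintro ⟨-, h1, h2⟩
        exact ⟨h1, lt_of_le_of_ne h2 (hjne v h1).symm⟩
    rw [heq]
    exact (isCompact_levelH_le c).inter_right
      ((isClosed_eq hH continuous_const).inter (isClosed_le continuous_const hj))
  obtain ⟨q, hq⟩ := hne
  obtain ⟨R, hR⟩ := hΓc.isBounded.subset_closedBall (0 : Fin 2 → ℝ)
  obtain ⟨χ, hχ, hχ0, hχ1, γ, hγ0, hγ⟩ := exists_cutoff_solution (contDiff_fieldP5 hw c) q R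
  have hγc : Continuous γ := continuous_iff_continuousAt.mpr fun t => (hγ t).continuousAt
  have hlev : ∀ t, levelH (γ t) = c := levelH_eq_of_solution (k := fun t => χ (γ t))
    (hχ.continuous.comp hγc) hγ (hγ0 ▸ hq.1)
  have hmem : ∀ t, γ t ∈ Γ := fun t => ⟨hlev t, pos_of_ne_zero_of_pos' (hj.comp hγc)
    (by simpa [hγ0] using hq.2) (fun s => hjne _ (hlev s)) t⟩
  have hγF : ∀ t, HasDerivAt γ (fieldP5 w c (γ t)) t := fun t => by
    simpa [hχ1 _ (mem_closedBall_zero_iff.mp (hR (hmem t)))] using hγ t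
  have hFc := (contDiff_fieldP5 hw c).continuous
  have hne_p : ∀ v ∈ Γ, complexCoord p v ≠ 0 := fun v hv h0 =>
    hp (complexCoord_eq_zero_iff.mp h0 ▸ hv.1)
  have hden : ∀ v ∈ Γ, 0 < (v 0 - p 0) ^ 2 + (v 1 - p 1) ^ 2 := by
    intro v hv
    have := Complex.normSq_pos.mpr (hne_p v hv)
    simp only [complexCoord, Complex.normSq_mk] at this
    nlinarith
  set ω : (Fin 2 → ℝ) → ℝ := fun v =>
    ((v 0 - p 0) * fieldP5 w c v 1 - (v 1 - p 1) * fieldP5 w c v 0) /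
      ((v 0 - p 0) ^ 2 + (v 1 - p 1) ^ 2) with hω
  have hωpos : ∀ v ∈ Γ, 0 < ω v := by
    intro v hv
    refine div_pos ?_ (hden v hv)
    have h1 := mul_pos (hpos v) (hrot v hv.1 hv.2)
    -- On C = 0 only the Hamiltonian part w·(-B, A) of the field is left.
    have h2 : (v 0 - p 0) * fieldP5 w c v 1 - (v 1 - p 1) * fieldP5 w c v 0 =
        w v * ((v 0 - p 0) * coeffA v + (v 1 - p 1) * coeffB v) := by
      simp only [fieldP5, Matrix.cons_val_zero, Matrix.cons_val_one, hv.1]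
      ring
    rwa [h2]
  have hωc : ContinuousOn ω Γ := by
    refine ContinuousOn.div (Continuous.continuousOn ?_) (Continuous.continuousOn ?_)
      fun v hv => (hden v hv).ne'
    · have h0 := (continuous_pi_iff.mp hFc) 0
      have h1 := (continuous_pi_iff.mp hFc) 1
      fun_prop
    · fun_prop
  obtain ⟨m, hm, hmin⟩ := hΓc.exists_isMinOn ⟨q, hq⟩ hωc
  refine isCycle_of_rotation (contDiff_fieldP5 hw c) hγF hmem
    (fun t => hasDerivAt_complexCoord (p := p) (hγF t))
    (continuous_complexMk ((continuous_pi_iff.mp (hFc.comp hγc)) 0)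
      ((continuous_pi_iff.mp (hFc.comp hγc)) 1)) hne_p (hωpos m hm) (fun t => ?_) ?_
  · have h1 := hmin (hmem t)
    simp only [complexCoord, im_div_eq]
    exact h1
  · intro u hu v hv k hk huv
    rw [Complex.ext_iff] at huv
    refine hstar u v hu.1 hu.2 hv.1 hv.2 k hk ?_ ?_
    · simpa [complexCoord] using huv.1
    · simpa [complexCoord] using huv.2

/-- In the band |C| ≤ ε, C² decreases under the reversed flow. The band contains no equilibria, so
its derivative vanishes only on the curve; the sign of j cannot change inside the band. -/
theorem isRepellingLimitCycle_level {w : (Fin 2 → ℝ) → ℝ} (hw : ContDiff ℝ 1 w) {c : ℝ}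
    {j : (Fin 2 → ℝ) → ℝ} (hj : Continuous j) {ε : ℝ} (hε : 0 < ε)
    (hjne : ∀ v, |levelH v - c| ≤ ε → j v ≠ 0)
    (hS : ∀ v, |levelH v - c| ≤ ε → coeffS v ≠ 0)
    (hcyc : IsCycle (fieldP5 w c) {v | levelH v = c ∧ 0 < j v}) :
    IsRepellingLimitCycle (fieldP5 w c) univ {v | levelH v = c ∧ 0 < j v} := by
  have hH := contDiff_levelH.continuous
  set K : Set (Fin 2 → ℝ) := {v | |levelH v - c| ≤ ε ∧ 0 < j v} with hKdef
  have hK : IsCompact K := by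
    have heq : K = {v | levelH v ≤ c + ε} ∩ ({v | |levelH v - c| ≤ ε} ∩ {v | 0 ≤ j v}) := by
      ext v
      constructor
      · rintro ⟨h1, h2⟩
        refine ⟨?_, h1, h2.le⟩
        have := (abs_le.mp h1).2
        change levelH v ≤ c + ε
        linarith
      · rintro ⟨-, h1, h2⟩
        exact ⟨h1, lt_of_le_of_ne h2 (hjne v h1).symm⟩
    rw [heq]
    exact (isCompact_levelH_le _).inter_right
      ((isClosed_le (hH.sub continuous_const).abs continuous_const).inter
        (isClosed_le continuous_const hj))
  have hd : ∀ (k : ℝ) (γ : ℝ → Fin 2 → ℝ) (t : ℝ), HasDerivAt γ (k • fieldP5 w c (γ t)) t →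
      HasDerivAt (fun s => (levelH (γ s) - c) ^ 2)
        (k * (4 * coeffS (γ t) * (levelH (γ t) - c) ^ 2)) t := by
    intro k γ t h
    refine (((hasDerivAt_levelH h).sub_const c).pow 2).congr_deriv ?_
    push_cast
    ring
  refine isAttractingLimitCycle_of_lyapunov (contDiff_neg_fieldP5 hw c) (isCycle_neg hcyc) hK
    (subset_univ K) (U := {v | |levelH v - c| < ε ∧ 0 < j v})
    (V := fun v => (levelH v - c) ^ 2)
    (D := fun v => -1 * (4 * coeffS v * (levelH v - c) ^ 2)) ?_ ?_ ?_ ?_ ?_ ?_ ?_ ?_ ?_ ?_ ?_ ?_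
  · rintro v ⟨h1, h2⟩
    exact ⟨by rw [h1, sub_self, abs_zero]; exact hε.le, h2⟩
  · exact (isOpen_lt (hH.sub continuous_const).abs continuous_const).inter
      (isOpen_lt continuous_const hj)
  · rintro v ⟨h1, h2⟩
    exact ⟨by rw [h1, sub_self, abs_zero]; exact hε, h2⟩
  · rintro v ⟨⟨h1, h2⟩, -⟩
    exact ⟨h1.le, h2⟩
  · intro χ γ hχ hχ0 hγ h0
    have hγc : Continuous γ := continuous_iff_continuousAt.mpr fun t => (hγ t).continuousAt
    have hanti : Antitone fun s => (levelH (γ s) - c) ^ 2 := by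
      refine antitone_of_hasDerivAt_nonpos (fun t => hd (-χ (γ t)) γ t ?_) fun t => ?_
      · simpa using hγ t
      · have h1 := coeffS_nonneg (γ t)
        have h2 := hχ0 (γ t)
        have h3 : 0 ≤ χ (γ t) * (4 * coeffS (γ t) * (levelH (γ t) - c) ^ 2) := by positivity
        simp only [Pi.zero_apply]
        linarith
    have habs : ∀ t, 0 ≤ t → |levelH (γ t) - c| ≤ ε := fun t ht =>
      (sq_le_sq.mp (hanti ht)).trans h0.1
    exact fun t ht => ⟨habs t ht, pos_of_ne_zero_of_pos (hj.comp hγc) h0.2 ht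
      fun s hs => hjne _ (habs s hs)⟩
  · exact ((hH.sub continuous_const).pow 2).continuousOn
  · exact (continuous_const.mul ((continuous_const.mul continuous_coeffS).mul
      ((hH.sub continuous_const).pow 2))).continuousOn
  · exact fun v _ => sq_nonneg _
  · intro v _
    have h1 := coeffS_nonneg v
    have h3 : 0 ≤ 4 * coeffS v * (levelH v - c) ^ 2 := by positivity
    linarith
  · intro v hv h0
    have h1 : 4 * coeffS v * (levelH v - c) ^ 2 = 0 := by linarith
    exact (mul_eq_zero.mp h1).resolve_left (mul_ne_zero four_ne_zero (hS v hv.1))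
  · intro v hv h0
    have := pow_eq_zero_iff two_ne_zero |>.mp h0
    exact ⟨by linarith, hv.2⟩
  · intro γ t _ h
    exact hd (-1) γ t (by simpa using h)

theorem exists_axis_point {c : ℝ} (hc : -(1 / 4) ≤ c) :
    ∃ y : ℝ, 0 < y ∧ (y ^ 2) ^ 2 - y ^ 2 = c := by
  have h1 : √(1 + 4 * c) ^ 2 = 1 + 4 * c := Real.sq_sqrt (by linarith)
  have h2 : 0 ≤ √(1 + 4 * c) := Real.sqrt_nonneg _
  -- y² is the larger root of z² - z = c, which is positive.
  refine ⟨√((1 + √(1 + 4 * c)) / 2), Real.sqrt_pos.mpr (by linarith), ?_⟩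
  rw [Real.sq_sqrt (by linarith)]
  linarith

/-- The point `(0, σ / √2)`: the upper one for `σ = 1`, the lower one for `σ = -1`. -/
def spiralPoint (σ : ℝ) : Fin 2 → ℝ := ![0, σ * (1 / √2)]

theorem spiralPoint_one : spiralPoint 1 = upperPoint := by
  simp [spiralPoint, upperPoint]

theorem spiralPoint_neg_one : spiralPoint (-1) = lowerPoint := by
  simp [spiralPoint, lowerPoint]

theorem levelH_axis (y : ℝ) : levelH ![0, y] = (y ^ 2) ^ 2 - y ^ 2 := by
  simp [levelH]

theorem levelH_spiralPoint {σ : ℝ} (hσ : σ ^ 2 = 1) : levelH (spiralPoint σ) = -(1 / 4) := by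
  rw [spiralPoint, levelH_axis, mul_pow, hσ, sq_one_div_sqrt_two]
  norm_num

/-- The left side is ½(v - p)·∇H. As a combination of the squares x² and (y - p₁)² it shows its
sign: both weights are positive in the half plane of p. -/
theorem rotation_form_spiralPoint {σ : ℝ} (hσ : σ ^ 2 = 1) (v : Fin 2 → ℝ) :
    (v 0 - spiralPoint σ 0) * coeffA v + (v 1 - spiralPoint σ 1) * coeffB v =
      v 0 ^ 2 * (2 * v 0 ^ 2 + 2 * v 1 ^ 2 + 1 + 2 * (v 1 - σ * (1 / √2)) * v 1) +
        (v 1 - σ * (1 / √2)) ^ 2 * (2 * v 1 * (v 1 + σ * (1 / √2))) := by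
  have hs := sq_one_div_sqrt_two
  have h2 : (σ * (1 / √2)) ^ 2 = 1 / 2 := by rw [mul_pow, hσ, hs, one_mul]
  simp only [spiralPoint, coeffA, coeffB, Matrix.cons_val_zero, Matrix.cons_val_one]
  set s := σ * (1 / √2)
  linear_combination (2 * v 1 * (v 1 - s)) * h2

/-- Substituting Y = σy treats both halves at once. The form can vanish only for x = 0 and Y = 1/√2,
that is at the spiral point, where H = -1/4. -/
theorem rotation_form_pos {σ : ℝ} (hσ : σ ^ 2 = 1) {v : Fin 2 → ℝ} (hv : 0 < σ * v 1)
    (hne : levelH v ≠ -(1 / 4)) :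
    0 < (v 0 - spiralPoint σ 0) * coeffA v + (v 1 - spiralPoint σ 1) * coeffB v := by
  have hs := sq_one_div_sqrt_two
  have hs0 := one_div_sqrt_two_pos
  rw [rotation_form_spiralPoint hσ]
  set s := 1 / √2
  set Y := σ * v 1 with hY
  have hY2 : Y ^ 2 = v 1 ^ 2 := by rw [hY, mul_pow, hσ, one_mul]
  have e1 : 2 * v 0 ^ 2 + 2 * v 1 ^ 2 + 1 + 2 * (v 1 - σ * s) * v 1 =
      2 * v 0 ^ 2 + 4 * Y ^ 2 + 1 - 2 * s * Y := by
    rw [hY2, hY]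
    ring
  have e2 : 2 * v 1 * (v 1 + σ * s) = 2 * Y * (Y + s) := by
    linear_combination -2 * hY2
  have e3 : (v 1 - σ * s) ^ 2 = (Y - s) ^ 2 := by
    rw [hY]
    linear_combination (s ^ 2 - v 1 ^ 2) * hσ
  rw [e1, e2, e3]
  have p1 : 0 < 2 * v 0 ^ 2 + 4 * Y ^ 2 + 1 - 2 * s * Y := by
    nlinarith [sq_nonneg (v 0), sq_nonneg (Y - s)]
  have p2 : 0 < 2 * Y * (Y + s) := by positivity
  by_contra! hcon
  have q1 : 0 ≤ v 0 ^ 2 * (2 * v 0 ^ 2 + 4 * Y ^ 2 + 1 - 2 * s * Y) := by positivity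
  have q2 : 0 ≤ (Y - s) ^ 2 * (2 * Y * (Y + s)) := by positivity
  have z1 : v 0 ^ 2 * (2 * v 0 ^ 2 + 4 * Y ^ 2 + 1 - 2 * s * Y) = 0 := by linarith
  have z2 : (Y - s) ^ 2 * (2 * Y * (Y + s)) = 0 := by linarith
  have r1 : v 0 ^ 2 = 0 := (mul_eq_zero.mp z1).resolve_right p1.ne'
  have r2 : Y - s = 0 := by
    have := (mul_eq_zero.mp z2).resolve_right p2.ne'
    exact pow_eq_zero_iff two_ne_zero |>.mp this
  have r3 : v 1 ^ 2 = 1 / 2 := by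
    rw [← hY2, show Y = s by linarith, hs]
  refine hne ?_
  unfold levelH
  rw [r1, r3]
  norm_num

/-- This compares H at the parameters k and 1 of a ray from a spiral point. The difference of the
two sides is (k - 1)G. Replacing q by its lower bound b² and writing kb = t - s, with t > 0 the
height of the point at k, makes k²G a sum of nonnegative terms, the first positive. -/
theorem radial_quartic_ne {q b s k : ℝ} (hs : s ^ 2 = 1 / 2) (hs0 : 0 < s) (hk : 1 < k)
    (ht : 0 < s + k * b) (hq : b ^ 2 ≤ q) :
    q * k ^ 4 + 4 * s * b * k ^ 3 + 2 * k ^ 2 ≠ q + 4 * s * b + 2 := by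
  set t := s + k * b with htdef
  have hkb : k * b = t - s := by rw [htdef]; ring
  have hG : 0 < k ^ 2 *
      (q * ((k + 1) * (k ^ 2 + 1)) + 4 * s * b * (k ^ 2 + k + 1) + 2 * (k + 1)) := by
    have h1 : k ^ 2 * (b ^ 2 * ((k + 1) * (k ^ 2 + 1)) + 4 * s * b * (k ^ 2 + k + 1)
        + 2 * (k + 1)) = t ^ 2 * ((k + 1) * (k ^ 2 + 1)) +
        t * s * (2 * k ^ 3 + 2 * k ^ 2 + 2 * k - 2) +
        1 / 2 * ((k - 1) * (k ^ 2 + 2 * k - 1)) := by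
      have h2 : k ^ 2 * b ^ 2 = (t - s) ^ 2 := by rw [← hkb]; ring
      linear_combination ((k + 1) * (k ^ 2 + 1)) * h2 + 4 * s * k * (k ^ 2 + k + 1) * hkb +
        ((k + 1) * (k ^ 2 + 1) - 4 * k * (k ^ 2 + k + 1)) * hs
    have h3 : 0 < t ^ 2 * ((k + 1) * (k ^ 2 + 1)) := by positivity
    have h4 : 0 ≤ t * s * (2 * k ^ 3 + 2 * k ^ 2 + 2 * k - 2) := by
      have : 0 ≤ 2 * k ^ 3 + 2 * k ^ 2 + 2 * k - 2 := by
        have : 0 < k ^ 3 := by positivity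
        nlinarith
      positivity
    have h5 : 0 ≤ (k - 1) * (k ^ 2 + 2 * k - 1) := mul_nonneg (by linarith) (by nlinarith)
    have h6 : 0 ≤ k ^ 2 * ((q - b ^ 2) * ((k + 1) * (k ^ 2 + 1))) := by
      have : 0 ≤ q - b ^ 2 := by linarith
      positivity
    linarith
  have hG' := pos_of_mul_pos_right hG (sq_nonneg k)
  intro h
  have h7 : (k - 1) *
      (q * ((k + 1) * (k ^ 2 + 1)) + 4 * s * b * (k ^ 2 + k + 1) + 2 * (k + 1)) = 0 := by
    linear_combination h
  rcases mul_eq_zero.mp h7 with h8 | h8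
  · linarith
  · linarith

theorem levelH_radial {σ : ℝ} (hσ : σ ^ 2 = 1) {a b k : ℝ} {u : Fin 2 → ℝ}
    (h0 : u 0 - spiralPoint σ 0 = k * a) (h1 : u 1 - spiralPoint σ 1 = k * b) :
    levelH u + 1 / 4 = (a ^ 2 + b ^ 2) *
      ((a ^ 2 + b ^ 2) * k ^ 4 + 4 * (1 / √2) * (σ * b) * k ^ 3 + 2 * k ^ 2) := by
  have hs := sq_one_div_sqrt_two
  simp only [spiralPoint, Matrix.cons_val_zero, Matrix.cons_val_one] at h0 h1
  set s := 1 / √2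
  have e0 : u 0 = k * a := by linarith
  have e1 : u 1 = σ * s + k * b := by linarith
  have e2 : u 0 ^ 2 + u 1 ^ 2 - 1 / 2 = k ^ 2 * (a ^ 2 + b ^ 2) + 2 * k * s * (σ * b) := by
    rw [e0, e1]
    linear_combination s ^ 2 * hσ + hs
  rw [levelH_add_quarter, e2, e0]
  linear_combination (4 * k ^ 2 * s ^ 2 * b ^ 2) * hσ + (4 * k ^ 2 * b ^ 2) * hs

/-- A ray from the spiral point meets its half of the level curve at most once: by `levelH_radial`
two intersections would give equal values of the quartic excluded by `radial_quartic_ne`. -/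
theorem star_spiralPoint {σ : ℝ} (hσ : σ ^ 2 = 1) {c : ℝ} (hc : -(1 / 4) < c)
    {u v : Fin 2 → ℝ} (hu : levelH u = c) (hu1 : 0 < σ * u 1) (hv : levelH v = c)
    (hv1 : 0 < σ * v 1) {k : ℝ} (hk : 0 < k)
    (h0 : u 0 - spiralPoint σ 0 = k * (v 0 - spiralPoint σ 0))
    (h1 : u 1 - spiralPoint σ 1 = k * (v 1 - spiralPoint σ 1)) : u = v := by
  have hs := sq_one_div_sqrt_two
  have hs0 := one_div_sqrt_two_pos
  have key : ∀ (u v : Fin 2 → ℝ) (k : ℝ), levelH u = c → 0 < σ * u 1 → levelH v = c →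
      1 < k → u 0 - spiralPoint σ 0 = k * (v 0 - spiralPoint σ 0) →
      u 1 - spiralPoint σ 1 = k * (v 1 - spiralPoint σ 1) → False := by
    intro u v k hu hu1 hv hk h0 h1
    have eu := levelH_radial hσ h0 h1
    have ev := levelH_radial hσ (one_mul (v 0 - spiralPoint σ 0)).symm
      (one_mul (v 1 - spiralPoint σ 1)).symm
    set a := v 0 - spiralPoint σ 0
    set b := v 1 - spiralPoint σ 1
    have hq : a ^ 2 + b ^ 2 ≠ 0 := fun hq => by
      rw [hq, zero_mul] at eu
      linarith
    refine radial_quartic_ne (q := a ^ 2 + b ^ 2) (b := σ * b) hs hs0 hk ?_ ?_ ?_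
    · simp only [spiralPoint, Matrix.cons_val_one, Matrix.cons_val_zero] at h1
      have e1 : u 1 = σ * (1 / √2) + k * b := by linarith
      rw [e1] at hu1
      have : σ * (σ * (1 / √2) + k * b) = 1 / √2 + k * (σ * b) := by
        linear_combination (1 / √2) * hσ
      linarith
    · rw [mul_pow, hσ]
      nlinarith [sq_nonneg a]
    · refine mul_left_cancel₀ hq ?_
      rw [hu] at eu
      rw [hv] at ev
      linear_combination ev - eu
  -- The case k < 1 becomes k > 1 after exchanging u and v.
  rcases lt_trichotomy k 1 with hlt | rfl | hgt
  · refine (key v u k⁻¹ hv hv1 hu ((one_lt_inv₀ hk).mpr hlt) ?_ ?_).elim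
    · rw [h0, inv_mul_cancel_left₀ hk.ne']
    · rw [h1, inv_mul_cancel_left₀ hk.ne']
  · ext i
    fin_cases i
    · change u 0 = v 0
      linarith
    · change u 1 = v 1
      linarith
  · exact (key u v k hu hu1 hv hgt h0 h1).elim

/-- For `-1/4 < c < 0` the halves of the curve `C = 0` are repelling limit cycles. -/
theorem isRepellingLimitCycle_half {w : (Fin 2 → ℝ) → ℝ} (hw : ContDiff ℝ 1 w)
    (hpos : ∀ v, 0 < w v) {c : ℝ} (hc : -(1 / 4) < c) (hc0 : c < 0) {σ : ℝ} (hσ : σ ^ 2 = 1) :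
    IsRepellingLimitCycle (fieldP5 w c) univ {v | levelH v = c ∧ 0 < σ * v 1} := by
  have hσ0 : σ ≠ 0 := fun h => by simp [h] at hσ
  have hjc : Continuous fun v : Fin 2 → ℝ => σ * v 1 := by fun_prop
  have hjne : ∀ v : Fin 2 → ℝ, levelH v < 0 → σ * v 1 ≠ 0 := by
    intro v hv h
    have h1 := levelH_of_apply_one_eq_zero ((mul_eq_zero.mp h).resolve_left hσ0)
    have : 0 ≤ levelH v := by rw [h1]; positivity
    linarith
  -- The band must avoid the critical levels -1/4 and 0; staying below 0 also keeps it off the axis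
  -- y = 0, where H ≥ 0.
  set ε := min (-c) (c + 1 / 4) / 2 with hε
  have he1 : ε < -c := by
    have := min_le_left (-c) (c + 1 / 4)
    linarith
  have he2 : ε < c + 1 / 4 := by
    have := min_le_right (-c) (c + 1 / 4)
    linarith
  have he0 : 0 < ε := by
    have : 0 < min (-c) (c + 1 / 4) := lt_min (by linarith) (by linarith)
    linarith
  obtain ⟨y, hy0, hy⟩ := exists_axis_point hc.le
  refine isRepellingLimitCycle_level hw hjc he0 (fun v hv => hjne v ?_) (fun v hv => ?_)
    (isCycle_level hw hpos hjc (fun v hv => hjne v (hv ▸ hc0)) (p := spiralPoint σ)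
      (by rw [levelH_spiralPoint hσ]; exact hc.ne)
      (fun v hv hv1 => rotation_form_pos hσ hv1 (by rw [hv]; exact hc.ne'))
      (fun u v hu hu1 hv hv1 k hk h0 h1 => star_spiralPoint hσ hc hu hu1 hv hv1 hk h0 h1)
      ⟨![0, σ * y], ?_, ?_⟩)
  · linarith [(abs_le.mp hv).2]
  · refine (coeffS_pos_of_levelH_ne ?_ ?_).ne'
    · linarith [(abs_le.mp hv).2]
    · linarith [(abs_le.mp hv).1]
  · rw [levelH_axis, mul_pow, hσ, one_mul, hy]
  · simp only [Matrix.cons_val_one, Matrix.cons_val_zero]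
    have : σ * (σ * y) = y := by linear_combination y * hσ
    rwa [this]

/-- For `c > 0` the curve `C = 0` is a repelling limit cycle. -/
theorem isRepellingLimitCycle_curve {w : (Fin 2 → ℝ) → ℝ} (hw : ContDiff ℝ 1 w)
    (hpos : ∀ v, 0 < w v) {c : ℝ} (hc : 0 < c) :
    IsRepellingLimitCycle (fieldP5 w c) univ {v | levelH v = c} := by
  have heq : {v : Fin 2 → ℝ | levelH v = c} = {v | levelH v = c ∧ (0 : ℝ) < 1} := by simp
  rw [heq]
  obtain ⟨y, hy0, hy⟩ := exists_axis_point (c := c) (by linarith)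
  refine isRepellingLimitCycle_level hw (j := fun _ => 1) continuous_const (half_pos hc)
    (fun _ _ => one_ne_zero) (fun v hv => ?_)
    (isCycle_level hw hpos (j := fun _ => 1) continuous_const (fun _ _ => one_ne_zero) (p := 0)
      (by rw [levelH_zero]; exact hc.ne) ?_ ?_ ⟨![0, y], by rw [levelH_axis, hy], one_pos⟩)
  · have := (abs_le.mp hv).1
    exact (coeffS_pos_of_levelH_ne (by linarith) (by linarith)).ne'
  · intro v hv _
    -- By Euler's identity for the parts of degree 4 and 2, the rotation form about the origin is
    -- the quartic part plus H.
    have h1 : (v 0 - (0 : Fin 2 → ℝ) 0) * coeffA v + (v 1 - (0 : Fin 2 → ℝ) 1) * coeffB v =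
        (v 0 ^ 2 + v 1 ^ 2) ^ 2 + levelH v := by
      simp only [Pi.zero_apply, coeffA, coeffB, levelH]
      ring
    rw [h1, hv]
    positivity
  · intro u v hu _ hv _ k hk h0 h1
    simp only [Pi.zero_apply, sub_zero] at h0 h1
    have hk2 : (k ^ 2 - 1) * ((v 0 ^ 2 + v 1 ^ 2) ^ 2 * k ^ 2 + c) = 0 := by
      rw [← hv] at hu ⊢
      unfold levelH at hu ⊢
      rw [h0, h1] at hu
      linear_combination hu
    have hpos2 : 0 < (v 0 ^ 2 + v 1 ^ 2) ^ 2 * k ^ 2 + c := by positivity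
    have h2 := (mul_eq_zero.mp hk2).resolve_right hpos2.ne'
    have hk1 : k = 1 := by nlinarith
    ext i
    fin_cases i
    · simpa [hk1] using h0
    · simpa [hk1] using h1

end LimitCycles

/-! ### Spiral points -/

section Spirals

/-- Convergence of H to its minimum must yield convergence to the point. Here (Y² - 1/2)² = (Y -
s)²(Y + s)², and (Y + s)² ≥ 1/2 because Y > 0. -/
theorem sq_dist_spiralPoint_le {σ : ℝ} (hσ : σ ^ 2 = 1) {v : Fin 2 → ℝ} (hv : 0 < σ * v 1)
    (h1 : levelH v + 1 / 4 ≤ 1) :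
    (v 0 - spiralPoint σ 0) ^ 2 + (v 1 - spiralPoint σ 1) ^ 2 ≤ 6 * (levelH v + 1 / 4) := by
  have hs := sq_one_div_sqrt_two
  have hs0 := one_div_sqrt_two_pos
  simp only [spiralPoint, Matrix.cons_val_one, Matrix.cons_val_zero, sub_zero]
  set s := 1 / √2
  set Y := σ * v 1 with hY
  have hY2 : v 1 ^ 2 = Y ^ 2 := by rw [hY, mul_pow, hσ, one_mul]
  have e3 : (v 1 - σ * s) ^ 2 = (Y - s) ^ 2 := by
    rw [hY]
    linear_combination (s ^ 2 - v 1 ^ 2) * hσ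
  have hh := levelH_add_quarter v
  rw [hY2] at hh
  rw [e3]
  set h := levelH v + 1 / 4
  have hx : v 0 ^ 2 ≤ h / 2 := by nlinarith [sq_nonneg (v 0 ^ 2 + Y ^ 2 - 1 / 2)]
  have h2 : (Y - s) ^ 2 ≤ 2 * (Y ^ 2 - 1 / 2) ^ 2 := by
    have h3 : (Y ^ 2 - 1 / 2) ^ 2 = (Y - s) ^ 2 * (Y + s) ^ 2 := by
      rw [← hs]
      ring
    rw [h3]
    have h4 : 1 / 2 ≤ (Y + s) ^ 2 := by nlinarith [mul_pos hv hs0]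
    nlinarith [sq_nonneg (Y - s)]
  have h5 : (Y ^ 2 - 1 / 2) ^ 2 ≤ 2 * (v 0 ^ 2 + Y ^ 2 - 1 / 2) ^ 2 + 2 * (v 0 ^ 2) ^ 2 := by
    nlinarith [sq_nonneg (v 0 ^ 2 + Y ^ 2 - 1 / 2 + v 0 ^ 2)]
  have h6 : (v 0 ^ 2) ^ 2 ≤ v 0 ^ 2 := by nlinarith [sq_nonneg (v 0)]
  nlinarith [sq_nonneg (v 0)]

/-- The part of the angular velocity about a spiral that comes from the radial component. -/
theorem abs_radial_form_le {σ : ℝ} (hσ : σ ^ 2 = 1) (v : Fin 2 → ℝ) :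
    |(v 0 - spiralPoint σ 0) * coeffB v - (v 1 - spiralPoint σ 1) * coeffA v| ≤
      ((v 0 - spiralPoint σ 0) ^ 2 + (v 1 - spiralPoint σ 1) ^ 2) *
        (2 * |v 0 * v 1| + |σ * (1 / √2) * (v 1 - σ * (1 / √2)) - v 0 ^ 2|) := by
  have hs := sq_one_div_sqrt_two
  have h2 : (σ * (1 / √2)) ^ 2 = 1 / 2 := by rw [mul_pow, hσ, hs, one_mul]
  simp only [spiralPoint, coeffA, coeffB, Matrix.cons_val_zero, Matrix.cons_val_one, sub_zero]
  set s := σ * (1 / √2)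
  set x := v 0
  set y := v 1
  have e : x * (y * (2 * x ^ 2 + 2 * y ^ 2 - 1)) - (y - s) * (x * (2 * x ^ 2 + 2 * y ^ 2 + 1)) =
      2 * x ^ 2 * (x * y) + 2 * (x * (y - s)) * (s * (y - s) - x ^ 2) := by
    linear_combination (4 * x * y - 2 * s * x) * h2
  rw [e]
  refine (abs_add_le _ _).trans ?_
  rw [abs_mul, abs_mul (2 * (x * (y - s))), abs_of_nonneg (show 0 ≤ 2 * x ^ 2 by positivity)]
  have h3 : |2 * (x * (y - s))| ≤ x ^ 2 + (y - s) ^ 2 := by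
    rw [abs_le]
    constructor <;> nlinarith [sq_nonneg (x - (y - s)), sq_nonneg (x + (y - s))]
  have h4 := abs_nonneg (x * y)
  have h5 := abs_nonneg (s * (y - s) - x ^ 2)
  have h6 := mul_le_mul_of_nonneg_right h3 h5
  nlinarith [mul_nonneg (sq_nonneg (y - s)) h4]

/-- The Hamiltonian part contributes at least w times the squared distance once both weights are at
least 1. The gradient part contributes at most |C| times the squared distance times a bracket that
vanishes at the spiral point. -/
theorem angular_form_ge {σ : ℝ} (hσ : σ ^ 2 = 1) {w : (Fin 2 → ℝ) → ℝ} (c : ℝ) {v : Fin 2 → ℝ}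
    {m : ℝ} (hw : 0 ≤ w v)
    (hm : m ≤ w v - |levelH v - c| *
      (2 * |v 0 * v 1| + |σ * (1 / √2) * (v 1 - σ * (1 / √2)) - v 0 ^ 2|))
    (h1 : 1 ≤ 2 * v 0 ^ 2 + 2 * v 1 ^ 2 + 1 + 2 * (v 1 - σ * (1 / √2)) * v 1)
    (h2 : 1 ≤ 2 * v 1 * (v 1 + σ * (1 / √2))) :
    m * ((v 0 - spiralPoint σ 0) ^ 2 + (v 1 - spiralPoint σ 1) ^ 2) ≤
      (v 0 - spiralPoint σ 0) * fieldP5 w c v 1 - (v 1 - spiralPoint σ 1) * fieldP5 w c v 0 := by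
  have hrot := rotation_form_spiralPoint hσ v
  have habs := abs_radial_form_le hσ v
  have hp0 : spiralPoint σ 0 = 0 := by simp [spiralPoint]
  have hp1 : spiralPoint σ 1 = σ * (1 / √2) := by simp [spiralPoint]
  have hr : 0 ≤ (v 0 - spiralPoint σ 0) ^ 2 + (v 1 - spiralPoint σ 1) ^ 2 := by positivity
  have h3 : (v 0 - spiralPoint σ 0) ^ 2 + (v 1 - spiralPoint σ 1) ^ 2 ≤
      (v 0 - spiralPoint σ 0) * coeffA v + (v 1 - spiralPoint σ 1) * coeffB v := by
    rw [hrot, hp0, hp1, sub_zero]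
    exact add_le_add (le_mul_of_one_le_right (sq_nonneg _) h1)
      (le_mul_of_one_le_right (sq_nonneg _) h2)
  have h4 := mul_le_mul_of_nonneg_left h3 hw
  have h5 := mul_le_mul_of_nonneg_left habs (abs_nonneg (levelH v - c))
  rw [← abs_mul] at h5
  have h6 := (abs_le.mp h5).1
  have h7 := mul_le_mul_of_nonneg_right hm hr
  have e1 : (v 0 - spiralPoint σ 0) * fieldP5 w c v 1 - (v 1 - spiralPoint σ 1) * fieldP5 w c v 0 =
      (levelH v - c) *
        ((v 0 - spiralPoint σ 0) * coeffB v - (v 1 - spiralPoint σ 1) * coeffA v) +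
      w v * ((v 0 - spiralPoint σ 0) * coeffA v + (v 1 - spiralPoint σ 1) * coeffB v) := by
    simp only [fieldP5, Matrix.cons_val_zero, Matrix.cons_val_one]
    ring
  rw [e1]
  refine h7.trans ?_
  rw [sub_mul]
  refine (sub_le_sub_right h4 _).trans ?_
  have e2 := mul_assoc |levelH v - c| ((v 0 - spiralPoint σ 0) ^ 2 + (v 1 - spiralPoint σ 1) ^ 2)
    (2 * |v 0 * v 1| + |σ * (1 / √2) * (v 1 - σ * (1 / √2)) - v 0 ^ 2|)
  rw [mul_right_comm, e2]
  exact (sub_le_iff_le_add.mpr (by linarith))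

/-- The sign e = ±1 covers the field and its reversal. Hypothesis `hC` makes H nonincreasing below
level l, and lets C vanish there only at the minimum level. -/
theorem isStableSpiral_spiralPoint {w : (Fin 2 → ℝ) → ℝ} (hw : ContDiff ℝ 1 w)
    (hpos : ∀ v, 0 < w v) {c e l : ℝ} (he : e ^ 2 = 1) (hl : -(1 / 4) < l)
    (hC : ∀ v, levelH v < l → e * (levelH v - c) ≤ 0 ∧ (levelH v = c → levelH v = -(1 / 4)))
    {σ : ℝ} (hσ : σ ^ 2 = 1) :
    IsStableSpiral (fun v => e • fieldP5 w c v) (spiralPoint σ) := by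
  set p := spiralPoint σ with hp
  have hs := sq_one_div_sqrt_two
  have hs0 := one_div_sqrt_two_pos
  have hH := contDiff_levelH.continuous
  have hHp : levelH p = -(1 / 4) := levelH_spiralPoint hσ
  have hσ0 : σ ≠ 0 := fun h => by simp [h] at hσ
  have hF : ContDiff ℝ 1 (fun v => e • fieldP5 w c v) := (contDiff_fieldP5 hw c).const_smul e
  have hp0 : p 0 = 0 := by simp [hp, spiralPoint]
  have hp1 : p 1 = σ * (1 / √2) := by simp [hp, spiralPoint]
  have hσp : 0 < σ * p 1 := by
    rw [hp1, ← mul_assoc, ← sq, hσ, one_mul]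
    exact hs0
  have hFp : e • fieldP5 w c p = 0 := by
    rw [(fieldP5_eq_zero_iff hpos c p).mpr (coeffS_eq_zero_of_level_le hHp.le), smul_zero]
  refine ⟨hFp, fun U hU => ?_⟩
  -- g is the lower bound for the angular velocity from `angular_form_ge`; at p it equals w p.
  set g : (Fin 2 → ℝ) → ℝ := fun v => w v - |levelH v - c| *
    (2 * |v 0 * v 1| + |σ * (1 / √2) * (v 1 - σ * (1 / √2)) - v 0 ^ 2|) with hg
  have hgc : Continuous g := by
    have := hw.continuous
    fun_prop
  have hgp : g p = w p := by simp [hg, hp0, hp1]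
  have hgood : ∀ᶠ v in 𝓝 p, v ∈ U ∧ w p / 2 < g v ∧
      1 < 2 * v 0 ^ 2 + 2 * v 1 ^ 2 + 1 + 2 * (v 1 - σ * (1 / √2)) * v 1 ∧
      1 < 2 * v 1 * (v 1 + σ * (1 / √2)) := by
    refine Filter.Eventually.and hU ?_
    have hpp : p 1 ^ 2 = 1 / 2 := by rw [hp1, mul_pow, hσ, hs, one_mul]
    refine ((hgc.tendsto p).eventually (lt_mem_nhds ?_)).and
      ((Continuous.tendsto (by fun_prop) p).eventually (lt_mem_nhds ?_) |>.and
        ((Continuous.tendsto (by fun_prop) p).eventually (lt_mem_nhds ?_)))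
    · rw [hgp]
      linarith [hpos p]
    · rw [← hp1, hpp, hp0]
      norm_num
    · rw [← hp1]
      nlinarith
  obtain ⟨ρ, hρ, hball⟩ := Metric.eventually_nhds_iff_ball.mp hgood
  -- The first bound gives squared distance at most 6ε < ρ², the second keeps H below l, and the
  -- third keeps H below 0, hence off the axis y = 0 and away from the saddle.
  set ε := min (ρ ^ 2 / 12) (min ((l + 1 / 4) / 2) (1 / 8)) with hε
  have hε0 : 0 < ε := lt_min (by positivity) (lt_min (by linarith) (by norm_num))
  have hε1 : ε ≤ ρ ^ 2 / 12 := min_le_left _ _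
  have hε2 : ε ≤ (l + 1 / 4) / 2 := (min_le_right _ _).trans (min_le_left _ _)
  have hε3 : ε ≤ 1 / 8 := (min_le_right _ _).trans (min_le_right _ _)
  have hjne : ∀ v : Fin 2 → ℝ, levelH v ≤ -(1 / 4) + ε → σ * v 1 ≠ 0 := by
    intro v hv h
    have h1 := levelH_of_apply_one_eq_zero ((mul_eq_zero.mp h).resolve_left hσ0)
    have : 0 ≤ levelH v := by rw [h1]; positivity
    linarith
  set K : Set (Fin 2 → ℝ) := {v | levelH v ≤ -(1 / 4) + ε ∧ 0 < σ * v 1} with hKdef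
  have hjc : Continuous fun v : Fin 2 → ℝ => σ * v 1 := by fun_prop
  have hK : IsCompact K := by
    have heq : K = {v | levelH v ≤ -(1 / 4) + ε} ∩ {v | 0 ≤ σ * v 1} := by
      ext v
      constructor
      · rintro ⟨h1, h2⟩
        exact ⟨h1, h2.le⟩
      · rintro ⟨h1, h2⟩
        exact ⟨h1, lt_of_le_of_ne h2 (hjne v h1).symm⟩
    rw [heq]
    exact (isCompact_levelH_le _).inter_right (isClosed_le continuous_const hjc)
  have hKdist : ∀ v ∈ K, (v 0 - p 0) ^ 2 + (v 1 - p 1) ^ 2 ≤ 6 * (levelH v + 1 / 4) :=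
    fun v hv => sq_dist_spiralPoint_le hσ hv.2 (by linarith [hv.1])
  have hKball : ∀ v ∈ K, v ∈ Metric.ball p ρ := by
    intro v hv
    have h1 := hKdist v hv
    have h2 := hv.1
    have h3 : (v 0 - p 0) ^ 2 + (v 1 - p 1) ^ 2 < ρ ^ 2 := by nlinarith [sq_pos_of_pos hρ]
    rw [Metric.mem_ball, dist_pi_lt_iff hρ]
    intro i
    rw [Real.dist_eq]
    refine abs_lt_of_sq_lt_sq ?_ hρ.le
    fin_cases i
    · change (v 0 - p 0) ^ 2 < _
      nlinarith [sq_nonneg (v 1 - p 1)]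
    · change (v 1 - p 1) ^ 2 < _
      nlinarith [sq_nonneg (v 0 - p 0)]
  refine ⟨{v | levelH v < -(1 / 4) + ε} ∩ {v | 0 < σ * v 1},
    ((isOpen_lt hH continuous_const).inter (isOpen_lt continuous_const hjc)).mem_nhds
      ⟨by change levelH p < _; linarith, hσp⟩, ?_⟩
  rintro q ⟨hq1, hq2⟩ hqp
  have hq1 : levelH q < -(1 / 4) + ε := hq1
  obtain ⟨R, hR⟩ := hK.isBounded.subset_closedBall (0 : Fin 2 → ℝ)
  obtain ⟨χ, hχ, hχ0, hχ1, γ, hγ0, hγ⟩ := exists_cutoff_solution hF q R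
  have hγc : Continuous γ := continuous_iff_continuousAt.mpr fun t => (hγ t).continuousAt
  have hγ' : ∀ t, HasDerivAt γ ((χ (γ t) * e) • fieldP5 w c (γ t)) t := fun t => by
    simpa only [smul_smul] using hγ t
  obtain ⟨ex, hex0, hex⟩ := exists_levelH_eq (k := fun t => χ (γ t) * e)
    ((hχ.continuous.comp hγc).mul continuous_const) hγ'
  have hsign : ∀ t, e * (levelH (γ t) - c) ≤ 0 := fun t => by
    rw [hex t, ← mul_assoc]
    refine mul_nonpos_of_nonpos_of_nonneg ?_ (hex0 t).le
    rw [hγ0]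
    exact (hC q (by linarith)).1
  have hanti : Antitone fun t => levelH (γ t) := by
    refine antitone_of_hasDerivAt_nonpos (fun t => hasDerivAt_levelH (hγ' t)) fun t => ?_
    have h1 := mul_nonpos_of_nonneg_of_nonpos (mul_nonneg (hχ0 (γ t)) (coeffS_nonneg (γ t)))
      (hsign t)
    simp only [Pi.zero_apply]
    linarith
  have hlev : ∀ t, 0 ≤ t → levelH (γ t) ≤ -(1 / 4) + ε := fun t ht => by
    have : levelH (γ t) ≤ levelH (γ 0) := hanti ht
    rw [hγ0] at this
    linarith
  have hγK : ∀ t, 0 ≤ t → γ t ∈ K := fun t ht => ⟨hlev t ht,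
    pos_of_ne_zero_of_pos (hjc.comp hγc) (by simpa [hγ0] using hq2) ht
      fun s hs => hjne _ (hlev s hs)⟩
  have hγF : ∀ t, 0 ≤ t → HasDerivAt γ (e • fieldP5 w c (γ t)) t := fun t ht => by
    simpa [hχ1 _ (mem_closedBall_zero_iff.mp (hR (hγK t ht)))] using hγ t
  have hχF : ContDiff ℝ 1 (fun v => χ v • e • fieldP5 w c v) := hχ.smul hF
  -- The polar lift needs this for negative times too, where the cutoff may be active; p is an
  -- equilibrium of the cut-off field as well.
  have hγp : ∀ t, γ t ≠ p := fun t ht => by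
    have h1 := solution_eq_const hχF hγ (t₀ := t) (by rw [ht, hFp, smul_zero]) 0
    rw [hγ0, ht] at h1
    exact hqp h1
  have hlim : Tendsto (fun t => levelH (γ t) + 1 / 4) atTop (𝓝 0) := by
    refine tendsto_zero_of_lyapunov hK (V := fun v => levelH v + 1 / 4)
      (D := fun v => 2 * e * coeffS v * (levelH v - c))
      (hH.add continuous_const).continuousOn
      ((continuous_const.mul continuous_coeffS).mul (hH.sub continuous_const)).continuousOn
      (fun v _ => by linarith [levelH_ge v]) (fun v hv => ?_) (fun v hv h0 => ?_) hγK
      (fun t ht => (hasDerivAt_levelH (hγF t ht)).add_const _)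
    · have h1 := mul_nonpos_of_nonneg_of_nonpos (coeffS_nonneg v)
        (hC v (by linarith [hv.1])).1
      linarith
    · have he0 : e ≠ 0 := fun h => by simp [h] at he
      rcases mul_eq_zero.mp h0 with h1 | h1
      · have h2 : coeffS v = 0 :=
          (mul_eq_zero.mp h1).resolve_left (mul_ne_zero two_ne_zero he0)
        by_contra hne
        refine (coeffS_pos_of_levelH_ne ?_ ?_ : 0 < coeffS v).ne' h2
        · linarith [hv.1]
        · intro h3
          exact hne (by linarith)
      · have := (hC v (by linarith [hv.1])).2 (by linarith)
        linarith
  have hz : ∀ t, HasDerivAt (fun t => complexCoord p (γ t))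
      ⟨(χ (γ t) • e • fieldP5 w c (γ t)) 0, (χ (γ t) • e • fieldP5 w c (γ t)) 1⟩ t := fun t =>
    hasDerivAt_complexCoord (hγ t)
  have hz0 : ∀ t, complexCoord p (γ t) ≠ 0 := fun t h => hγp t (complexCoord_eq_zero_iff.mp h)
  have hFc := hχF.continuous.comp hγc
  obtain ⟨θ, hθ, hpol⟩ := exists_polar_lift hz
    (continuous_complexMk ((continuous_pi_iff.mp hFc) 0) ((continuous_pi_iff.mp hFc) 1)) hz0
  have hθc : Continuous θ := continuous_iff_continuousAt.mpr fun t => (hθ t).continuousAt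
  have hnormsq : ∀ v, ‖complexCoord p v‖ ^ 2 = (v 0 - p 0) ^ 2 + (v 1 - p 1) ^ 2 := fun v => by
    rw [← Complex.normSq_eq_norm_sq, complexCoord, Complex.normSq_mk]
    ring
  refine ⟨γ, fun t => ‖complexCoord p (γ t)‖, θ, hγ0, solvesOn_of_hasDerivAt hγF,
    fun t ht => (hball _ (hKball _ (hγK t ht))).1, hθc.continuousOn, fun t ht => ⟨?_, ?_⟩, ?_, ?_⟩
  · exact norm_pos_iff.mpr (hz0 t)
  · have hre := congrArg Complex.re (hpol t)
    have him := congrArg Complex.im (hpol t)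
    rw [Complex.re_ofReal_mul, Complex.exp_ofReal_mul_I_re] at hre
    rw [Complex.im_ofReal_mul, Complex.exp_ofReal_mul_I_im] at him
    have hre' : γ t 0 - p 0 = ‖complexCoord p (γ t)‖ * Real.cos (θ t) := hre
    have him' : γ t 1 - p 1 = ‖complexCoord p (γ t)‖ * Real.sin (θ t) := him
    ext i
    fin_cases i
    · simp only [Fin.zero_eta, Pi.add_apply, Pi.smul_apply, smul_eq_mul, Matrix.cons_val_zero]
      linarith
    · simp only [Fin.mk_one, Pi.add_apply, Pi.smul_apply, smul_eq_mul, Matrix.cons_val_one,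
        Matrix.cons_val_zero]
      linarith
  · have h1 : Tendsto (fun t => √(6 * (levelH (γ t) + 1 / 4))) atTop (𝓝 0) := by
      have := (hlim.const_mul 6).sqrt
      simpa using this
    refine squeeze_zero' (Eventually.of_forall fun t => norm_nonneg _) ?_ h1
    filter_upwards [eventually_ge_atTop 0] with t ht
    refine Real.le_sqrt_of_sq_le ?_
    rw [hnormsq]
    exact hKdist _ (hγK t ht)
  -- Multiplying the angular velocity by e undoes the reversal, since e² = 1.
  · have hrate : ∀ t, 0 ≤ t → w p / 2 ≤ e *
        (((⟨(χ (γ t) • e • fieldP5 w c (γ t)) 0, (χ (γ t) • e • fieldP5 w c (γ t)) 1⟩ : ℂ) /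
          complexCoord p (γ t)).im) := by
      intro t ht
      obtain ⟨-, hg1, hc1, hc2⟩ := hball _ (hKball _ (hγK t ht))
      rw [hχ1 _ (mem_closedBall_zero_iff.mp (hR (hγK t ht))), one_smul, complexCoord, im_div_eq]
      set v := γ t
      have hr : 0 < (v 0 - p 0) ^ 2 + (v 1 - p 1) ^ 2 := by
        rw [← hnormsq]
        have := norm_pos_iff.mpr (hz0 t)
        positivity
      rw [← mul_div_assoc, le_div_iff₀ hr]
      have e1 : e * ((v 0 - p 0) * (e • fieldP5 w c v) 1 - (v 1 - p 1) * (e • fieldP5 w c v) 0) =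
          (v 0 - p 0) * fieldP5 w c v 1 - (v 1 - p 1) * fieldP5 w c v 0 := by
        simp only [Pi.smul_apply, smul_eq_mul]
        linear_combination ((v 0 - p 0) * fieldP5 w c v 1 - (v 1 - p 1) * fieldP5 w c v 0) * he
      rw [e1]
      exact angular_form_ge hσ c (hpos v).le hg1.le hc1.le hc2.le
    have hlow : ∀ t, 0 ≤ t → e * θ 0 + w p / 2 * (t - 0) ≤ e * θ t := fun t ht =>
      add_mul_le_of_le_deriv ht (fun s _ => (hθ s).const_mul e) hrate
    have hle : ∀ t, 0 ≤ t → e * θ 0 + w p / 2 * t ≤ |θ t| := fun t ht => by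
      have h1 := hlow t ht
      have h2 := le_abs_self (e * θ t)
      have h3 : |e| = 1 :=
        (pow_eq_one_iff_of_nonneg (abs_nonneg e) two_ne_zero).mp (by rw [sq_abs, he])
      rw [abs_mul, h3, one_mul] at h2
      linarith
    refine tendsto_atTop_mono' _ ((eventually_ge_atTop 0).mono hle) ?_
    exact tendsto_atTop_add_const_left _ _
      (tendsto_id.const_mul_atTop (half_pos (hpos p)))

theorem isStableSpiral_of_lt {w : (Fin 2 → ℝ) → ℝ} (hw : ContDiff ℝ 1 w)
    (hpos : ∀ v, 0 < w v) {c : ℝ} (hc : -(1 / 4) < c) {σ : ℝ} (hσ : σ ^ 2 = 1) :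
    IsStableSpiral (fieldP5 w c) (spiralPoint σ) := by
  have := isStableSpiral_spiralPoint hw hpos (c := c) (e := 1) (one_pow 2) hc
    (fun v hv => ⟨by linarith, fun h => absurd h hv.ne⟩) hσ
  simpa only [one_smul] using this

theorem isUnstableSpiral_of_le {w : (Fin 2 → ℝ) → ℝ} (hw : ContDiff ℝ 1 w)
    (hpos : ∀ v, 0 < w v) {c : ℝ} (hc : c ≤ -(1 / 4)) {σ : ℝ} (hσ : σ ^ 2 = 1) :
    IsUnstableSpiral (fieldP5 w c) (spiralPoint σ) := by
  -- Here C ≥ 0 everywhere, so any l in (-1/4, 0] would do. For c = -1/4, C does vanish, but only at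
  -- the minimum level.
  have := isStableSpiral_spiralPoint hw hpos (c := c) (e := -1) (l := 0) (by norm_num)
    (by norm_num) (fun v _ => ⟨by linarith [levelH_ge v], fun h => by linarith [levelH_ge v]⟩) hσ
  simpa only [IsUnstableSpiral, neg_one_smul] using this

end Spirals

/-! ### The homoclinic halves of the lemniscate -/

section Lemniscate

/-- u decreases to a limit in [-1, 1). If the limit exceeded -1, the speed would stay bounded away
from 0 and u would leave the interval. -/
theorem tendsto_neg_one_of_autonomous {u G : ℝ → ℝ} (hG : Continuous G)
    (hGpos : ∀ x, -1 < x → x < 1 → 0 < G x) (hu : ∀ t, HasDerivAt u (-G (u t)) t)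
    (hmem : ∀ t, -1 < u t ∧ u t < 1) : Tendsto u atTop (𝓝 (-1)) := by
  have hanti : Antitone u := antitone_of_hasDerivAt_nonpos hu fun t => by
    have := hGpos _ (hmem t).1 (hmem t).2
    simp only [Pi.zero_apply]
    linarith
  have hbdd : BddBelow (range u) := ⟨-1, by rintro _ ⟨t, rfl⟩; exact (hmem t).1.le⟩
  have hlim := tendsto_atTop_ciInf hanti hbdd
  set L := ⨅ t, u t
  have hL1 : -1 ≤ L := le_ciInf fun t => (hmem t).1.le
  have hL2 : L < 1 := (ciInf_le hbdd 0).trans_lt (hmem 0).2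
  rcases hL1.eq_or_lt with h | h
  · rwa [← h] at hlim
  exfalso
  have hGL := hGpos L h hL2
  have hev : ∀ᶠ t in atTop, G L / 2 < G (u t) :=
    ((hG.tendsto L).comp hlim).eventually (lt_mem_nhds (half_lt_self hGL))
  obtain ⟨a, ha⟩ := eventually_atTop.mp hev
  have key : ∀ b, a ≤ b → -u a + G L / 2 * (b - a) ≤ -u b := fun b hb =>
    add_mul_le_of_le_deriv (θ := fun t => -u t) (θ' := fun t => G (u t)) hb
      (fun t _ => (hu t).neg.congr_deriv (neg_neg _)) fun t ht => (ha t ht).le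
  -- At speed G L / 2 this time suffices to cover the length 2 of the interval.
  have hd : 0 ≤ 2 / (G L / 2) := by positivity
  have h1 := key (a + 2 / (G L / 2)) (by linarith)
  rw [add_sub_cancel_left, mul_div_cancel₀ _ (half_pos hGL).ne'] at h1
  linarith [(hmem a).2, (hmem (a + 2 / (G L / 2))).1]

/-- The half `0 < σ y` of the lemniscate, parametrized by `u = x / y`. -/
def lemniscatePoint (σ u : ℝ) : Fin 2 → ℝ :=
  ![u * (σ * √(1 - u ^ 2) / (1 + u ^ 2)), σ * √(1 - u ^ 2) / (1 + u ^ 2)]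

theorem continuous_lemniscatePoint (σ : ℝ) : Continuous (lemniscatePoint σ) := by
  have h : Continuous fun u : ℝ => σ * √(1 - u ^ 2) / (1 + u ^ 2) :=
    Continuous.div (by fun_prop) (by fun_prop) fun u => by positivity
  refine continuous_pi fun i => ?_
  fin_cases i
  · exact continuous_id.mul h
  · exact h

theorem lemniscatePoint_eq_zero {σ u : ℝ} (h : u ^ 2 = 1) : lemniscatePoint σ u = 0 := by
  ext i
  fin_cases i <;> simp [lemniscatePoint, h]

theorem eq_zero_of_levelH_eq_zero {v : Fin 2 → ℝ} (h : levelH v = 0) (h1 : v 1 = 0) : v = 0 := by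
  rw [levelH_of_apply_one_eq_zero h1] at h
  have h0 : v 0 = 0 := by
    have : v 0 ^ 2 = 0 := by nlinarith [sq_nonneg (v 0)]
    exact pow_eq_zero_iff two_ne_zero |>.mp this
  ext i
  fin_cases i
  · exact h0
  · exact h1

theorem one_sub_sq_slope {v : Fin 2 → ℝ} (h : levelH v = 0) (h1 : v 1 ≠ 0) :
    1 - (v 0 / v 1) ^ 2 = (v 0 ^ 2 + v 1 ^ 2) ^ 2 / v 1 ^ 2 := by
  field_simp
  unfold levelH at h
  linarith

theorem slope_mem {v : Fin 2 → ℝ} (h : levelH v = 0) (h1 : v 1 ≠ 0) :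
    -1 < v 0 / v 1 ∧ v 0 / v 1 < 1 := by
  have h2 := one_sub_sq_slope h h1
  have h3 : 0 < (v 0 ^ 2 + v 1 ^ 2) ^ 2 / v 1 ^ 2 := by positivity
  exact abs_lt.mp ((sq_lt_one_iff_abs_lt_one _).mp (by linarith))

theorem eq_lemniscatePoint {σ : ℝ} (hσ : σ ^ 2 = 1) {v : Fin 2 → ℝ} (h : levelH v = 0)
    (h1 : 0 < σ * v 1) : v = lemniscatePoint σ (v 0 / v 1) := by
  have hv1 : v 1 ≠ 0 := fun h0 => by simp [h0] at h1
  have hr : 0 < v 0 ^ 2 + v 1 ^ 2 := by positivity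
  have hsq : √(1 - (v 0 / v 1) ^ 2) = (v 0 ^ 2 + v 1 ^ 2) / (σ * v 1) := by
    rw [one_sub_sq_slope h hv1, Real.sqrt_eq_iff_mul_self_eq (by positivity) (by positivity)]
    have hσ0 : σ ≠ 0 := fun h => by simp [h] at hσ
    field_simp
    rw [hσ]
  have hy : σ * √(1 - (v 0 / v 1) ^ 2) / (1 + (v 0 / v 1) ^ 2) = v 1 := by
    rw [hsq]
    have hσ0 : σ ≠ 0 := fun h => by simp [h] at hσ
    have : 1 + (v 0 / v 1) ^ 2 = (v 0 ^ 2 + v 1 ^ 2) / v 1 ^ 2 := by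
      field_simp
      ring
    rw [this]
    field_simp
  ext i
  fin_cases i
  · change v 0 = v 0 / v 1 * (σ * √(1 - (v 0 / v 1) ^ 2) / (1 + (v 0 / v 1) ^ 2))
    rw [hy, div_mul_cancel₀ _ hv1]
  · exact hy.symm

/-- The halves of the lemniscate are homoclinic orbits. -/
theorem isHomoclinicOrbit_half {w : (Fin 2 → ℝ) → ℝ} (hw : ContDiff ℝ 1 w)
    (hpos : ∀ v, 0 < w v) {σ : ℝ} (hσ : σ ^ 2 = 1) :
    IsHomoclinicOrbit (fieldP5 w 0) 0 {v | levelH v = 0 ∧ 0 < σ * v 1} := by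
  have hF := contDiff_fieldP5 hw 0
  have hF0 : fieldP5 w 0 0 = 0 :=
    (fieldP5_eq_zero_iff hpos 0 0).mpr ((coeffS_eq_zero_iff 0).mpr (Or.inl rfl))
  refine ⟨hF0, ?_⟩
  have hσ0 : σ ≠ 0 := fun h => by simp [h] at hσ
  obtain ⟨R, hR⟩ := (isCompact_levelH_le 0).isBounded.subset_closedBall (0 : Fin 2 → ℝ)
  obtain ⟨χ, hχ, hχ0, hχ1, γ, hγ0, hγ⟩ := exists_cutoff_solution hF ![0, σ] R
  have hγc : Continuous γ := continuous_iff_continuousAt.mpr fun t => (hγ t).continuousAt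
  have hlev : ∀ t, levelH (γ t) = 0 := levelH_eq_of_solution (k := fun t => χ (γ t))
    (hχ.continuous.comp hγc) hγ (by rw [hγ0, levelH_axis, hσ]; norm_num)
  have hγF : ∀ t, HasDerivAt γ (fieldP5 w 0 (γ t)) t := fun t => by
    have h1 := hχ1 _ (mem_closedBall_zero_iff.mp (hR (show levelH (γ t) ≤ 0 from (hlev t).le)))
    simpa [h1] using hγ t
  have hy0 : ∀ t, γ t 1 ≠ 0 := fun t h => by
    have h1 := eq_zero_of_levelH_eq_zero (hlev t) h
    have h2 := solution_eq_const hF hγF (t₀ := t) (by rw [h1, hF0]) 0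
    rw [hγ0, h1] at h2
    have := congrFun h2 1
    simp at this
    exact hσ0 this
  have hy : ∀ t, 0 < σ * γ t 1 := pos_of_ne_zero_of_pos' (g := fun t => σ * γ t 1)
    (by fun_prop) (by simp [hγ0, ← sq, hσ]) fun t => mul_ne_zero hσ0 (hy0 t)
  set u : ℝ → ℝ := fun t => γ t 0 / γ t 1 with hudef
  have hγu : ∀ t, γ t = lemniscatePoint σ (u t) := fun t => eq_lemniscatePoint hσ (hlev t) (hy t)
  set G : ℝ → ℝ := fun x => w (lemniscatePoint σ x) * (1 - x ^ 2) with hG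
  have hGc : Continuous G := (hw.continuous.comp (continuous_lemniscatePoint σ)).mul (by fun_prop)
  have hGpos : ∀ x, -1 < x → x < 1 → 0 < G x := fun x h1 h2 =>
    mul_pos (hpos _) (by nlinarith)
  -- On H = 0 one has x·B - y·A... reduced by `one_sub_sq_slope`: the slope satisfies u' = -w(1 -
  -- u²), with w a function of u alone on this half.
  have hu : ∀ t, HasDerivAt u (-G (u t)) t := fun t => by
    have h := hasDerivAt_pi.mp (hγF t)
    refine ((h 0).div (h 1) (hy0 t)).congr_deriv ?_
    have h1 : G (u t) = w (γ t) * ((γ t 0 ^ 2 + γ t 1 ^ 2) ^ 2 / γ t 1 ^ 2) := by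
      rw [← one_sub_sq_slope (hlev t) (hy0 t)]
      change w (lemniscatePoint σ (u t)) * (1 - u t ^ 2) = _
      rw [← hγu t]
    rw [h1, ← mul_div_assoc, ← neg_div]
    congr 1
    have h2 : (γ t 0 ^ 2 + γ t 1 ^ 2) ^ 2 + γ t 0 ^ 2 - γ t 1 ^ 2 = 0 := hlev t
    simp only [fieldP5, hlev t, Matrix.cons_val_zero, Matrix.cons_val_one, coeffA, coeffB]
    linear_combination -w (γ t) * h2
  have hmem : ∀ t, -1 < u t ∧ u t < 1 := fun t => slope_mem (hlev t) (hy0 t)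
  have htop : Tendsto u atTop (𝓝 (-1)) := tendsto_neg_one_of_autonomous hGc hGpos hu hmem
  have hbot : Tendsto u atBot (𝓝 1) := by
    -- Reversing time and reflecting u gives an equation of the same type.
    have h1 : Tendsto (fun t => -u (-t)) atTop (𝓝 (-1)) := by
      refine tendsto_neg_one_of_autonomous (G := fun x => G (-x)) (hGc.comp continuous_neg)
        (fun x h1 h2 => hGpos _ (by linarith) (by linarith)) (fun t => ?_)
        fun t => ⟨by linarith [(hmem (-t)).2], by linarith [(hmem (-t)).1]⟩
      have h2 := ((hu (-t)).comp t (hasDerivAt_neg t)).neg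
      exact h2.congr_deriv (by simp)
    have h2 := (h1.comp tendsto_neg_atBot_atTop).neg
    simpa [Function.comp_def] using h2
  have hP := continuous_lemniscatePoint σ
  refine ⟨γ, solvesOn_univ_iff.mpr hγF, ⟨0, fun h => hy0 0 (by rw [h]; rfl)⟩, ?_, ?_, ?_⟩
  · have h1 := (hP.tendsto (-1)).comp htop
    rw [lemniscatePoint_eq_zero (by norm_num)] at h1
    exact h1.congr fun t => (hγu t).symm
  · have h1 := (hP.tendsto 1).comp hbot
    rw [lemniscatePoint_eq_zero (by norm_num)] at h1
    exact h1.congr fun t => (hγu t).symm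
  · refine Subset.antisymm ?_ (range_subset_iff.mpr fun t => ⟨hlev t, hy t⟩)
    rintro v ⟨hv, hv1⟩
    have hv1' : v 1 ≠ 0 := fun h0 => by simp [h0] at hv1
    obtain ⟨ha1, ha2⟩ := slope_mem hv hv1'
    have huc : Continuous u := continuous_iff_continuousAt.mpr fun t => (hu t).continuousAt
    obtain ⟨t, ht⟩ := mem_range_of_exists_le_of_exists_ge huc
      ((htop.eventually (gt_mem_nhds ha1)).exists.imp fun _ h => h.le)
      ((hbot.eventually (lt_mem_nhds ha2)).exists.imp fun _ h => h.le)
    exact ⟨t, by rw [hγu t, ht, ← eq_lemniscatePoint hσ hv hv1]⟩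

end Lemniscate

/-! ### Which equilibria the curves surround -/

section SurroundingHalves

/-- The function `max (C, -σ y)`, which is negative inside the half `0 < σ y` of `C = 0`. -/
def halfGauge (c σ : ℝ) (v : Fin 2 → ℝ) : ℝ := max (levelH v - c) (-(σ * v 1))

theorem continuous_halfGauge (c σ : ℝ) : Continuous (halfGauge c σ) :=
  (contDiff_levelH.continuous.sub continuous_const).max (by fun_prop)

theorem isBounded_halfGauge_neg (c σ : ℝ) : Bornology.IsBounded {v | halfGauge c σ v < 0} := by
  refine (isCompact_levelH_le c).isBounded.subset fun v hv => ?_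
  have h1 : levelH v - c < 0 := (le_max_left _ _).trans_lt hv
  change levelH v ≤ c
  linarith

/-- Besides the half curve, the maximum could vanish on the part H ≤ c of the axis y = 0. For c < 0
this part is empty since H ≥ 0 there; for c = 0 it is just the origin. -/
theorem halfGauge_eq_zero_iff {c σ : ℝ} (hσ : σ ^ 2 = 1) (hc : c < 0) (v : Fin 2 → ℝ) :
    halfGauge c σ v = 0 ↔ v ∈ {v | levelH v = c ∧ 0 < σ * v 1} := by
  have hσ0 : σ ≠ 0 := fun h => by simp [h] at hσ
  have hjne : levelH v ≤ c → σ * v 1 ≠ 0 := fun hv h => by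
    have h1 := levelH_of_apply_one_eq_zero ((mul_eq_zero.mp h).resolve_left hσ0)
    have : 0 ≤ levelH v := by rw [h1]; positivity
    linarith
  unfold halfGauge
  constructor
  · intro h
    have h1 : levelH v - c ≤ 0 := h ▸ le_max_left _ _
    have h2 : -(σ * v 1) ≤ 0 := h ▸ le_max_right _ _
    have h3 := hjne (by linarith)
    have h4 : 0 < σ * v 1 := lt_of_le_of_ne (by linarith) h3.symm
    rcases max_choice (levelH v - c) (-(σ * v 1)) with h5 | h5
    · exact ⟨by linarith, h4⟩
    · linarith
  · rintro ⟨h1, h2⟩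
    rw [h1, sub_self, max_eq_left (by linarith)]

theorem halfGauge_zero_eq_zero_iff {σ : ℝ} (hσ : σ ^ 2 = 1) (v : Fin 2 → ℝ) :
    halfGauge 0 σ v = 0 ↔ v ∈ insert 0 {v | levelH v = 0 ∧ 0 < σ * v 1} := by
  have hσ0 : σ ≠ 0 := fun h => by simp [h] at hσ
  unfold halfGauge
  rw [sub_zero]
  constructor
  · intro h
    have h1 : levelH v ≤ 0 := h ▸ le_max_left _ _
    have h2 : -(σ * v 1) ≤ 0 := h ▸ le_max_right _ _
    by_cases h3 : v 1 = 0
    · have h4 : 0 ≤ levelH v := by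
        rw [levelH_of_apply_one_eq_zero h3]
        positivity
      exact Or.inl (eq_zero_of_levelH_eq_zero (h1.antisymm h4) h3)
    · have h4 : 0 < σ * v 1 := lt_of_le_of_ne (by linarith) (mul_ne_zero hσ0 h3).symm
      rcases max_choice (levelH v) (-(σ * v 1)) with h5 | h5
      · exact Or.inr ⟨by linarith, h4⟩
      · linarith
  · rintro (rfl | ⟨h1, h2⟩)
    · simp [levelH_zero]
    · rw [h1, max_eq_left (by linarith)]

theorem halfGauge_spiralPoint_neg {c σ : ℝ} (hσ : σ ^ 2 = 1) (hc : -(1 / 4) < c) :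
    halfGauge c σ (spiralPoint σ) < 0 := by
  refine max_lt ?_ ?_
  · rw [levelH_spiralPoint hσ]
    linarith
  · have h1 : σ * spiralPoint σ 1 = 1 / √2 := by
      simp only [spiralPoint, Matrix.cons_val_one, Matrix.cons_val_zero]
      linear_combination (1 / √2) * hσ
    rw [h1]
    linarith [one_div_sqrt_two_pos]

/-- The vertical ray away from the half plane σy > 0 stays where the gauge is positive. -/
theorem not_surrounds_spiralPoint_neg {c σ : ℝ} (hσ : σ ^ 2 = 1) {Γ : Set (Fin 2 → ℝ)}
    (hΓ : ∀ v, halfGauge c σ v = 0 ↔ v ∈ Γ) : ¬ Surrounds Γ (spiralPoint (-σ)) := by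
  have hσ0 : σ ≠ 0 := fun h => by simp [h] at hσ
  refine not_surrounds_of_ray (d := ![0, -σ]) (fun h => hσ0 ?_) fun t ht hmem => ?_
  · simpa using congrFun h 1
  · have h1 := (hΓ _).mpr hmem
    have h2 : -(σ * (spiralPoint (-σ) + t • ![0, -σ]) 1) = 1 / √2 + t := by
      simp only [spiralPoint, Pi.add_apply, Pi.smul_apply, Matrix.cons_val_one,
        Matrix.cons_val_zero, smul_eq_mul]
      linear_combination (1 / √2 + t) * hσ
    have h3 : -(σ * (spiralPoint (-σ) + t • ![0, -σ]) 1) ≤ 0 := h1 ▸ le_max_right _ _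
    rw [h2] at h3
    linarith [one_div_sqrt_two_pos]

theorem not_surrounds_zero {c σ : ℝ} (hσ : σ ^ 2 = 1) (hc : c < 0) {Γ : Set (Fin 2 → ℝ)}
    (hΓ : ∀ v, halfGauge c σ v = 0 ↔ v ∈ Γ) : ¬ Surrounds Γ 0 := by
  have hσ0 : σ ≠ 0 := fun h => by simp [h] at hσ
  refine not_surrounds_of_ray (d := ![0, -σ]) (fun h => hσ0 ?_) fun t ht hmem => ?_
  · simpa using congrFun h 1
  · have h1 := (hΓ _).mpr hmem
    have h2 : -(σ * ((0 : Fin 2 → ℝ) + t • ![0, -σ]) 1) = t := by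
      simp only [Pi.add_apply, Pi.smul_apply, Matrix.cons_val_one,
        Matrix.cons_val_zero, smul_eq_mul, Pi.zero_apply]
      linear_combination t * hσ
    have h3 : -(σ * ((0 : Fin 2 → ℝ) + t • ![0, -σ]) 1) ≤ 0 := h1 ▸ le_max_right _ _
    rw [h2] at h3
    -- Only the origin itself could be on the curve, and H(0) = 0 > c.
    have h4 : t = 0 := le_antisymm h3 ht
    have h5 : levelH ((0 : Fin 2 → ℝ) + t • ![0, -σ]) - c ≤ 0 := (le_max_left _ _).trans h1.le
    rw [h4, zero_smul, add_zero, levelH_zero] at h5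
    linarith

theorem surrounds_curve {c : ℝ} {p : Fin 2 → ℝ} (hp : levelH p < c) :
    Surrounds {v | levelH v = c} p := by
  refine surrounds_of_neg (f := fun v => levelH v - c)
    (contDiff_levelH.continuous.sub continuous_const) (fun v => sub_eq_zero)
    ((isCompact_levelH_le c).isBounded.subset fun v hv => ?_) (by linarith)
  have h : levelH v - c < 0 := hv
  change levelH v ≤ c
  linarith

end SurroundingHalves

/-! ### Homogenization and the degree of the system -/

section Homogenization

open MvPolynomial

theorem contDiff_eval {σ : Type*} [Fintype σ] (P : MvPolynomial σ ℝ) :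
    ContDiff ℝ 1 (fun v : σ → ℝ => eval v P) := by
  induction P using MvPolynomial.induction_on with
  | C a => simpa using contDiff_const
  | add p q hp hq => simpa using hp.add hq
  | mul_X p i hp => simpa using hp.mul (contDiff_apply ℝ ℝ i)

theorem eval_smul_of_isHomogeneous {σ : Type*} [Fintype σ] {P : MvPolynomial σ ℝ} {n : ℕ}
    (hP : P.IsHomogeneous n) (r : ℝ) (v : σ → ℝ) : eval (r • v) P = r ^ n * eval v P := by
  rw [eval_eq', eval_eq', Finset.mul_sum]
  refine Finset.sum_congr rfl fun d hd => ?_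
  have hdeg : ∑ i, d i = n := by
    have h1 := hP (mem_support_iff.mp hd)
    rw [← h1, Finsupp.weight_apply, Finsupp.sum_fintype _ _ (by simp)]
    simp
  simp only [Pi.smul_apply, smul_eq_mul, mul_pow, Finset.prod_mul_distrib, Finset.prod_pow_eq_pow_sum,
    hdeg]
  ring

theorem contDiff_homogenized (m : ℕ) (P : MvPolynomial (Fin 2) ℝ) :
    ContDiff ℝ 1 (homogenized m P) := by
  have h1 : ContDiff ℝ 1 (fun u : Fin 3 → ℝ => ![u 0, u 1]) := by
    rw [contDiff_pi]
    intro i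
    fin_cases i
    · exact contDiff_apply ℝ ℝ 0
    · exact contDiff_apply ℝ ℝ 1
  unfold homogenized
  exact ContDiff.sum fun i _ => ((contDiff_apply ℝ ℝ 2).pow _).mul ((contDiff_eval _).comp h1)

theorem homogenized_of_ne_zero {m : ℕ} {P : MvPolynomial (Fin 2) ℝ} (hP : P.totalDegree ≤ m)
    {u : Fin 3 → ℝ} (hu : u 2 ≠ 0) :
    homogenized m P u = u 2 ^ m * eval ![u 0 / u 2, u 1 / u 2] P := by
  have hsum : P = ∑ i ∈ Finset.range (m + 1), homogeneousComponent i P := by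
    conv_lhs => rw [← sum_homogeneousComponent P]
    refine Finset.sum_subset (Finset.range_mono (by omega)) fun i _ hi => ?_
    refine homogeneousComponent_eq_zero _ _ ?_
    simp only [Finset.mem_range] at hi
    omega
  have hvec : ![u 0, u 1] = u 2 • ![u 0 / u 2, u 1 / u 2] := by
    ext i
    fin_cases i <;> simp [mul_div_cancel₀ _ hu]
  conv_rhs => rw [hsum, map_sum, Finset.mul_sum]
  unfold homogenized
  refine Finset.sum_congr rfl fun i hi => ?_
  rw [hvec, eval_smul_of_isHomogeneous (homogeneousComponent_isHomogeneous i P), ← mul_assoc,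
    ← pow_add, Nat.sub_add_cancel]
  simp only [Finset.mem_range] at hi
  omega

theorem homogenized_of_eq_zero (m : ℕ) (P : MvPolynomial (Fin 2) ℝ) {u : Fin 3 → ℝ}
    (hu : u 2 = 0) :
    homogenized m P u = eval ![u 0, u 1] (homogeneousComponent m P) := by
  unfold homogenized
  rw [Finset.sum_range_succ, Finset.sum_eq_zero]
  · simp
  · intro i hi
    simp only [Finset.mem_range] at hi
    rw [hu, zero_pow (by omega), zero_mul]

/-- Continuous functions that agree off the plane `Z = 0` agree everywhere. -/
theorem eq_of_eq_of_ne_zero {f g : (Fin 3 → ℝ) → ℝ} (hf : Continuous f) (hg : Continuous g)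
    (h : ∀ u, u 2 ≠ 0 → f u = g u) (u : Fin 3 → ℝ) : f u = g u := by
  have hc : Continuous fun t : ℝ => Function.update u 2 t := continuous_const.update 2 continuous_id
  have h1 := Continuous.ext_on (dense_compl_singleton (0 : ℝ)) (hf.comp hc) (hg.comp hc)
    fun t ht => h _ (by simpa using ht)
  have h2 := congrFun h1 (u 2)
  simpa using h2

/-- The homogenization of `A`. -/
def homA (u : Fin 3 → ℝ) : ℝ := u 0 * (2 * u 0 ^ 2 + 2 * u 1 ^ 2 + u 2 ^ 2)

/-- The homogenization of `B`. -/
def homB (u : Fin 3 → ℝ) : ℝ := u 1 * (2 * u 0 ^ 2 + 2 * u 1 ^ 2 - u 2 ^ 2)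

/-- The homogenization of `C`. -/
def homC (c : ℝ) (u : Fin 3 → ℝ) : ℝ :=
  (u 0 ^ 2 + u 1 ^ 2) ^ 2 + (u 0 ^ 2 - u 1 ^ 2) * u 2 ^ 2 - c * u 2 ^ 4

theorem contDiff_homA : ContDiff ℝ 1 homA := by
  unfold homA
  fun_prop

theorem contDiff_homB : ContDiff ℝ 1 homB := by
  unfold homB
  fun_prop

theorem contDiff_homC (c : ℝ) : ContDiff ℝ 1 (homC c) := by
  unfold homC
  fun_prop

theorem totalDegree_two : (2 : MvPolynomial (Fin 2) ℝ).totalDegree = 0 := by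
  rw [← map_ofNat (C (σ := Fin 2) (R := ℝ)) 2, totalDegree_C]

theorem totalDegree_quadratic_le (a : MvPolynomial (Fin 2) ℝ) (ha : a.totalDegree ≤ 0) :
    ((2 * X 0 ^ 2 + 2 * X 1 ^ 2 + a : MvPolynomial (Fin 2) ℝ)).totalDegree ≤ 2 := by
  have h : ∀ i : Fin 2, (2 * X i ^ 2 : MvPolynomial (Fin 2) ℝ).totalDegree ≤ 2 := fun i => by
    refine (totalDegree_mul _ _).trans ?_
    have h1 := totalDegree_two
    have h2 : (X i ^ 2 : MvPolynomial (Fin 2) ℝ).totalDegree = 2 := totalDegree_X_pow i 2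
    omega
  refine (totalDegree_add _ _).trans (max_le ((totalDegree_add _ _).trans ?_) (by omega))
  exact max_le (h 0) (h 1)

theorem totalDegree_polyA_le : polyA.totalDegree ≤ 3 := by
  have h1 := totalDegree_quadratic_le 1 (by simp)
  have h2 : (X 0 : MvPolynomial (Fin 2) ℝ).totalDegree = 1 := totalDegree_X 0
  refine (totalDegree_mul _ _).trans ?_
  omega

theorem totalDegree_polyB_le : polyB.totalDegree ≤ 3 := by
  have h1 := totalDegree_quadratic_le (-1) (by simp)
  have h2 : (X 1 : MvPolynomial (Fin 2) ℝ).totalDegree = 1 := totalDegree_X 1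
  rw [← sub_eq_add_neg] at h1
  refine (totalDegree_mul _ _).trans ?_
  omega

theorem totalDegree_polyC_le (c : ℝ) : (polyC c).totalDegree ≤ 4 := by
  have h : ∀ i : Fin 2, (X i ^ 2 : MvPolynomial (Fin 2) ℝ).totalDegree = 2 :=
    fun i => totalDegree_X_pow i 2
  have h1 : ((X 0 ^ 2 + X 1 ^ 2) ^ 2 : MvPolynomial (Fin 2) ℝ).totalDegree ≤ 4 := by
    refine (totalDegree_pow _ 2).trans ?_
    have h2 := totalDegree_add (X 0 ^ 2 : MvPolynomial (Fin 2) ℝ) (X 1 ^ 2)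
    rw [h 0, h 1] at h2
    omega
  unfold polyC
  refine (totalDegree_sub _ _).trans (max_le ((totalDegree_sub _ _).trans (max_le
    ((totalDegree_add _ _).trans (max_le h1 ?_)) ?_)) (by simp))
  · rw [h 0]
    norm_num
  · rw [h 1]
    norm_num

/-- Off Z = 0 this is substitution of (X/Z, Y/Z); continuity extends it. The products AC have degree
7 and those with W have degree up to n + 7, whence the factor Zⁿ. -/
theorem homogenized_p5 {n : ℕ} {W : MvPolynomial (Fin 2) ℝ} (hW : W.totalDegree ≤ n + 4) (c : ℝ)
    (u : Fin 3 → ℝ) :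
    homogenized (n + 7) (p5X W c) u =
        homA u * homC c u * u 2 ^ n - homB u * homogenized (n + 4) W u ∧
      homogenized (n + 7) (p5Y W c) u =
        homB u * homC c u * u 2 ^ n + homA u * homogenized (n + 4) W u := by
  have hA := totalDegree_polyA_le
  have hB := totalDegree_polyB_le
  have hC := totalDegree_polyC_le c
  have hA' := contDiff_homA.continuous
  have hB' := contDiff_homB.continuous
  have hC' := (contDiff_homC c).continuous
  have hW' := (contDiff_homogenized (n + 4) W).continuous
  have hZ : Continuous fun u : Fin 3 → ℝ => u 2 ^ n := by fun_prop
  have dX : (p5X W c).totalDegree ≤ n + 7 := by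
    refine (totalDegree_sub _ _).trans (max_le ?_ ?_)
    · exact (totalDegree_mul _ _).trans (by omega)
    · exact (totalDegree_mul _ _).trans (by omega)
  have dY : (p5Y W c).totalDegree ≤ n + 7 := by
    refine (totalDegree_add _ _).trans (max_le ?_ ?_)
    · exact (totalDegree_mul _ _).trans (by omega)
    · exact (totalDegree_mul _ _).trans (by omega)
  have eA : ∀ u : Fin 3 → ℝ, u 2 ≠ 0 →
      homA u = u 2 ^ 3 * coeffA ![u 0 / u 2, u 1 / u 2] := fun u hu => by
    simp only [homA, coeffA, Matrix.cons_val_zero, Matrix.cons_val_one]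
    field_simp
  have eB : ∀ u : Fin 3 → ℝ, u 2 ≠ 0 →
      homB u = u 2 ^ 3 * coeffB ![u 0 / u 2, u 1 / u 2] := fun u hu => by
    simp only [homB, coeffB, Matrix.cons_val_zero, Matrix.cons_val_one]
    field_simp
  have eC : ∀ u : Fin 3 → ℝ, u 2 ≠ 0 →
      homC c u = u 2 ^ 4 * (levelH ![u 0 / u 2, u 1 / u 2] - c) := fun u hu => by
    simp only [homC, levelH, Matrix.cons_val_zero, Matrix.cons_val_one]
    field_simp
    ring
  constructor
  · refine eq_of_eq_of_ne_zero (contDiff_homogenized _ _).continuous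
      (((hA'.mul hC').mul hZ).sub (hB'.mul hW')) (fun u hu => ?_) u
    change _ = homA u * homC c u * u 2 ^ n - homB u * homogenized (n + 4) W u
    rw [homogenized_of_ne_zero dX hu, homogenized_of_ne_zero hW hu, eA u hu, eB u hu, eC u hu, p5X]
    simp only [map_sub, map_mul, eval_polyA, eval_polyB, eval_polyC]
    ring
  · refine eq_of_eq_of_ne_zero (contDiff_homogenized _ _).continuous
      (((hB'.mul hC').mul hZ).add (hA'.mul hW')) (fun u hu => ?_) u
    change _ = homB u * homC c u * u 2 ^ n + homA u * homogenized (n + 4) W u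
    rw [homogenized_of_ne_zero dY hu, homogenized_of_ne_zero hW hu, eA u hu, eB u hu, eC u hu, p5Y]
    simp only [map_add, map_mul, eval_polyA, eval_polyB, eval_polyC]
    ring

theorem max_totalDegree_p5 {n : ℕ} {W : MvPolynomial (Fin 2) ℝ} (hW : W.totalDegree ≤ n + 4)
    (c : ℝ) (hpos : ∀ v : Fin 2 → ℝ, v ≠ 0 → 0 < eval v (homogeneousComponent (n + 4) W)) :
    max (p5X W c).totalDegree (p5Y W c).totalDegree = n + 7 := by
  have hA := totalDegree_polyA_le
  have hB := totalDegree_polyB_le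
  have hC := totalDegree_polyC_le c
  refine le_antisymm (max_le ?_ ?_) (le_trans ?_ (le_max_right _ _))
  · refine (totalDegree_sub _ _).trans (max_le ?_ ?_)
    · exact (totalDegree_mul _ _).trans (by omega)
    · exact (totalDegree_mul _ _).trans (by omega)
  · refine (totalDegree_add _ _).trans (max_le ?_ ?_)
    · exact (totalDegree_mul _ _).trans (by omega)
    · exact (totalDegree_mul _ _).trans (by omega)
  · by_contra! hlt
    -- At this point of the equator the top part of y' equals 2 W_N(1, 0), which is positive, so the
    -- degree cannot drop.
    have h1 := (homogenized_p5 hW c ![1, 0, 0]).2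
    rw [homogenized_of_eq_zero _ _ (by simp), homogenized_of_eq_zero _ _ (by simp),
      homogeneousComponent_eq_zero _ _ hlt] at h1
    have h2 := hpos ![1, 0] fun h => by simpa using congrFun h 0
    simp [homA, homB] at h1
    exact h2.ne' h1

end Homogenization

/-! ### The limit cycle at infinity -/

section Infinity

/-- The field on the Poincaré sphere for a general homogenized weight function `f`. -/
def sphereP5 (f : (Fin 3 → ℝ) → ℝ) (n : ℕ) (c : ℝ) (u : Fin 3 → ℝ) : Fin 3 → ℝ :=
  let p := homA u * homC c u * u 2 ^ n - homB u * f u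
  let q := homB u * homC c u * u 2 ^ n + homA u * f u
  ![p, q, 0] - (u 0 * p + u 1 * q) • u

/-- The radial rate `X p + Y q`. -/
def radialRate (f : (Fin 3 → ℝ) → ℝ) (n : ℕ) (c : ℝ) (u : Fin 3 → ℝ) : ℝ :=
  u 0 * (homA u * homC c u * u 2 ^ n - homB u * f u) +
    u 1 * (homB u * homC c u * u 2 ^ n + homA u * f u)

theorem sphereP5_apply (f : (Fin 3 → ℝ) → ℝ) (n : ℕ) (c : ℝ) (u : Fin 3 → ℝ) :
    sphereP5 f n c u 0 =
        homA u * homC c u * u 2 ^ n - homB u * f u - radialRate f n c u * u 0 ∧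
      sphereP5 f n c u 1 =
        homB u * homC c u * u 2 ^ n + homA u * f u - radialRate f n c u * u 1 ∧
      sphereP5 f n c u 2 = -(radialRate f n c u * u 2) :=
  ⟨rfl, rfl, zero_sub _⟩

theorem contDiff_sphereP5 {f : (Fin 3 → ℝ) → ℝ} (hf : ContDiff ℝ 1 f) (n : ℕ) (c : ℝ) :
    ContDiff ℝ 1 (sphereP5 f n c) := by
  have hA := contDiff_homA
  have hB := contDiff_homB
  have hC := contDiff_homC c
  have hX : ContDiff ℝ 1 fun u : Fin 3 → ℝ => u 0 := contDiff_apply ℝ ℝ 0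
  have hY : ContDiff ℝ 1 fun u : Fin 3 → ℝ => u 1 := contDiff_apply ℝ ℝ 1
  have hZ : ContDiff ℝ 1 fun u : Fin 3 → ℝ => u 2 := contDiff_apply ℝ ℝ 2
  have hp := ((hA.mul hC).mul (hZ.pow n)).sub (hB.mul hf)
  have hq := ((hB.mul hC).mul (hZ.pow n)).add (hA.mul hf)
  have hl := (hX.mul hp).add (hY.mul hq)
  rw [contDiff_pi]
  intro i
  fin_cases i
  · exact hp.sub (hl.mul hX)
  · exact hq.sub (hl.mul hY)
  · exact contDiff_const.sub (hl.mul hZ)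

theorem continuous_radialRate {f : (Fin 3 → ℝ) → ℝ} (hf : ContDiff ℝ 1 f) (n : ℕ) (c : ℝ) :
    Continuous (radialRate f n c) := by
  have hA := contDiff_homA.continuous
  have hB := contDiff_homB.continuous
  have hC := (contDiff_homC c).continuous
  have hf := hf.continuous
  unfold radialRate
  fun_prop

variable {f : (Fin 3 → ℝ) → ℝ} {n : ℕ} {c k t : ℝ} {γ : ℝ → Fin 3 → ℝ}

theorem hasDerivAt_apply_of_sphereP5 (h : HasDerivAt γ (k • sphereP5 f n c (γ t)) t) :
    HasDerivAt (fun t => γ t 0)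
      (k * (homA (γ t) * homC c (γ t) * γ t 2 ^ n - homB (γ t) * f (γ t) -
        radialRate f n c (γ t) * γ t 0)) t ∧
    HasDerivAt (fun t => γ t 1)
      (k * (homB (γ t) * homC c (γ t) * γ t 2 ^ n + homA (γ t) * f (γ t) -
        radialRate f n c (γ t) * γ t 1)) t ∧
    HasDerivAt (fun t => γ t 2) (-(k * radialRate f n c (γ t)) * γ t 2) t := by
  have h' := hasDerivAt_pi.mp h
  obtain ⟨e0, e1, e2⟩ := sphereP5_apply f n c (γ t)
  refine ⟨(h' 0).congr_deriv ?_, (h' 1).congr_deriv ?_, (h' 2).congr_deriv ?_⟩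
  · rw [Pi.smul_apply, smul_eq_mul, e0]
  · rw [Pi.smul_apply, smul_eq_mul, e1]
  · rw [Pi.smul_apply, smul_eq_mul, e2]
    ring

theorem hasDerivAt_normSq_of_sphereP5 (h : HasDerivAt γ (k • sphereP5 f n c (γ t)) t) :
    HasDerivAt (fun t => γ t 0 ^ 2 + γ t 1 ^ 2 + γ t 2 ^ 2 - 1)
      (-(2 * k * radialRate f n c (γ t)) * (γ t 0 ^ 2 + γ t 1 ^ 2 + γ t 2 ^ 2 - 1)) t := by
  obtain ⟨h0, h1, h2⟩ := hasDerivAt_apply_of_sphereP5 h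
  refine ((((h0.pow 2).add (h1.pow 2)).add (h2.pow 2)).sub_const 1).congr_deriv ?_
  push_cast
  unfold radialRate
  ring

/-- The X and Y derivatives of C* are 2A* and 2B*, as in the plane. The radial correction
contributes -4 times the radial rate by Euler's identity in degree 4; Z⁴ has the same term, so it
cancels in Z⁴/C*. -/
theorem hasDerivAt_homC_of_sphereP5 (h : HasDerivAt γ (k • sphereP5 f n c (γ t)) t) :
    HasDerivAt (fun t => homC c (γ t))
      (k * (2 * γ t 2 ^ n * (homA (γ t) ^ 2 + homB (γ t) ^ 2) - 4 * radialRate f n c (γ t)) *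
        homC c (γ t)) t := by
  obtain ⟨h0, h1, h2⟩ := hasDerivAt_apply_of_sphereP5 h
  have h3 := ((((h0.pow 2).add (h1.pow 2)).pow 2).add
    (((h0.pow 2).sub (h1.pow 2)).mul (h2.pow 2))).sub ((h2.pow 4).const_mul c)
  refine h3.congr_deriv ?_
  set r := radialRate f n c (γ t)
  simp only [Pi.add_apply, Pi.sub_apply, Pi.pow_apply]
  push_cast
  simp only [homA, homB, homC]
  ring

theorem hasDerivAt_pow_four_of_sphereP5 (h : HasDerivAt γ (k • sphereP5 f n c (γ t)) t) :
    HasDerivAt (fun t => γ t 2 ^ 4) (-(4 * k * radialRate f n c (γ t)) * γ t 2 ^ 4) t := by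
  obtain ⟨-, -, h2⟩ := hasDerivAt_apply_of_sphereP5 h
  refine (h2.pow 4).congr_deriv ?_
  push_cast
  ring

/-- Both X² + Y² + Z² - 1 and Z satisfy homogeneous linear equations along solutions in space, so
the sphere, its closed upper half and the equator are invariant. -/
theorem sphere_invariants {k : ℝ → ℝ} (hf : ContDiff ℝ 1 f) (hk : Continuous k)
    (h : ∀ t, HasDerivAt γ (k t • sphereP5 f n c (γ t)) t)
    (h0 : γ 0 0 ^ 2 + γ 0 1 ^ 2 + γ 0 2 ^ 2 = 1) :
    (∀ t, γ t 0 ^ 2 + γ t 1 ^ 2 + γ t 2 ^ 2 = 1) ∧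
      ∃ e : ℝ → ℝ, (∀ t, 0 < e t) ∧ ∀ t, γ t 2 = γ 0 2 * e t := by
  have hγ : Continuous γ := continuous_iff_continuousAt.mpr fun t => (h t).continuousAt
  have hr := (continuous_radialRate hf n c).comp hγ
  constructor
  · obtain ⟨e, -, he⟩ := linear_solution
      (g := fun t => γ t 0 ^ 2 + γ t 1 ^ 2 + γ t 2 ^ 2 - 1)
      (a := fun t => -(2 * k t * radialRate f n c (γ t)))
      (((continuous_const.mul hk).mul hr).neg) fun t => hasDerivAt_normSq_of_sphereP5 (h t)
    intro t
    have := he t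
    simp only [h0, sub_self, zero_mul] at this
    linarith
  · exact linear_solution (g := fun t => γ t 2) (a := fun t => -(k t * radialRate f n c (γ t)))
      ((hk.mul hr).neg) fun t => (hasDerivAt_apply_of_sphereP5 (h t)).2.2

theorem isCompact_hemisphere : IsCompact hemisphere := by
  have h1 : IsClosed {u : Fin 3 → ℝ | u 0 ^ 2 + u 1 ^ 2 + u 2 ^ 2 = 1} :=
    isClosed_eq (by fun_prop) continuous_const
  have h2 : IsClosed {u : Fin 3 → ℝ | 0 ≤ u 2} := isClosed_le continuous_const (by fun_prop)
  refine Metric.isCompact_of_isClosed_isBounded (h1.inter h2) ?_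
  refine Metric.isBounded_closedBall.subset (t := Metric.closedBall 0 1) fun u hu => ?_
  rw [mem_closedBall_zero_iff, pi_norm_le_iff_of_nonneg zero_le_one]
  have h := hu.1
  intro i
  rw [Real.norm_eq_abs, abs_le_one_iff_mul_self_le_one]
  fin_cases i
  · change u 0 * u 0 ≤ 1
    nlinarith [sq_nonneg (u 1), sq_nonneg (u 2)]
  · change u 1 * u 1 ≤ 1
    nlinarith [sq_nonneg (u 0), sq_nonneg (u 2)]
  · change u 2 * u 2 ≤ 1
    nlinarith [sq_nonneg (u 0), sq_nonneg (u 1)]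

theorem equator_subset_hemisphere : equator ⊆ hemisphere := by
  rintro u ⟨h1, h2⟩
  exact ⟨by rw [h1, h2]; norm_num, h2.ge⟩

theorem isCompact_equator : IsCompact equator := by
  have h1 : IsClosed {u : Fin 3 → ℝ | u 0 ^ 2 + u 1 ^ 2 = 1} :=
    isClosed_eq (by fun_prop) continuous_const
  have h2 : IsClosed {u : Fin 3 → ℝ | u 2 = 0} := isClosed_eq (by fun_prop) continuous_const
  exact isCompact_hemisphere.of_isClosed_subset (h1.inter h2) equator_subset_hemisphere

theorem isCycle_equator (hf : ContDiff ℝ 1 f) (hpos : ∀ u ∈ equator, 0 < f u) :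
    IsCycle (sphereP5 f n c) equator := by
  have hF := contDiff_sphereP5 hf n c
  have hq : ![1, 0, 0] ∈ equator := by simp [equator]
  obtain ⟨R, hR⟩ := isCompact_equator.isBounded.subset_closedBall (0 : Fin 3 → ℝ)
  obtain ⟨χ, hχ, hχ0, hχ1, γ, hγ0, hγ⟩ := exists_cutoff_solution hF ![1, 0, 0] R
  have hγc : Continuous γ := continuous_iff_continuousAt.mpr fun t => (hγ t).continuousAt
  obtain ⟨hs, e, -, he⟩ := sphere_invariants (k := fun t => χ (γ t)) hf
    (hχ.continuous.comp hγc) hγ (by simp [hγ0])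
  have hmem : ∀ t, γ t ∈ equator := fun t => by
    have h2 : γ t 2 = 0 := by rw [he t, hγ0]; simp
    have h1 := hs t
    rw [h2] at h1
    exact ⟨by linarith, h2⟩
  have hγF : ∀ t, HasDerivAt γ (sphereP5 f n c (γ t)) t := fun t => by
    simpa [hχ1 _ (mem_closedBall_zero_iff.mp (hR (hmem t)))] using hγ t
  obtain ⟨m, hm, hmin⟩ := isCompact_equator.exists_isMinOn ⟨_, hq⟩ hf.continuous.continuousOn
  have hFc := hF.continuous.comp hγc
  refine isCycle_of_rotation (π := fun u => (⟨u 0, u 1⟩ : ℂ)) hF hγF hmem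
    (fun t => hasDerivAt_complexMk (hasDerivAt_pi.mp (hγF t) 0) (hasDerivAt_pi.mp (hγF t) 1))
    (continuous_complexMk ((continuous_pi_iff.mp hFc) 0) ((continuous_pi_iff.mp hFc) 1))
    (fun u hu h0 => ?_) (hpos m hm) (fun t => ?_) fun u hu v hv k hk huv => ?_
  · rw [Complex.ext_iff] at h0
    obtain ⟨h1, h2⟩ := h0
    have h3 := hu.1
    simp only [Complex.zero_re, Complex.zero_im] at h1 h2
    rw [h1, h2] at h3
    norm_num at h3
  · obtain ⟨h1, h2⟩ := hmem t
    have hmt : f m ≤ f (γ t) := hmin (hmem t)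
    have hft := hpos _ (hmem t)
    rw [im_div_eq, h1, div_one]
    -- At Z = 0 one has A* = 2X(X² + Y²) and B* = 2Y(X² + Y²), so the equator turns with angular
    -- velocity 2f.
    have e1 : γ t 0 * sphereP5 f n c (γ t) 1 - γ t 1 * sphereP5 f n c (γ t) 0 =
        2 * f (γ t) * (γ t 0 ^ 2 + γ t 1 ^ 2) ^ 2 := by
      rw [(sphereP5_apply f n c (γ t)).1, (sphereP5_apply f n c (γ t)).2.1]
      simp only [homA, homB, h2]
      ring
    rw [e1, h1]
    linarith
  · rw [Complex.ext_iff] at huv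
    have h0 : u 0 = k * v 0 := by simpa using huv.1
    have h1 : u 1 = k * v 1 := by simpa using huv.2
    have h2 := hu.1
    rw [h0, h1] at h2
    have h3 : k ^ 2 = 1 := by linear_combination h2 - k ^ 2 * hv.1
    have h4 : k = 1 := by nlinarith
    ext i
    fin_cases i
    · simpa [h4] using h0
    · simpa [h4] using h1
    · exact hu.2.trans hv.2.symm

/-- The equator is an attracting limit cycle, since `1 / C` is a Lyapunov function near it. -/
theorem isAttractingLimitCycle_equator (hf : ContDiff ℝ 1 f) (hpos : ∀ u ∈ equator, 0 < f u) :
    IsAttractingLimitCycle (sphereP5 f n c) hemisphere equator := by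
  have hCc := (contDiff_homC c).continuous
  have hAc := contDiff_homA.continuous
  have hBc := contDiff_homB.continuous
  have hc0 := abs_nonneg c
  obtain ⟨δ, hδ0, hδ1, hδ2⟩ : ∃ δ : ℝ, 0 < δ ∧ δ ≤ 1 / 8 ∧ |c| * δ ≤ 1 / 8 := by
    refine ⟨1 / (8 * (1 + |c|)), by positivity, ?_, ?_⟩
    · exact one_div_le_one_div_of_le (by norm_num) (by linarith)
    · rw [mul_one_div, div_le_div_iff₀ (by positivity) (by norm_num)]
      linarith
  -- On the hemisphere C* ≤ 2 + |c|, so Z⁴ ≤ εC* implies Z² ≤ δ; δ is so small that C* ≥ 1/2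
  -- follows.
  set ε := δ ^ 2 / (2 + |c|) with hε
  have hε0 : 0 < ε := by positivity
  have hεδ : ε * (2 + |c|) = δ ^ 2 := div_mul_cancel₀ _ (by positivity)
  set K : Set (Fin 3 → ℝ) := hemisphere ∩ {u | u 2 ^ 4 ≤ ε * homC c u} with hKdef
  have hK : IsCompact K := isCompact_hemisphere.inter_right
    (isClosed_le (by fun_prop) (by fun_prop))
  have hest : ∀ u ∈ K, u 2 ^ 2 ≤ δ ∧ 1 / 2 ≤ homC c u := by
    rintro u ⟨⟨h1, -⟩, h2⟩
    have h2 : u 2 ^ 4 ≤ ε * homC c u := h2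
    have a0 := sq_nonneg (u 0)
    have a1 := sq_nonneg (u 1)
    have a2 := sq_nonneg (u 2)
    have e4 : u 2 ^ 4 = (u 2 ^ 2) ^ 2 := by ring
    have hCeq : homC c u = (1 - u 2 ^ 2) ^ 2 + (u 0 ^ 2 - u 1 ^ 2) * u 2 ^ 2 -
        c * (u 2 ^ 2) ^ 2 := by
      rw [← h1]
      unfold homC
      ring
    rw [e4] at h2
    set z := u 2 ^ 2
    have hz1 : z ≤ 1 := by linarith
    have hcz := abs_le.mp (abs_mul c (z ^ 2)).le
    rw [abs_of_nonneg (sq_nonneg z)] at hcz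
    have hb1 : (u 0 ^ 2 - u 1 ^ 2) * z ≤ z := by nlinarith
    have hb2 : -z ≤ (u 0 ^ 2 - u 1 ^ 2) * z := by nlinarith
    have hzz : z ^ 2 ≤ 1 := by nlinarith
    have hup : homC c u ≤ 2 + |c| := by
      rw [hCeq]
      nlinarith [mul_le_mul_of_nonneg_left hzz hc0]
    have hz2 : z ^ 2 ≤ δ ^ 2 := by
      rw [← hεδ]
      exact h2.trans (mul_le_mul_of_nonneg_left hup hε0.le)
    have hzδ : z ≤ δ := (abs_le_of_sq_le_sq' hz2 hδ0.le).2
    refine ⟨hzδ, ?_⟩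
    rw [hCeq]
    have hcz2 : |c| * z ^ 2 ≤ 1 / 8 := by
      have h3 := mul_le_mul_of_nonneg_left hz2 hc0
      nlinarith
    nlinarith
  refine isAttractingLimitCycle_of_lyapunov (contDiff_sphereP5 hf n c) (isCycle_equator hf hpos)
    hK inter_subset_left (U := {u | u 2 ^ 4 < ε * homC c u})
    (V := fun u => u 2 ^ 4 / homC c u)
    (D := fun u => -(2 * u 2 ^ n * (homA u ^ 2 + homB u ^ 2) * (u 2 ^ 4 / homC c u)))
    ?_ ?_ ?_ ?_ ?_ ?_ ?_ ?_ ?_ ?_ ?_ ?_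
  · intro u hu
    refine ⟨equator_subset_hemisphere hu, ?_⟩
    obtain ⟨h1, h2⟩ := hu
    change u 2 ^ 4 ≤ ε * homC c u
    simp only [homC, h1, h2]
    nlinarith
  · exact isOpen_lt (by fun_prop) (by fun_prop)
  · rintro u ⟨h1, h2⟩
    change u 2 ^ 4 < ε * homC c u
    simp only [homC, h1, h2]
    nlinarith
  · rintro u ⟨h1, h2⟩
    exact ⟨h2, (show u 2 ^ 4 < ε * homC c u from h1).le⟩
  · intro χ γ hχ hχ0 hγ h0
    have hγc : Continuous γ := continuous_iff_continuousAt.mpr fun t => (hγ t).continuousAt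
    have hχc : Continuous fun t => χ (γ t) := hχ.continuous.comp hγc
    obtain ⟨hs, e, he0, he⟩ := sphere_invariants (k := fun t => χ (γ t)) hf hχc hγ h0.1.1
    have hZ : ∀ t, 0 ≤ γ t 2 := fun t => by
      rw [he t]
      exact mul_nonneg h0.1.2 (he0 t).le
    have hrc := (continuous_radialRate hf n c).comp hγc
    -- The trapping condition is kept in the form Z⁴ - εC* ≤ 0, which needs no division by C* before
    -- the trajectory is known to stay in K.
    have hgc : ∀ t, 0 ≤ t → γ t 2 ^ 4 - ε * homC c (γ t) ≤ 0 := by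
      intro t ht
      refine nonpos_of_deriv_le_mul
        (g := fun t => γ t 2 ^ 4 - ε * homC c (γ t))
        (a := fun t => χ (γ t) * (2 * γ t 2 ^ n * (homA (γ t) ^ 2 + homB (γ t) ^ 2) -
          4 * radialRate f n c (γ t))) ?_
        (fun t => (hasDerivAt_pow_four_of_sphereP5 (hγ t)).sub
          ((hasDerivAt_homC_of_sphereP5 (hγ t)).const_mul ε)) (fun t _ => ?_) ?_ ht
      · refine hχc.mul (Continuous.sub ?_ (continuous_const.mul hrc))
        fun_prop
      · have h1 := hχ0 (γ t)
        have h2 := hZ t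
        have h3 : 0 ≤ χ (γ t) * (2 * γ t 2 ^ n * (homA (γ t) ^ 2 + homB (γ t) ^ 2)) * γ t 2 ^ 4 := by
          positivity
        refine le_of_sub_nonneg (h3.trans_eq ?_)
        ring
      · have : γ 0 2 ^ 4 ≤ ε * homC c (γ 0) := h0.2
        linarith
    intro t ht
    exact ⟨⟨hs t, hZ t⟩, sub_nonpos.mp (hgc t ht)⟩
  · exact ContinuousOn.div (Continuous.continuousOn (by fun_prop)) hCc.continuousOn
      fun u hu => by linarith [(hest u hu).2]
  · refine ContinuousOn.neg (ContinuousOn.mul (Continuous.continuousOn (by fun_prop)) ?_)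
    exact ContinuousOn.div (Continuous.continuousOn (by fun_prop)) hCc.continuousOn
      fun u hu => by linarith [(hest u hu).2]
  · intro u hu
    have h1 := (hest u hu).2
    have h2 : 0 < homC c u := by linarith
    positivity
  · intro u hu
    have h1 := (hest u hu).2
    have h2 : 0 < homC c u := by linarith
    have h3 := hu.1.2
    have : 0 ≤ 2 * u 2 ^ n * (homA u ^ 2 + homB u ^ 2) * (u 2 ^ 4 / homC c u) := by positivity
    linarith
  · intro u hu h0
    have h1 := (hest u hu).1
    have h2 := hu.1.1
    by_contra hV
    have hZ : u 2 ≠ 0 := fun h => hV (by simp [h])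
    have h3 : 2 * u 2 ^ n * (homA u ^ 2 + homB u ^ 2) = 0 :=
      (mul_eq_zero.mp (neg_eq_zero.mp h0)).resolve_right hV
    -- Off the equator A* = B* = 0 forces X = 0, and then Y = 0 or 2Y² = Z²; on the sphere both
    -- contradict Z² ≤ δ ≤ 1/8.
    have h4 : homA u ^ 2 + homB u ^ 2 = 0 := (mul_eq_zero.mp h3).resolve_left (by positivity)
    have hA : homA u = 0 := by nlinarith [sq_nonneg (homA u), sq_nonneg (homB u)]
    have hB : homB u = 0 := by nlinarith [sq_nonneg (homA u), sq_nonneg (homB u)]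
    have hX : u 0 = 0 := (mul_eq_zero.mp hA).resolve_right (by positivity)
    rw [hX] at h2
    rcases mul_eq_zero.mp hB with h5 | h5
    · rw [h5] at h2
      nlinarith
    · rw [hX] at h5
      nlinarith
  · intro u hu h0
    have h1 := (hest u hu).2
    have hZ : u 2 ^ 4 = 0 := (div_eq_zero_iff.mp h0).resolve_right (by linarith)
    have hZ0 : u 2 = 0 := pow_eq_zero_iff four_ne_zero |>.mp hZ
    have h2 := hu.1.1
    rw [hZ0] at h2
    exact ⟨by linarith, hZ0⟩
  · intro γ t hmem h
    have h' : HasDerivAt γ ((1 : ℝ) • sphereP5 f n c (γ t)) t := by rwa [one_smul]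
    have h1 := (hest _ hmem).2
    have h2 : homC c (γ t) ≠ 0 := by linarith
    refine ((hasDerivAt_pow_four_of_sphereP5 h').div (hasDerivAt_homC_of_sphereP5 h')
      h2).congr_deriv ?_
    field_simp
    ring

theorem hasAttractingLimitCycleAtInfinity_p5 {n : ℕ} {W : MvPolynomial (Fin 2) ℝ}
    (hW : W.totalDegree ≤ n + 4) (c : ℝ)
    (hpos : ∀ v : Fin 2 → ℝ, v ≠ 0 →
      0 < MvPolynomial.eval v (MvPolynomial.homogeneousComponent (n + 4) W)) :
    HasAttractingLimitCycleAtInfinity (p5X W c) (p5Y W c) := by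
  have heq : poincareField (p5X W c) (p5Y W c) = sphereP5 (homogenized (n + 4) W) n c := by
    funext u
    simp only [poincareField, max_totalDegree_p5 hW c hpos, (homogenized_p5 hW c u).1,
      (homogenized_p5 hW c u).2, sphereP5]
  unfold HasAttractingLimitCycleAtInfinity
  rw [heq]
  refine isAttractingLimitCycle_equator (contDiff_homogenized _ _) fun u hu => ?_
  rw [homogenized_of_eq_zero _ _ hu.2]
  refine hpos _ fun h => ?_
  have h0 : u 0 = 0 := by simpa using congrFun h 0
  have h1 : u 1 = 0 := by simpa using congrFun h 1
  have h2 := hu.1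
  rw [h0, h1] at h2
  norm_num at h2

end Infinity

/-! ### Completeness of the lists of cycles and homoclinic orbits -/

section Classification

variable {w : (Fin 2 → ℝ) → ℝ} {c : ℝ}

/-- A cycle is determined by any of its points. -/
theorem isCycle_eq_of_mem (hw : ContDiff ℝ 1 w) {Γ Γ' : Set (Fin 2 → ℝ)}
    (h : IsCycle (fieldP5 w c) Γ) (h' : IsCycle (fieldP5 w c) Γ') {v : Fin 2 → ℝ} (hv : v ∈ Γ)
    (hv' : v ∈ Γ') : Γ = Γ' := by
  obtain ⟨γ, T, hγ, -, -, -, rfl⟩ := h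
  obtain ⟨η, T', hη, -, -, -, rfl⟩ := h'
  obtain ⟨t, rfl⟩ := hv
  exact (range_eq_of_mem_range (contDiff_fieldP5 hw c) (solvesOn_univ_iff.mp hγ)
    (solvesOn_univ_iff.mp hη) hv').choose_spec.2

theorem exists_mem_level_of_isCycle (hw : ContDiff ℝ 1 w) (hpos : ∀ v, 0 < w v)
    {Γ : Set (Fin 2 → ℝ)} (h : IsCycle (fieldP5 w c) Γ) :
    ∃ v ∈ Γ, levelH v = c ∧ coeffS v ≠ 0 := by
  obtain ⟨γ, T, hγ, hT, hper, hne, rfl⟩ := h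
  exact ⟨γ 0, ⟨0, rfl⟩, level_of_isCycle hw hpos (solvesOn_univ_iff.mp hγ) hT hper hne 0⟩

theorem not_isCycle_of_le (hw : ContDiff ℝ 1 w) (hpos : ∀ v, 0 < w v) (hc : c ≤ -(1 / 4))
    (Γ : Set (Fin 2 → ℝ)) : ¬ IsCycle (fieldP5 w c) Γ := fun h => by
  obtain ⟨v, -, hv, hS⟩ := exists_mem_level_of_isCycle hw hpos h
  exact hS (coeffS_eq_zero_of_level_le (hv.trans_le hc))

theorem isCycle_of_isRepellingLimitCycle {Γ : Set (Fin 2 → ℝ)}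
    (h : IsRepellingLimitCycle (fieldP5 w c) univ Γ) : IsCycle (fieldP5 w c) Γ := by
  simpa using isCycle_neg h.2.1

/-- The limit equilibrium lies on C = 0, so c is 0 or -1/4; at level -1/4 the curve consists of
equilibria only. -/
theorem not_isHomoclinicOrbit (hw : ContDiff ℝ 1 w) (hpos : ∀ v, 0 < w v) (hc : c ≠ 0)
    (p : Fin 2 → ℝ) (Γ : Set (Fin 2 → ℝ)) : ¬ IsHomoclinicOrbit (fieldP5 w c) p Γ := by
  rintro ⟨hp, γ, hγ, hne, htop, hbot, -⟩
  rw [solvesOn_univ_iff] at hγ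
  have h1 := level_eq_of_homoclinic hw hpos hγ hne htop hbot
  have h2 := level_of_homoclinic hw hpos hγ hne htop hbot 0
  rw [fieldP5_eq_zero_iff hpos, coeffS_eq_zero_iff] at hp
  have h3 : c = -(1 / 4) := by
    rcases hp with rfl | rfl | rfl
    · exact absurd (h1.symm.trans levelH_zero) hc
    · exact h1.symm.trans levelH_upperPoint
    · exact h1.symm.trans levelH_lowerPoint
  exact h2.2 (coeffS_eq_zero_of_level_le (h2.1.trans h3).le)

/-- The points of the lemniscate other than the origin lie on one of its halves. -/
theorem mem_half_of_levelH_eq_zero {v : Fin 2 → ℝ} (h : levelH v = 0) (hv : v ≠ 0) :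
    0 < v 1 ∨ v 1 < 0 := by
  rcases lt_trichotomy (v 1) 0 with h1 | h1 | h1
  · exact Or.inr h1
  · exact absurd (eq_zero_of_levelH_eq_zero h h1) hv
  · exact Or.inl h1

theorem exists_homoclinic_half (hw : ContDiff ℝ 1 w) (hpos : ∀ v, 0 < w v) {v : Fin 2 → ℝ}
    (h : levelH v = 0) (hS : coeffS v ≠ 0) :
    ∃ Γ, (Γ = {v | levelH v = 0 ∧ 0 < (1 : ℝ) * v 1} ∨ Γ = {v | levelH v = 0 ∧ 0 < (-1 : ℝ) * v 1}) ∧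
      v ∈ Γ ∧ IsHomoclinicOrbit (fieldP5 w 0) 0 Γ := by
  have hv : v ≠ 0 := by
    rintro rfl
    exact hS ((coeffS_eq_zero_iff 0).mpr (Or.inl rfl))
  rcases mem_half_of_levelH_eq_zero h hv with h1 | h1
  · exact ⟨_, Or.inl rfl, ⟨h, by linarith⟩, isHomoclinicOrbit_half hw hpos (one_pow 2)⟩
  · exact ⟨_, Or.inr rfl, ⟨h, by linarith⟩, isHomoclinicOrbit_half hw hpos (by norm_num)⟩

theorem isHomoclinicOrbit_zero_eq (hw : ContDiff ℝ 1 w) (hpos : ∀ v, 0 < w v) {p : Fin 2 → ℝ}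
    {Γ : Set (Fin 2 → ℝ)} (h : IsHomoclinicOrbit (fieldP5 w 0) p Γ) :
    p = 0 ∧ (Γ = {v | levelH v = 0 ∧ 0 < (1 : ℝ) * v 1} ∨
      Γ = {v | levelH v = 0 ∧ 0 < (-1 : ℝ) * v 1}) := by
  obtain ⟨hp, γ, hγ, hne, htop, hbot, rfl⟩ := h
  rw [solvesOn_univ_iff] at hγ
  have h1 := level_eq_of_homoclinic hw hpos hγ hne htop hbot
  obtain ⟨h2, h3⟩ := level_of_homoclinic hw hpos hγ hne htop hbot 0
  rw [fieldP5_eq_zero_iff hpos, coeffS_eq_zero_iff] at hp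
  constructor
  · rcases hp with rfl | rfl | rfl
    · rfl
    · rw [levelH_upperPoint] at h1
      norm_num at h1
    · rw [levelH_lowerPoint] at h1
      norm_num at h1
  · obtain ⟨Γ', hΓ', hmem, -, η, hη, -, -, -, rfl⟩ := exists_homoclinic_half hw hpos h2 h3
    rw [solvesOn_univ_iff] at hη
    rw [(range_eq_of_mem_range (contDiff_fieldP5 hw 0) hγ hη hmem).choose_spec.2]
    exact hΓ'

/-- A cycle would coincide with one of the homoclinic orbits, and a periodic function with a limit
at infinity is constant. -/
theorem not_isCycle_zero (hw : ContDiff ℝ 1 w) (hpos : ∀ v, 0 < w v) (Γ : Set (Fin 2 → ℝ)) :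
    ¬ IsCycle (fieldP5 w 0) Γ := by
  rintro ⟨γ, T, hγ, hT, hper, ⟨a, ha⟩, rfl⟩
  rw [solvesOn_univ_iff] at hγ
  obtain ⟨h2, h3⟩ := level_of_isCycle hw hpos hγ hT hper ⟨a, ha⟩ 0
  obtain ⟨Γ', hΓ', hmem, -, η, hη, -, htop, -, rfl⟩ := exists_homoclinic_half hw hpos h2 h3
  obtain ⟨b, rfl, -⟩ := range_eq_of_mem_range (contDiff_fieldP5 hw 0) hγ
    (solvesOn_univ_iff.mp hη) hmem
  have hlim : Tendsto (fun t => η (t + b)) atTop (𝓝 0) :=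
    htop.comp (tendsto_atTop_add_const_right _ b tendsto_id)
  have hzero : ∀ t, η (t + b) = 0 := fun t => by
    have h4 : Tendsto (fun n : ℕ => t + n * T) atTop atTop :=
      tendsto_atTop_add_const_left _ _ (tendsto_natCast_atTop_atTop.atTop_mul_const hT)
    refine tendsto_nhds_unique (tendsto_const_nhds.congr fun n => ?_) (hlim.comp h4)
    exact (hper.nat_mul n t).symm
  exact ha ((hzero a).trans (hzero 0).symm)

end Classification

/-! ### The full portrait and the system R5 -/

theorem hasPortraitP5_of_posDef {N : ℕ} {W : MvPolynomial (Fin 2) ℝ} (hdeg : W.totalDegree = N)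
    (hN : 4 ≤ N) (hpos : ∀ v : Fin 2 → ℝ, 0 < MvPolynomial.eval v W)
    (htop : ∀ v : Fin 2 → ℝ, v ≠ 0 →
      0 < MvPolynomial.eval v (MvPolynomial.homogeneousComponent N W)) (c : ℝ) :
    HasPortraitP5 (p5X W c) (p5Y W c) c := by
  obtain ⟨n, rfl⟩ := Nat.exists_eq_add_of_le' hN
  have hinf := hasAttractingLimitCycleAtInfinity_p5 hdeg.le c htop
  have hF := planarField_p5 W c
  have hw := contDiff_eval W
  replace hpos : ∀ v, 0 < (fun v : Fin 2 → ℝ => MvPolynomial.eval v W) v := hpos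
  -- In the plane W matters only as a positive C¹ function; the part at infinity, where its top form
  -- enters, is already settled.
  generalize (fun v : Fin 2 → ℝ => MvPolynomial.eval v W) = w at hF hw hpos
  have hσ : (-1 : ℝ) ^ 2 = 1 := by norm_num
  have hup : ∀ c : ℝ, curveC c ∩ {v | 0 < v 1} = {v | levelH v = c ∧ 0 < (1 : ℝ) * v 1} :=
    fun c => by
      rw [curveC_eq]
      ext v
      simp
  have hlo : ∀ c : ℝ, curveC c ∩ {v | v 1 < 0} = {v | levelH v = c ∧ 0 < (-1 : ℝ) * v 1} :=
    fun c => by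
      rw [curveC_eq]
      ext v
      simp
  constructor
  all_goals try rw [hF]
  · intro v
    rw [fieldP5_eq_zero_iff hpos, coeffS_eq_zero_iff]
  · exact isSaddle_fieldP5 hw hpos c
  · intro hc
    have hc : c ≤ -(1 / 4) := by linarith
    rw [← spiralPoint_one, ← spiralPoint_neg_one]
    exact ⟨isUnstableSpiral_of_le hw hpos hc (one_pow 2), isUnstableSpiral_of_le hw hpos hc hσ⟩
  · intro hc
    have hc : -(1 / 4) < c := by linarith
    rw [← spiralPoint_one, ← spiralPoint_neg_one]
    exact ⟨isStableSpiral_of_lt hw hpos hc (one_pow 2), isStableSpiral_of_lt hw hpos hc hσ⟩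
  · intro γ s hs hγ t₀ ht₀ h0 t ht
    rw [curveC_eq] at h0 ⊢
    exact mem_curveC_of_solvesOn hs hγ ht₀ ht h0
  · intro hc
    exact not_isCycle_of_le hw hpos (by linarith)
  · intro hc hc0
    have hc : -(1 / 4) < c := by linarith
    have hr1 := isRepellingLimitCycle_half hw hpos hc hc0 (one_pow 2)
    have hr2 := isRepellingLimitCycle_half hw hpos hc hc0 hσ
    have hg1 := halfGauge_eq_zero_iff (one_pow 2) hc0
    have hg2 := halfGauge_eq_zero_iff hσ hc0
    have hs1 := surrounds_of_neg (continuous_halfGauge c 1) hg1 (isBounded_halfGauge_neg c 1)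
      (halfGauge_spiralPoint_neg (one_pow 2) hc)
    have hs2 := surrounds_of_neg (continuous_halfGauge c (-1)) hg2 (isBounded_halfGauge_neg c (-1))
      (halfGauge_spiralPoint_neg hσ hc)
    have hn1 := not_surrounds_spiralPoint_neg (one_pow 2) hg1
    have hn2 := not_surrounds_spiralPoint_neg hσ hg2
    rw [spiralPoint_one] at hs1
    rw [spiralPoint_neg_one] at hs2 hn1
    rw [neg_neg, spiralPoint_one] at hn2
    have hcase : ∀ v : Fin 2 → ℝ, levelH v = c → 0 < v 1 ∨ v 1 < 0 := fun v hv => by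
      rcases lt_trichotomy (v 1) 0 with h1 | h1 | h1
      · exact Or.inr h1
      · have h2 := levelH_of_apply_one_eq_zero h1
        have : 0 ≤ levelH v := by rw [h2]; positivity
        linarith
      · exact Or.inl h1
    refine ⟨_, _, rfl, rfl, ?_, ?_⟩
    · rw [← inter_union_distrib_left, inter_eq_left]
      intro v hv
      rw [curveC_eq] at hv
      exact hcase v hv
    rw [hup, hlo]
    refine ⟨hr1, hr2, hs1, hn1, not_surrounds_zero (one_pow 2) hc0 hg1, hs2, hn2,
      not_surrounds_zero hσ hc0 hg2, fun Γ hΓ => ?_⟩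
    obtain ⟨v, hv, hvc, -⟩ := exists_mem_level_of_isCycle hw hpos hΓ
    rcases hcase v hvc with h1 | h1
    · exact Or.inl (isCycle_eq_of_mem hw hΓ (isCycle_of_isRepellingLimitCycle hr1) hv
        ⟨hvc, by linarith⟩)
    · exact Or.inr (isCycle_eq_of_mem hw hΓ (isCycle_of_isRepellingLimitCycle hr2) hv
        ⟨hvc, by linarith⟩)
  · rintro rfl
    have hc : -(1 / 4) < (0 : ℝ) := by norm_num
    have hg1 := halfGauge_zero_eq_zero_iff (one_pow 2)
    have hg2 := halfGauge_zero_eq_zero_iff hσ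
    have hs1 := surrounds_of_neg (continuous_halfGauge 0 1) hg1 (isBounded_halfGauge_neg 0 1)
      (halfGauge_spiralPoint_neg (one_pow 2) hc)
    have hs2 := surrounds_of_neg (continuous_halfGauge 0 (-1)) hg2 (isBounded_halfGauge_neg 0 (-1))
      (halfGauge_spiralPoint_neg hσ hc)
    have hn1 := not_surrounds_spiralPoint_neg (one_pow 2) hg1
    have hn2 := not_surrounds_spiralPoint_neg hσ hg2
    rw [spiralPoint_one] at hs1
    rw [spiralPoint_neg_one] at hs2 hn1
    rw [neg_neg, spiralPoint_one] at hn2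
    refine ⟨_, _, rfl, rfl, ?_, ?_⟩
    · rw [← inter_union_distrib_left, curveC_eq]
      ext v
      constructor
      · rintro (rfl | h)
        · exact levelH_zero
        · exact h.1
      · intro h
        by_cases hv : v = 0
        · exact Or.inl hv
        · exact Or.inr ⟨h, mem_half_of_levelH_eq_zero h hv⟩
    rw [hup, hlo]
    exact ⟨isHomoclinicOrbit_half hw hpos (one_pow 2), isHomoclinicOrbit_half hw hpos hσ,
      hs1, hn1, hs2, hn2, fun p Γ h => isHomoclinicOrbit_zero_eq hw hpos h,
      not_isCycle_zero hw hpos⟩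
  · intro hc
    have hr := isRepellingLimitCycle_curve hw hpos hc
    rw [curveC_eq]
    refine ⟨hr, fun v hv => ?_, surrounds_curve (by rwa [levelH_zero]),
      surrounds_curve (by rw [levelH_upperPoint]; linarith),
      surrounds_curve (by rw [levelH_lowerPoint]; linarith), fun Γ hΓ => ?_⟩
    · have h1 : levelH (-v) = levelH v := by simp [levelH]
      exact h1.trans hv
    · obtain ⟨v, hv, hvc, -⟩ := exists_mem_level_of_isCycle hw hpos hΓ
      exact isCycle_eq_of_mem hw hΓ (isCycle_of_isRepellingLimitCycle hr) hv hvc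
  · exact not_isHomoclinicOrbit hw hpos
  · exact hinf

open MvPolynomial in
theorem weightR5_props : weightR5.totalDegree = 4 ∧ (∀ v : Fin 2 → ℝ, 0 < eval v weightR5) ∧
    ∀ v : Fin 2 → ℝ, v ≠ 0 → 0 < eval v (homogeneousComponent 4 weightR5) := by
  have h4 : ∀ i : Fin 2, (X i ^ 4 : MvPolynomial (Fin 2) ℝ).IsHomogeneous 4 := fun i => by
    simpa using (isHomogeneous_X ℝ i).pow 4
  have hcomp : homogeneousComponent 4 weightR5 = X 0 ^ 4 + X 1 ^ 4 := by
    have h1 : homogeneousComponent 4 (1 : MvPolynomial (Fin 2) ℝ) = 0 :=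
      homogeneousComponent_eq_zero _ _ (by simp)
    have h2 := homogeneousComponent_eq_self (h4 0)
    have h3 := homogeneousComponent_eq_self (h4 1)
    rw [weightR5, map_add, map_add, h1, h2, h3, add_zero]
  have hpos : ∀ v : Fin 2 → ℝ, v ≠ 0 → 0 < eval v (homogeneousComponent 4 weightR5) := by
    intro v hv
    rw [hcomp]
    simp only [map_add, map_pow, eval_X]
    by_contra! hle
    have e0 : v 0 ^ 4 = 0 := by
      have h0 : 0 ≤ v 0 ^ 4 := by positivity
      have h1 : 0 ≤ v 1 ^ 4 := by positivity
      linarith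
    have e1 : v 1 ^ 4 = 0 := by
      have h1 : 0 ≤ v 1 ^ 4 := by positivity
      linarith
    refine hv (funext fun i => ?_)
    fin_cases i
    · exact pow_eq_zero_iff four_ne_zero |>.mp e0
    · exact pow_eq_zero_iff four_ne_zero |>.mp e1
  refine ⟨le_antisymm ?_ ?_, fun v => ?_, hpos⟩
  · have h : ∀ i : Fin 2, (X i ^ 4 : MvPolynomial (Fin 2) ℝ).totalDegree ≤ 4 :=
      fun i => (totalDegree_X_pow i 4).le
    exact (totalDegree_add _ _).trans (max_le ((totalDegree_add _ _).trans (max_le (h 0) (h 1)))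
      (by simp))
  · by_contra! hlt
    have h1 := hpos ![1, 0] fun h => by simpa using congrFun h 0
    rw [homogeneousComponent_eq_zero _ _ hlt, map_zero] at h1
    exact h1.false
  · simp only [weightR5, map_add, map_pow, eval_X, map_one]
    positivity

end

theorem theorem4 :
    (∀ (N : ℕ) (W : MvPolynomial (Fin 2) ℝ), W.totalDegree = N → 4 ≤ N →
      (∀ v : Fin 2 → ℝ, 0 < MvPolynomial.eval v W) →
      (∀ v : Fin 2 → ℝ, v ≠ 0 →
        0 < MvPolynomial.eval v (MvPolynomial.homogeneousComponent N W)) →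
      ∀ c : ℝ, HasPortraitP5 (p5X W c) (p5Y W c) c) ∧
    ∀ c : ℝ, HasPortraitP5 (p5X weightR5 c) (p5Y weightR5 c) c :=
  ⟨fun _ _ hdeg hN hpos htop c => hasPortraitP5_of_posDef hdeg hN hpos htop c,
    fun c => hasPortraitP5_of_posDef weightR5_props.1 le_rfl weightR5_props.2.1
      weightR5_props.2.2 c⟩
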